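/- For $\tau:\mathbb Z^3\to\mathbb C$ write $\tilde\tau,\hat\tau,\dot\tau$ for the shifts $k\mapsto k+1$, $l\mapsto l+1$, $m\mapsto m+1$ of $\tau(k,l,m)$ and under-accents for the inverse shifts. The dual AKP (DAKP) equation with parameters $a_1,\dots,a_4\in\mathbb C$ is $$a_1\Big(\tfrac{\tau(k-1,l+1,m+1)}{\hat{\dot\tau}\hat\tau\dot\tau}-\tfrac{\tilde{\tilde\tau}}{\tilde\tau\tilde{\hat\tau}\tilde{\dot\tau}}\Big)+a_2\Big(\tfrac{\tau(k+1,l-1,m+1)}{\tilde{\dot\tau}\tilde\tau\dot\tau}-\tfrac{\hat{\hat\tau}}{\hat\tau\hat{\dot\tau}\tilde{\hat\tau}}\Big)+a_3\Big(\tfrac{\tau(k+1,l+1,m-1)}{\tilde{\hat\tau}\tilde\tau\hat\tau}-\tfrac{\dot{\dot\tau}}{\dot\tau\tilde{\dot\tau}\hat{\dot\tau}}\Big)+a_4\Big(\tfrac{\tau}{\tilde\tau\hat\tau\dot\tau}-\tfrac{\tilde{\hat{\dot\tau}}}{\tilde{\hat\tau}\hat{\dot\tau}\tilde{\dot\tau}}\Big)=0,$$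 required wherever no denominator vanishes. The N-soliton form with data $x_i,y_i,z_i,c_i$ and $R_{ij}$ is $$\tau(k,l,m)=\sum_{w\subseteq\{1,\dots,N\}}\Big(\prod_{i<j\in w}R_{ij}\Big)\prod_{i\in w}c_i\,x_i^k y_i^l z_i^m .$$ Put $$\begin{aligned}Q(x,y,z)=\;&yz(x-1)(x-y)(x-z)a_1+xz(y-1)(y-x)(y-z)a_2\\&+xy(z-1)(z-x)(z-y)a_3+xyz(x-1)(y-1)(z-1)a_4,\end{aligned}$$ $x_{ij}=x_ix_j$ etc., and $R_{ij}=\dfrac{a_1S_1+a_2S_2+a_3S_3+a_4S_4}{Q(x_{ij},y_{ij},z_{ij})}$, where $$\begin{aligned}S_1=\big(&(x_i-x_j)(x_jy_i-y_jx_i)(x_{ij}-z_{ij})+(x_i-x_j)(x_jz_i-z_jx_i)(x_{ij}-y_{ij})\\&+(x_jz_i-z_jx_i)(x_jy_i-y_jx_i)(1-x_{ij})\big)y_{ij}z_{ij},\end{aligned}$$ $S_2$ (resp. $S_3$) is $S_1$ with $x,y$ (resp. $x,z$) interchanged, and $$\begin{aligned}S_4=\big(&(1-x_{ij})(y_i-y_j)(z_i-z_j)+(x_i-x_j)(1-y_{ij})(z_i-z_j)\\&+(x_i-x_j)(y_i-y_j)(1-z_{ij})\big)x_{ij}y_{ij}z_{ij}.\end{aligned}$$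 **(1) Existence.** For all $a_1,\dots,a_4\in\mathbb C$, all $N$, all constants $c_i$ and all nonzero $x_i,y_i,z_i$ with $Q(x_i,y_i,z_i)=0$ and $Q(x_{ij},y_{ij},z_{ij})\ne0$ for $i<j$, the N-soliton form with the above $R_{ij}$ solves the DAKP equation. **(2) Miwa coordinates, all $a_i$ nonzero.** Let $A=(b+a)(c+a)(b-c)$, $B=(c+b)(b+a)(c-a)$, $C=(c+a)(c+b)(a-b)$, $D=(a-b)(b-c)(c-a)$. (a) If $A,B,C,D$ are nonzero, there are nonzero $g_1,g_2,g_3$ such that $\tau$ solves DAKP with $a'=(A^2,B^2,C^2,-D^2)$ if and only if $g_1^{lm}g_2^{km}g_3^{kl}\tau$ solves DAKP with $a_1,\dots,a_4$. (b) For any $a,b,c,p_i,q_i$ for which the following are finite and nonzero, let $X_i=\frac{(1-ap_i)(1-aq_i)}{(ap_i+1)(aq_i+1)}$, let $Y_i,Z_i$ be the same with $b$, $c$ in place of $a$, and put $x_i=Y_iZ_i$, $y_i=X_iZ_i$, $z_i=X_iY_i$. Then, with parameters $a'$, $Q(x_i,y_i,z_i)=0$, and for $i\neq j$ the DAKP term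 $R_{ij}$ (where $Q(x_{ij},y_{ij},z_{ij})\ne0$) equals $$\frac{(q_i-q_j)(q_i-p_j)(p_i-q_j)(p_i-p_j)}{(q_i+q_j)(q_i+p_j)(p_i+q_j)(p_i+p_j)}.$$ If these denominators are nonzero, the N-soliton form $\sigma$ with data $X_i,Y_i,Z_i$ and this $R_{ij}$ solves the BKP equation $A\tilde\sigma\hat{\dot\sigma}+B\hat\sigma\tilde{\dot\sigma}+C\dot\sigma\tilde{\hat\sigma}+D\sigma\tilde{\hat{\dot\sigma}}=0$; the one with data $x_i,y_i,z_i$ is $\sigma(l+m,k+m,k+l)$ and solves DAKP with $a'$. (c) Conversely, if $a,b,c,A,B,C,D\ne0$, every $(x,y,z)$ with nonzero entries and $Q(x,y,z)=0$ (parameters $a'$), not on the lines $\{x=1,y=z\}$, $\{y=1,x=z\}$, $\{z=1,x=y\}$, has this form for some $p,q$. **(3) Miwa coordinates, exactly one $a_i$ zero.** Now let $A=a(b-c)$, $B=b(c-a)$, $C=c(a-b)$, and let $a'=(0,C^2,B^2,-A^2)$, $(C^2,0,A^2,-B^2)$, $(B^2,A^2,0,-C^2)$, $(A^2,B^2,C^2,0)$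 according as $a_1$, $a_2$, $a_3$, $a_4$ is the vanishing parameter. Let $\varepsilon=(-1,1,1),(1,-1,1),(1,1,-1),(1,1,1)$ respectively. (a) If $A,B,C\neq0$, a gauge factor as in (2)(a) relates DAKP with $a'$ to DAKP with $a_1,\dots,a_4$. (b) With $X_i=\frac{1-aq_i}{1-ap_i}$, $Y_i=\frac{1-bq_i}{1-bp_i}$, $Z_i=\frac{1-cq_i}{1-cp_i}$ (finite and nonzero) and $x_i=Y_i^{\varepsilon_2}Z_i^{\varepsilon_3}$, $y_i=X_i^{\varepsilon_1}Z_i^{\varepsilon_3}$, $z_i=X_i^{\varepsilon_1}Y_i^{\varepsilon_2}$, one has $Q(x_i,y_i,z_i)=0$ with parameters $a'$, and for $i\neq j$ the DAKP term $R_{ij}$ (where $Q(x_{ij},y_{ij},z_{ij})\ne0$) equals $$-\frac{(q_i-q_j)(p_i-p_j)}{(p_j-q_i)(p_i-q_j)}.$$ If these denominators are nonzero, the N-soliton form $\sigma$ with data $X_i,Y_i,Z_i$ and this $R_{ij}$ solves the AKP equation $A\tilde\sigma\hat{\dot\sigma}+B\hat\sigma\tilde{\dot\sigma}+C\dot\sigma\tilde{\hat\sigma}=0$;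 the one with data $x_i,y_i,z_i$ is $\sigma(\varepsilon_1(l+m),\varepsilon_2(k+m),\varepsilon_3(k+l))$ and solves DAKP with $a'$. (c) Conversely, if $A,B,C\neq0$, every $(x,y,z)$ with nonzero entries and $Q(x,y,z)=0$ (parameters $a'$), not on the three lines in (2)(c), has this form for some $p,q$, or is of the limiting form $x=t^{\varepsilon_2+\varepsilon_3}$, $y=t^{\varepsilon_1+\varepsilon_3}$, $z=t^{\varepsilon_1+\varepsilon_2}$ with $t\ne0$. -/

import Mathlib

noncomputable section

namespace DualAKP

/-- Complex functions of three discrete variables. -/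
abbrev LatticeFun : Type := ℤ → ℤ → ℤ → ℂ

/-- Left-hand side of the dual AKP equation at `(k, l, m)`; the parameters
`a₁, a₂, a₃, a₄` are `α 0, α 1, α 2, α 3`. -/
def dakpLHS (α : Fin 4 → ℂ) (τ : LatticeFun) (k l m : ℤ) : ℂ :=
  α 0 * (τ (k - 1) (l + 1) (m + 1) / (τ k (l + 1) (m + 1) * τ k (l + 1) m * τ k l (m + 1))
      - τ (k + 2) l m / (τ (k + 1) l m * τ (k + 1) (l + 1) m * τ (k + 1) l (m + 1)))
  + α 1 * (τ (k + 1) (l - 1) (m + 1) / (τ (k + 1) l (m + 1) * τ (k + 1) l m * τ k l (m + 1))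
      - τ k (l + 2) m / (τ k (l + 1) m * τ k (l + 1) (m + 1) * τ (k + 1) (l + 1) m))
  + α 2 * (τ (k + 1) (l + 1) (m - 1) / (τ (k + 1) (l + 1) m * τ (k + 1) l m * τ k (l + 1) m)
      - τ k l (m + 2) / (τ k l (m + 1) * τ (k + 1) l (m + 1) * τ k (l + 1) (m + 1)))
  + α 3 * (τ k l m / (τ (k + 1) l m * τ k (l + 1) m * τ k l (m + 1))
      - τ (k + 1) (l + 1) (m + 1)
        / (τ (k + 1) (l + 1) m * τ k (l + 1) (m + 1) * τ (k + 1) l (m + 1)))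

/-- `τ` solves the dual AKP equation: the equation holds at every lattice point at which
none of the denominators vanishes. -/
def IsDAKPSolution (α : Fin 4 → ℂ) (τ : LatticeFun) : Prop :=
  ∀ k l m : ℤ,
    τ (k + 1) l m ≠ 0 → τ k (l + 1) m ≠ 0 → τ k l (m + 1) ≠ 0 →
    τ (k + 1) (l + 1) m ≠ 0 → τ (k + 1) l (m + 1) ≠ 0 → τ k (l + 1) (m + 1) ≠ 0 →
    dakpLHS α τ k l m = 0

/-- The lattice BKP equation. -/
def IsBKPSolution (A B C D : ℂ) (τ : LatticeFun) : Prop :=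
  ∀ k l m : ℤ,
    A * (τ (k + 1) l m * τ k (l + 1) (m + 1)) + B * (τ k (l + 1) m * τ (k + 1) l (m + 1))
      + C * (τ k l (m + 1) * τ (k + 1) (l + 1) m)
      + D * (τ k l m * τ (k + 1) (l + 1) (m + 1)) = 0

/-- The lattice AKP equation. -/
def IsAKPSolution (A B C : ℂ) (τ : LatticeFun) : Prop :=
  ∀ k l m : ℤ,
    A * (τ (k + 1) l m * τ k (l + 1) (m + 1)) + B * (τ k (l + 1) m * τ (k + 1) l (m + 1))
      + C * (τ k l (m + 1) * τ (k + 1) (l + 1) m) = 0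

/-- The N-soliton form: sum over subsets `w` of the index set, the interaction terms being
multiplied over the pairs `i < j` in `w`. -/
def nSoliton {N : ℕ} (R : Fin N → Fin N → ℂ) (c x y z : Fin N → ℂ) : LatticeFun :=
  fun k l m => ∑ w : Finset (Fin N),
    (∏ v ∈ (w ×ˢ w).filter (fun v => v.1 < v.2), R v.1 v.2)
      * (∏ i ∈ w, c i) * (∏ i ∈ w, x i) ^ k * (∏ i ∈ w, y i) ^ l * (∏ i ∈ w, z i) ^ m

/-- The dispersion polynomial `Q` of the dual AKP equation. -/
def dispQ (α : Fin 4 → ℂ) (x y z : ℂ) : ℂ :=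
  y * z * (x - 1) * (x - y) * (x - z) * α 0
  + x * z * (y - 1) * (y - x) * (y - z) * α 1
  + x * y * (z - 1) * (z - x) * (z - y) * α 2
  + x * y * z * (x - 1) * (y - 1) * (z - 1) * α 3

/-- `S₁^{ij}`, with `(x, y, z) = (x_i, y_i, z_i)` and `(x', y', z') = (x_j, y_j, z_j)`. -/
def S₁ (x y z x' y' z' : ℂ) : ℂ :=
  ((x - x') * (x' * y - y' * x) * (x * x' - z * z')
    + (x - x') * (x' * z - z' * x) * (x * x' - y * y')
    + (x' * z - z' * x) * (x' * y - y' * x) * (1 - x * x')) * (y * y') * (z * z')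

/-- `S₄^{ij}`. -/
def S₄ (x y z x' y' z' : ℂ) : ℂ :=
  ((1 - x * x') * (y - y') * (z - z')
    + (x - x') * (1 - y * y') * (z - z')
    + (x - x') * (y - y') * (1 - z * z')) * (x * x') * (y * y') * (z * z')

/-- The dual AKP interaction term `R_{ij}`. -/
def dakpR (α : Fin 4 → ℂ) (x y z x' y' z' : ℂ) : ℂ :=
  (α 0 * S₁ x y z x' y' z' + α 1 * S₁ y x z y' x' z' + α 2 * S₁ z y x z' y' x'
    + α 3 * S₄ x y z x' y' z') / dispQ α (x * x') (y * y') (z * z')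

/-- Multiplication by the gauge factor `g₁^{lm} g₂^{km} g₃^{kl}`. -/
def gaugeMul (g₁ g₂ g₃ : ℂ) (τ : LatticeFun) : LatticeFun :=
  fun k l m => g₁ ^ (l * m) * g₂ ^ (k * m) * g₃ ^ (k * l) * τ k l m

/-- The change of independent variables
`(k, l, m) ↦ (ε₁ (l + m), ε₂ (k + m), ε₃ (k + l))`. -/
def changeVars (ε : Fin 3 → ℤ) (σ : LatticeFun) : LatticeFun :=
  fun k l m => σ (ε 0 * (l + m)) (ε 1 * (k + m)) (ε 2 * (k + l))

/-! Miwa parametrisation of BKP. -/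

def bkpA (a b c : ℂ) : ℂ := (b + a) * (c + a) * (b - c)
def bkpB (a b c : ℂ) : ℂ := (c + b) * (b + a) * (c - a)
def bkpC (a b c : ℂ) : ℂ := (c + a) * (c + b) * (a - b)
def bkpD (a b c : ℂ) : ℂ := (a - b) * (b - c) * (c - a)

/-- The Miwa factor `(1 - ap)(1 - aq) / ((ap + 1)(aq + 1))` of BKP. -/
def bkpX (a p q : ℂ) : ℂ := ((1 - a * p) * (1 - a * q)) / ((a * p + 1) * (a * q + 1))

/-- The numerator and the denominator of `bkpX a p q` do not vanish. -/
def BKPRegular (a p q : ℂ) : Prop :=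
  1 - a * p ≠ 0 ∧ 1 - a * q ≠ 0 ∧ a * p + 1 ≠ 0 ∧ a * q + 1 ≠ 0

/-- The BKP interaction term in Miwa coordinates. -/
def bkpR (p q p' q' : ℂ) : ℂ :=
  ((q - q') * (q - p') * (p - q') * (p - p')) / ((q + q') * (q + p') * (p + q') * (p + p'))

/-- The dual AKP parameters `(A², B², C², -D²)` built from the BKP coefficients. -/
def bkpParams (a b c : ℂ) : Fin 4 → ℂ :=
  ![bkpA a b c ^ 2, bkpB a b c ^ 2, bkpC a b c ^ 2, -bkpD a b c ^ 2]

/-! Miwa parametrisation of AKP. -/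

def akpA (a b c : ℂ) : ℂ := a * (b - c)
def akpB (a b c : ℂ) : ℂ := b * (c - a)
def akpC (a b c : ℂ) : ℂ := c * (a - b)

/-- The Miwa factor `(1 - aq) / (1 - ap)` of AKP. -/
def akpX (a p q : ℂ) : ℂ := (1 - a * q) / (1 - a * p)

/-- The numerator and the denominator of `akpX a p q` do not vanish. -/
def AKPRegular (a p q : ℂ) : Prop := 1 - a * p ≠ 0 ∧ 1 - a * q ≠ 0

/-- The AKP interaction term in Miwa coordinates. -/
def akpR (p q p' q' : ℂ) : ℂ := -(((q - q') * (p - p')) / ((p' - q) * (p - q')))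

/-- The dual AKP parameters built from the AKP coefficients when the parameter with index `ν`
vanishes (`ν = 0, 1, 2, 3` for `a₁, a₂, a₃, a₄`). -/
def akpParams (ν : Fin 4) (a b c : ℂ) : Fin 4 → ℂ :=
  (![![0, akpC a b c ^ 2, akpB a b c ^ 2, -akpA a b c ^ 2],
     ![akpC a b c ^ 2, 0, akpA a b c ^ 2, -akpB a b c ^ 2],
     ![akpB a b c ^ 2, akpA a b c ^ 2, 0, -akpC a b c ^ 2],
     ![akpA a b c ^ 2, akpB a b c ^ 2, akpC a b c ^ 2, 0]] : Fin 4 → Fin 4 → ℂ) ν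

/-- The lattice direction that is reversed when the parameter with index `ν` vanishes
(none for `ν = 3`). -/
def reversal (ν : Fin 4) : Fin 3 → ℤ := fun i => if (i : ℕ) = (ν : ℕ) then -1 else 1

end DualAKP

end

open DualAKP

/-!
All soliton solutions come from one mechanism. Let `ξ` be an antisymmetric function of two points
such that the Pfaffian of its restriction to any four points is the product of its six values
(`IsPfaffianKernel`). Attach to each soliton two end points `p i`, `q i`, let the solitons interact
through the four values of `ξ` between end points, and let a lattice point `v` multiply the
amplitude of soliton `i` by `ξ v (p i) * ξ v (q i)`. Then the soliton sums dressed by words of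
lattice points obey a four-letter Pfaffian relation (`solitonSum_pfaffian`, by induction on the
number of solitons). With three letters for the lattice directions and a fourth one, `o`, this is
the BKP equation polarised in two functions `τ`, `φ` (`isMixedBKP_nSoliton`). If both `(τ, φ)` and
`(φ, τ)` satisfy the polarised equation, elimination over eight cubes around a site gives
`φ * (dual AKP expression of τ) = 0` in the variables `(l + m, k + m, k + l)`
(`IsMixedBKP.mul_dakpNum_eq_zero`), and analyticity in the amplitudes removes the factor `φ`.

BKP solitons belong to the rational kernel `(v - v') / (v + v')`, where `o = 0` gives `φ = τ`. AKP
solitons are limits of these, with the end points close to `1` and `-1`. Reversing one lattice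
direction permutes the four terms of the equation, which yields the four cases of one vanishing
parameter. The dispersion relation and the interaction term of the dual AKP equation are the first
coefficients, in the amplitudes, of the one- and two-soliton solutions. Conversely, `Q` factors into
two `3 × 3` determinants, and a kernel vector of the vanishing one determines `p` and `q`.

For general parameters the vacuum `τ = 1` is not the BKP vacuum, and the kernel is elliptic
(`isPfaffianKernel_ellKernel`): `ξ = (X Y' - X' Y) / (C (1 - X Y X' Y'))` on an affine elliptic
curve. Here `φ` is `τ` dressed at a generic point `o`, and the involution `(X, Y) ↦ (1 / X, 1 / Y)`
inverts the kernel, so that dressing at the image of `o` leads back from `φ` to `τ`. A generic point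
of the surface `Q = 0` is the triple of a soliton with two end points on the curve
(`exists_ellTriple`), and all remaining parameters, data and coincidences are reached by continuity,
because zeros of analytic functions persist under perturbation.
-/

namespace DualAKP

open Filter Topology

/-! ### Zeros of entire functions and of their perturbations -/

/-- An entire function that does not vanish identically has isolated zeros. -/
lemma eventually_ne_of_differentiable {f : ℂ → ℂ} (hf : Differentiable ℂ f) {w : ℂ}
    (hw : f w ≠ 0) (z : ℂ) : ∀ᶠ s in 𝓝[≠] z, f s ≠ 0 := by
  by_contra h
  have h' : ∃ᶠ s in 𝓝[≠] z, f s = 0 := h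
  have := (hf.differentiableOn.analyticOnNhd (s := Set.univ)
    isOpen_univ).eqOn_zero_of_preconnected_of_frequently_eq_zero isPreconnected_univ
    (Set.mem_univ z) h'
  exact hw (this (Set.mem_univ w))

lemma eq_zero_of_eventually_eq_zero {f : ℂ → ℂ} {z : ℂ} (hf : ContinuousAt f z)
    (h : ∀ᶠ s in 𝓝[≠] z, f s = 0) : f z = 0 := by
  have h1 : Tendsto f (𝓝[≠] z) (𝓝 (f z)) := hf.tendsto.mono_left nhdsWithin_le_nhds
  exact tendsto_nhds_unique h1 (tendsto_const_nhds.congr' (h.mono fun s hs => hs.symm))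

/-- If a product of two entire functions vanishes identically and the second factor does not,
then the first one does. -/
lemma eq_zero_of_mul_eq_zero_of_entire {f g : ℂ → ℂ} (hf : Differentiable ℂ f)
    (hg : Differentiable ℂ g) (hfg : ∀ s, f s * g s = 0) {w : ℂ} (hw : g w ≠ 0) (z : ℂ) :
    f z = 0 := by
  refine eq_zero_of_eventually_eq_zero hf.continuous.continuousAt ?_
  filter_upwards [eventually_ne_of_differentiable hg hw z] with s hs
  exact (mul_eq_zero.1 (hfg s)).resolve_right hs

/-- Zeros depend continuously on parameters: if `t₀` is a zero of `f p₀`, which is not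
identically zero, then `f p` has a zero near `t₀` for all `p` near `p₀`. -/
lemma eventually_exists_zero_near {P : Type*} [TopologicalSpace P] {f : P → ℂ → ℂ}
    (hf : Continuous (Function.uncurry f)) (hd : ∀ p, Differentiable ℂ (f p)) {p₀ : P} {t₀ w : ℂ}
    (h₀ : f p₀ t₀ = 0) (hw : f p₀ w ≠ 0) {U : Set ℂ} (hU : U ∈ 𝓝 t₀) :
    ∀ᶠ p in 𝓝 p₀, ∃ t ∈ U, f p t = 0 := by
  obtain ⟨ρ, hρ, hρU⟩ := Metric.nhds_basis_closedBall.mem_iff.1 hU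
  have hne := eventually_ne_of_differentiable (hd p₀) hw t₀
  rw [eventually_nhdsWithin_iff, Metric.eventually_nhds_iff] at hne
  obtain ⟨δ, hδ, hne⟩ := hne
  obtain ⟨r, hr, hrr⟩ : ∃ r > 0, r ≤ ρ ∧ r < δ :=
    ⟨min ρ (δ / 2), by positivity, min_le_left _ _,
      lt_of_le_of_lt (min_le_right _ _) (by linarith)⟩
  have hS : IsCompact (Metric.sphere t₀ r) := isCompact_sphere t₀ r
  have hSne : (Metric.sphere t₀ r).Nonempty := NormedSpace.sphere_nonempty.2 hr.le
  have hc0 : Continuous fun t => ‖f p₀ t‖ := (hd p₀).continuous.norm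
  obtain ⟨t₁, ht₁, hmin⟩ := hS.exists_isMinOn hSne hc0.continuousOn
  set m := ‖f p₀ t₁‖ with hm
  have hmpos : 0 < m := by
    refine norm_pos_iff.2 (hne (by rw [Metric.mem_sphere.1 ht₁]; exact hrr.2) ?_)
    rintro rfl
    simp at ht₁
    exact hr.ne ht₁
  -- on the circle `|f p| > 3m/4`, at the centre `|f p| < m/4`
  have h1 : ∀ᶠ p in 𝓝 p₀, ∀ t ∈ Metric.sphere t₀ r, 3 * m / 4 < ‖f p t‖ := by
    refine hS.eventually_forall_of_forall_eventually fun t ht => ?_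
    have : ContinuousAt (fun z : P × ℂ => ‖f z.1 z.2‖) (p₀, t) := hf.norm.continuousAt
    refine this.eventually (lt_mem_nhds ?_)
    have : m ≤ ‖f p₀ t‖ := isMinOn_iff.1 hmin t ht
    show 3 * m / 4 < ‖f p₀ t‖
    linarith
  have h2 : ∀ᶠ p in 𝓝 p₀, ‖f p t₀‖ < m / 4 := by
    have : ContinuousAt (fun p : P => ‖f p t₀‖) p₀ :=
      (hf.comp (continuous_id.prodMk continuous_const)).norm.continuousAt
    exact this.eventually (gt_mem_nhds (by simp [h₀]; linarith))
  filter_upwards [h1, h2] with p hp1 hp2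
  have hsub := ((hd p).diffContOnCl (s := Metric.ball t₀ r)).ball_subset_image_closedBall
    (ε := m / 2) hr
    (fun z hz => by
      have := hp1 z hz
      have h3 := norm_sub_norm_le (f p z) (f p t₀)
      linarith) ?_
  · have h0 : (0 : ℂ) ∈ Metric.ball (f p t₀) (m / 2 / 2) := by
      simp only [Metric.mem_ball, dist_zero_left]; linarith
    obtain ⟨t, ht, ht0⟩ := hsub h0
    exact ⟨t, hρU (Metric.closedBall_subset_closedBall hrr.1 ht), ht0⟩
  · -- `f p` is not locally constant at `t₀`, since it is larger on the circle
    have hz : f p t₁ - f p t₀ ≠ 0 := by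
      intro h
      have h3 := hp1 t₁ ht₁
      rw [sub_eq_zero.1 h] at h3
      linarith
    have := eventually_ne_of_differentiable ((hd p).sub_const (f p t₀)) hz t₀
    have : ∃ᶠ t in 𝓝 t₀, f p t - f p t₀ ≠ 0 :=
      (this.frequently).filter_mono nhdsWithin_le_nhds
    exact this.mono fun t ht => sub_ne_zero.1 ht

/-! ### Soliton sums and their bilinear identity -/

section SolitonSum

variable {ι : Type*} [LinearOrder ι]

/-- The product of the interaction terms over the pairs `i < j` in `w`. -/
def pairProd (R : ι → ι → ℂ) (w : Finset ι) : ℂ :=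
  ∏ v ∈ (w ×ˢ w).filter (fun v => v.1 < v.2), R v.1 v.2

/-- The soliton sum over the subsets of `s`, the soliton `i` having amplitude `c i`. -/
def solitonSum (R : ι → ι → ℂ) (s : Finset ι) (c : ι → ℂ) : ℂ :=
  ∑ w ∈ s.powerset, pairProd R w * ∏ i ∈ w, c i

lemma pairProd_insert (R : ι → ι → ℂ) {w : Finset ι} {a : ι} (h : ∀ i ∈ w, i < a) :
    pairProd R (insert a w) = pairProd R w * ∏ i ∈ w, R i a := by
  have ha : a ∉ w := fun h' => lt_irrefl a (h a h')
  simp only [pairProd, Finset.prod_filter, Finset.prod_product, Finset.prod_insert ha]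
  have h1 : ∀ i ∈ w, (if a < i then R a i else 1) = 1 := fun i hi => by
    rw [if_neg (h i hi).not_gt]
  rw [Finset.prod_congr rfl h1, if_neg (lt_irrefl a), Finset.prod_mul_distrib]
  have h2 : ∀ i ∈ w, (if i < a then R i a else 1) = R i a := fun i hi => by rw [if_pos (h i hi)]
  rw [Finset.prod_congr rfl h2]
  simp [mul_comm]

lemma pairProd_congr {R R' : ι → ι → ℂ} {w : Finset ι}
    (h : ∀ i ∈ w, ∀ j ∈ w, i < j → R i j = R' i j) : pairProd R w = pairProd R' w := by
  refine Finset.prod_congr rfl fun v hv => ?_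
  simp only [Finset.mem_filter, Finset.mem_product] at hv
  exact h _ hv.1.1 _ hv.1.2 hv.2

/-- Adding a soliton with the largest index: its amplitude multiplies the old sum at the
amplitudes dressed by the new interaction terms. -/
lemma solitonSum_insert (R : ι → ι → ℂ) {s : Finset ι} {a : ι} (h : ∀ i ∈ s, i < a)
    (c : ι → ℂ) :
    solitonSum R (insert a s) c
      = solitonSum R s c + c a * solitonSum R s (fun i => c i * R i a) := by
  have ha : a ∉ s := fun h' => lt_irrefl a (h a h')
  rw [solitonSum, Finset.sum_powerset_insert ha]
  simp only [solitonSum, Finset.mul_sum]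
  congr 1
  refine Finset.sum_congr rfl fun w hw => ?_
  have hws := Finset.mem_powerset.1 hw
  rw [pairProd_insert R fun i hi => h i (hws hi),
    Finset.prod_insert fun h' => ha (hws h'), Finset.prod_mul_distrib]
  ring

lemma solitonSum_zero (R : ι → ι → ℂ) (s : Finset ι) : solitonSum R s 0 = 1 := by
  rw [solitonSum, Finset.sum_eq_single ∅]
  · simp [pairProd]
  · intro w _ hw
    obtain ⟨i, hi⟩ := Finset.nonempty_iff_ne_empty.2 hw
    rw [Finset.prod_eq_zero hi rfl, mul_zero]
  · simp

lemma differentiable_solitonSum (R : ι → ι → ℂ) (s : Finset ι) (c : ι → ℂ) :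
    Differentiable ℂ fun σ : ℂ => solitonSum R s (σ • c) := by
  simp only [solitonSum, Pi.smul_apply, smul_eq_mul]
  fun_prop

lemma continuous_solitonSum (R : ι → ι → ℂ) (s : Finset ι) : Continuous (solitonSum R s) := by
  unfold solitonSum
  fun_prop

lemma solitonSum_empty (R : ι → ι → ℂ) (c : ι → ℂ) : solitonSum R ∅ c = 1 := by
  simp [solitonSum, pairProd]

/-- The 4-point Pfaffian identity: `ξ` is antisymmetric and the Pfaffian of its restriction to any
four points is the product of its values on pairs. -/
structure IsPfaffianKernel {V : Type*} (ξ : V → V → ℂ) : Prop where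
  antisymm : ∀ a b, ξ b a = -ξ a b
  pfaffian : ∀ a b c d, ξ a b * ξ c d - ξ a c * ξ b d + ξ a d * ξ b c
    = ξ a b * ξ a c * ξ a d * ξ b c * ξ b d * ξ c d

/-- It suffices to know the 4-point identity for pairwise distinct points, because it is trivial
otherwise. -/
lemma IsPfaffianKernel.of_ne {V : Type*} {ξ : V → V → ℂ} (hanti : ∀ a b, ξ b a = -ξ a b)
    (h : ∀ a b c d, a ≠ b → a ≠ c → a ≠ d → b ≠ c → b ≠ d → c ≠ d →
      ξ a b * ξ c d - ξ a c * ξ b d + ξ a d * ξ b c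
        = ξ a b * ξ a c * ξ a d * ξ b c * ξ b d * ξ c d) : IsPfaffianKernel ξ := by
  refine ⟨hanti, fun a b c d => ?_⟩
  have h0 : ∀ x, ξ x x = 0 := fun x => by
    have := hanti x x
    linear_combination this / 2
  rcases eq_or_ne a b with rfl | hab
  · rw [h0]; ring
  rcases eq_or_ne a c with rfl | hac
  · rw [h0, hanti a b]; ring
  rcases eq_or_ne a d with rfl | had
  · rw [h0, hanti a b, hanti a c]; ring
  rcases eq_or_ne b c with rfl | hbc
  · rw [h0]; ring
  rcases eq_or_ne b d with rfl | hbd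
  · rw [h0, hanti b c]; ring
  rcases eq_or_ne c d with rfl | hcd
  · rw [h0]; ring
  exact h a b c d hab hac had hbc hbd hcd

variable {V : Type*}

/-- The factor by which the lattice point `v` dresses the soliton with end points `p i`, `q i`. -/
def dressing (ξ : V → V → ℂ) (p q : ι → V) (v : V) (i : ι) : ℂ := ξ v (p i) * ξ v (q i)

/-- The interaction term of the solitons `(p i, q i)` and `(p j, q j)`. -/
def interaction (ξ : V → V → ℂ) (p q : ι → V) (i j : ι) : ℂ :=
  ξ (p i) (p j) * ξ (p i) (q j) * ξ (q i) (p j) * ξ (q i) (q j)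

/-- The expansion of a 6-point Pfaffian along two disjoint pairs. Here `u₀`, `uᵢⱼ`, `vᵢⱼₖₗ`, `w`
stand for sums over words with no, two, four and six additional letters. -/
lemma sixPoint_identity {u₀ uab uac uad uap uaq ubc ubd ubp ubq ucd ucp ucq udp udq upq
      vabcd vabpq vacpq vadpq vbcpq vbdpq vcdpq w : ℂ} (h₀ : u₀ ≠ 0) (hpq : upq ≠ 0)
    (habcd : u₀ * vabcd = uab * ucd - uac * ubd + uad * ubc)
    (habpq : u₀ * vabpq = uab * upq - uap * ubq + uaq * ubp)
    (hacpq : u₀ * vacpq = uac * upq - uap * ucq + uaq * ucp)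
    (hadpq : u₀ * vadpq = uad * upq - uap * udq + uaq * udp)
    (hbcpq : u₀ * vbcpq = ubc * upq - ubp * ucq + ubq * ucp)
    (hbdpq : u₀ * vbdpq = ubd * upq - ubp * udq + ubq * udp)
    (hcdpq : u₀ * vcdpq = ucd * upq - ucp * udq + ucq * udp)
    (hw : upq * w = vabpq * vcdpq - vacpq * vbdpq + vadpq * vbcpq) :
    u₀ * w + upq * vabcd = uab * vcdpq + vabpq * ucd - (uac * vbdpq + vacpq * ubd)
      + (uad * vbcpq + vadpq * ubc) := by
  have e : ∀ {x y : ℂ}, u₀ * x = y → x = y / u₀ := fun h => by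
    rw [← h]; field_simp
  have ew : w = (vabpq * vcdpq - vacpq * vbdpq + vadpq * vbcpq) / upq := by
    rw [← hw]; field_simp
  rw [ew, e habcd, e habpq, e hacpq, e hadpq, e hbcpq, e hbdpq, e hcdpq]
  field_simp
  ring

/-- The order-one part of the induction step in `solitonSum_pfaffian`: if the sums over `s` satisfy
the four-letter relation for all letters and amplitudes, then they satisfy the relation obtained
from it by distributing one additional pair of letters `P`, `Q` over the two factors. -/
lemma solitonSum_pfaffian_polarised {ξ : V → V → ℂ} {p q : ι → V}
    {s : Finset ι} {S : (ι → ℂ) → ℂ} {L : V → ι → ℂ}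
    (hS : S = solitonSum (interaction ξ p q) s)
    (ih : ∀ (x : ι → ℂ) (a b c d : V),
      ξ a b * ξ a c * ξ a d * ξ b c * ξ b d * ξ c d * (S x * S (x * (L a * L b * L c * L d)))
        = ξ a b * ξ c d * (S (x * (L a * L b)) * S (x * (L c * L d)))
          - ξ a c * ξ b d * (S (x * (L a * L c)) * S (x * (L b * L d)))
          + ξ a d * ξ b c * (S (x * (L a * L d)) * S (x * (L b * L c))))
    {P Q : V} (hPQ : ξ P Q ≠ 0) (x : ι → ℂ) (a b c d : V) :
    ξ a b * ξ a c * ξ a d * ξ b c * ξ b d * ξ c d *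
        (S x * (ξ a P * ξ a Q * (ξ b P * ξ b Q) * (ξ c P * ξ c Q) * (ξ d P * ξ d Q)
            * S (x * (L a * L b * L c * L d * (L P * L Q))))
          + S (x * (L P * L Q)) * S (x * (L a * L b * L c * L d)))
      = ξ a b * ξ c d *
          (S (x * (L a * L b)) * (ξ c P * ξ c Q * (ξ d P * ξ d Q) * S (x * (L c * L d * (L P * L Q))))
          + ξ a P * ξ a Q * (ξ b P * ξ b Q) * S (x * (L a * L b * (L P * L Q)))
            * S (x * (L c * L d)))
        - ξ a c * ξ b d *
          (S (x * (L a * L c)) * (ξ b P * ξ b Q * (ξ d P * ξ d Q) * S (x * (L b * L d * (L P * L Q))))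
          + ξ a P * ξ a Q * (ξ c P * ξ c Q) * S (x * (L a * L c * (L P * L Q)))
            * S (x * (L b * L d)))
        + ξ a d * ξ b c *
          (S (x * (L a * L d)) * (ξ b P * ξ b Q * (ξ c P * ξ c Q) * S (x * (L b * L c * (L P * L Q))))
          + ξ a P * ξ a Q * (ξ d P * ξ d Q) * S (x * (L a * L d * (L P * L Q)))
            * S (x * (L b * L c))) := by
  -- first for amplitudes such that the two sums by which one divides do not vanish
  have key : ∀ x : ι → ℂ, S x ≠ 0 → S (x * (L P * L Q)) ≠ 0 →
      ξ a b * ξ a c * ξ a d * ξ b c * ξ b d * ξ c d *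
        (S x * (ξ a P * ξ a Q * (ξ b P * ξ b Q) * (ξ c P * ξ c Q) * (ξ d P * ξ d Q)
            * S (x * (L a * L b * L c * L d * (L P * L Q))))
          + S (x * (L P * L Q)) * S (x * (L a * L b * L c * L d)))
      - (ξ a b * ξ c d *
          (S (x * (L a * L b)) * (ξ c P * ξ c Q * (ξ d P * ξ d Q) * S (x * (L c * L d * (L P * L Q))))
          + ξ a P * ξ a Q * (ξ b P * ξ b Q) * S (x * (L a * L b * (L P * L Q)))
            * S (x * (L c * L d)))
        - ξ a c * ξ b d *
          (S (x * (L a * L c)) * (ξ b P * ξ b Q * (ξ d P * ξ d Q) * S (x * (L b * L d * (L P * L Q))))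
          + ξ a P * ξ a Q * (ξ c P * ξ c Q) * S (x * (L a * L c * (L P * L Q)))
            * S (x * (L b * L d)))
        + ξ a d * ξ b c *
          (S (x * (L a * L d)) * (ξ b P * ξ b Q * (ξ c P * ξ c Q) * S (x * (L b * L c * (L P * L Q))))
          + ξ a P * ξ a Q * (ξ d P * ξ d Q) * S (x * (L a * L d * (L P * L Q)))
            * S (x * (L b * L c)))) = 0 := by
    intro x h0 h1
    have hup : ξ P Q * S (x * (L P * L Q)) ≠ 0 := mul_ne_zero hPQ h1
    have four := ih x
    have hw := ih (x * (L P * L Q)) a b c d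
    have r : ∀ y : ι → ℂ, x * (L P * L Q) * y = x * (y * (L P * L Q)) := fun y => by ring
    simp only [r] at hw
    have e4 : ∀ a b : V, L a * L b * L P * L Q = L a * L b * (L P * L Q) := fun a b => by ring
    have hP := fun a b => four a b P Q
    simp only [e4] at hP
    have := sixPoint_identity (u₀ := S x) (upq := ξ P Q * S (x * (L P * L Q)))
      (uab := ξ a b * S (x * (L a * L b))) (uac := ξ a c * S (x * (L a * L c)))
      (uad := ξ a d * S (x * (L a * L d))) (ubc := ξ b c * S (x * (L b * L c)))
      (ubd := ξ b d * S (x * (L b * L d))) (ucd := ξ c d * S (x * (L c * L d)))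
      (uap := ξ a P * S (x * (L a * L P))) (uaq := ξ a Q * S (x * (L a * L Q)))
      (ubp := ξ b P * S (x * (L b * L P))) (ubq := ξ b Q * S (x * (L b * L Q)))
      (ucp := ξ c P * S (x * (L c * L P))) (ucq := ξ c Q * S (x * (L c * L Q)))
      (udp := ξ d P * S (x * (L d * L P))) (udq := ξ d Q * S (x * (L d * L Q)))
      (vabcd := ξ a b * ξ a c * ξ a d * ξ b c * ξ b d * ξ c d * S (x * (L a * L b * L c * L d)))
      (vabpq := ξ a b * ξ a P * ξ a Q * ξ b P * ξ b Q * ξ P Q * S (x * (L a * L b * (L P * L Q))))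
      (vacpq := ξ a c * ξ a P * ξ a Q * ξ c P * ξ c Q * ξ P Q * S (x * (L a * L c * (L P * L Q))))
      (vadpq := ξ a d * ξ a P * ξ a Q * ξ d P * ξ d Q * ξ P Q * S (x * (L a * L d * (L P * L Q))))
      (vbcpq := ξ b c * ξ b P * ξ b Q * ξ c P * ξ c Q * ξ P Q * S (x * (L b * L c * (L P * L Q))))
      (vbdpq := ξ b d * ξ b P * ξ b Q * ξ d P * ξ d Q * ξ P Q * S (x * (L b * L d * (L P * L Q))))
      (vcdpq := ξ c d * ξ c P * ξ c Q * ξ d P * ξ d Q * ξ P Q * S (x * (L c * L d * (L P * L Q))))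
      (w := ξ a b * ξ a c * ξ a d * ξ b c * ξ b d * ξ c d *
        (ξ a P * ξ a Q * (ξ b P * ξ b Q) * (ξ c P * ξ c Q) * (ξ d P * ξ d Q)) * ξ P Q
            * S (x * (L a * L b * L c * L d * (L P * L Q))))
      h0 hup (by linear_combination four a b c d) (by linear_combination hP a b)
      (by linear_combination hP a c) (by linear_combination hP a d)
      (by linear_combination hP b c) (by linear_combination hP b d)
      (by linear_combination hP c d)
      (by linear_combination ξ P Q ^ 2 * ξ a P * ξ a Q * ξ b P * ξ b Q * ξ c P * ξ c Q * ξ d P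
            * ξ d Q * hw)
    refine (mul_eq_zero.1 (?_ : ξ P Q * _ = 0)).resolve_left hPQ
    linear_combination this
  -- the remaining amplitudes are limits of such ones along a complex line
  have hd : ∀ y : ι → ℂ, Differentiable ℂ fun σ : ℂ => S (σ • y) := fun y => by
    rw [hS]; exact differentiable_solitonSum _ _ _
  have hne : ∀ y : ι → ℂ, ∀ᶠ σ in 𝓝[≠] (1 : ℂ), S (σ • y) ≠ 0 := fun y =>
    eventually_ne_of_differentiable (hd y) (w := 0)
      (by rw [zero_smul, hS, solitonSum_zero]; exact one_ne_zero) 1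
  have hc : Continuous S := by rw [hS]; exact continuous_solitonSum _ _
  have hev : ∀ᶠ σ in 𝓝[≠] (1 : ℂ), _ = (0 : ℂ) :=
    ((hne x).and (hne (x * (L P * L Q)))).mono fun σ h =>
      key (σ • x) h.1 (by rw [smul_mul_assoc]; exact h.2)
  simp only [smul_mul_assoc] at hev
  have := eq_zero_of_eventually_eq_zero (Continuous.continuousAt (by fun_prop)) hev
  simp only [one_smul] at this
  exact sub_eq_zero.1 this

lemma interaction_eq_dressing {ι V : Type*} {ξ : V → V → ℂ} (hξ : IsPfaffianKernel ξ)
    (p q : ι → V) (i j : ι) :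
    interaction ξ p q i j = dressing ξ p q (p j) i * dressing ξ p q (q j) i := by
  simp only [interaction, dressing, hξ.antisymm (p i) (p j), hξ.antisymm (p i) (q j),
    hξ.antisymm (q i) (p j), hξ.antisymm (q i) (q j)]
  ring

/-- The four-letter Pfaffian relation for soliton sums: the sum dressed by a word of lattice points
behaves like the Pfaffian of that word. -/
theorem solitonSum_pfaffian {ξ : V → V → ℂ} (hξ : IsPfaffianKernel ξ) (p q : ι → V)
    (s : Finset ι) (hpq : ∀ i ∈ s, ξ (p i) (q i) ≠ 0) {S : (ι → ℂ) → ℂ} {L : V → ι → ℂ}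
    (hS : S = solitonSum (interaction ξ p q) s) (hL : L = dressing ξ p q)
    (x : ι → ℂ) (a b c d : V) :
    ξ a b * ξ a c * ξ a d * ξ b c * ξ b d * ξ c d * (S x * S (x * (L a * L b * L c * L d)))
      = ξ a b * ξ c d * (S (x * (L a * L b)) * S (x * (L c * L d)))
        - ξ a c * ξ b d * (S (x * (L a * L c)) * S (x * (L b * L d)))
        + ξ a d * ξ b c * (S (x * (L a * L d)) * S (x * (L b * L c))) := by
  induction s using Finset.induction_on_max generalizing S x a b c d with
  | empty =>
    simp only [hS, solitonSum_empty]
    linear_combination -hξ.pfaffian a b c d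
  | insert N s hN ih =>
    have ih' := fun x a b c d => ih (fun i hi => hpq i (Finset.mem_insert_of_mem hi))
      (S := solitonSum (interaction ξ p q) s) rfl x a b c d
    have hrec : ∀ y, S y = solitonSum (interaction ξ p q) s y
        + y N * solitonSum (interaction ξ p q) s (y * (L (p N) * L (q N))) := fun y => by
      rw [hS, solitonSum_insert _ hN, hL]
      congr 3
      ext i
      simp [interaction_eq_dressing hξ]
    have h1 := solitonSum_pfaffian_polarised (S := solitonSum (interaction ξ p q) s) rfl ih'
      (hpq N (Finset.mem_insert_self _ _)) x a b c d
    have h0 := ih' x a b c d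
    have h2 := ih' (x * (L (p N) * L (q N))) a b c d
    have hLN : ∀ v, L v N = ξ v (p N) * ξ v (q N) := fun v => by rw [hL]; rfl
    have r : ∀ y : ι → ℂ, x * (L (p N) * L (q N)) * y = x * (y * (L (p N) * L (q N))) :=
      fun y => by ring
    simp only [r] at h2
    simp only [hrec, Pi.mul_apply, hLN, mul_assoc x]
    linear_combination h0 + x N * h1 + x N ^ 2 * (ξ a (p N) * ξ a (q N) * (ξ b (p N) * ξ b (q N))
      * (ξ c (p N) * ξ c (q N)) * (ξ d (p N) * ξ d (q N))) * h2

end SolitonSum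

/-! ### From a linear problem of BKP type to the dual AKP equation -/

/-- The left-hand side of the dual AKP equation multiplied by its six denominators, as a quartic
form in the fourteen values of `τ`: the numerators `v 0, …, v 7` in the order in which they occur,
then `v 8, …, v 13` for `τ` at the sites shifted by `e₁, e₂, e₃, e₁₂, e₁₃, e₂₃`. -/
def dakpForm (α : Fin 4 → ℂ) (v : Fin 14 → ℂ) : ℂ :=
  α 0 * (v 0 * (v 8 * v 11 * v 12) - v 1 * (v 13 * v 9 * v 10))
  + α 1 * (v 2 * (v 9 * v 11 * v 13) - v 3 * (v 12 * v 8 * v 10))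
  + α 2 * (v 4 * (v 10 * v 12 * v 13) - v 5 * (v 11 * v 8 * v 9))
  + α 3 * (v 6 * (v 11 * v 13 * v 12) - v 7 * (v 8 * v 9 * v 10))

/-- The values of `τ` that enter the dual AKP equation at `(k, l, m)`, in the order used by
`dakpForm`. -/
def stencil (τ : LatticeFun) (k l m : ℤ) : Fin 14 → ℂ :=
  ![τ (k - 1) (l + 1) (m + 1), τ (k + 2) l m, τ (k + 1) (l - 1) (m + 1), τ k (l + 2) m,
    τ (k + 1) (l + 1) (m - 1), τ k l (m + 2), τ k l m, τ (k + 1) (l + 1) (m + 1),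
    τ (k + 1) l m, τ k (l + 1) m, τ k l (m + 1),
    τ (k + 1) (l + 1) m, τ (k + 1) l (m + 1), τ k (l + 1) (m + 1)]

/-- The dual AKP expression with its denominators cleared. -/
def dakpNum (α : Fin 4 → ℂ) (τ : LatticeFun) (k l m : ℤ) : ℂ := dakpForm α (stencil τ k l m)

lemma dakpNum_eq (α : Fin 4 → ℂ) (τ : LatticeFun) (k l m : ℤ) :
    dakpNum α τ k l m =
      α 0 * (τ (k - 1) (l + 1) (m + 1) * (τ (k + 1) l m * τ (k + 1) (l + 1) m * τ (k + 1) l (m + 1))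
        - τ (k + 2) l m * (τ k (l + 1) (m + 1) * τ k (l + 1) m * τ k l (m + 1)))
      + α 1 * (τ (k + 1) (l - 1) (m + 1)
            * (τ k (l + 1) m * τ (k + 1) (l + 1) m * τ k (l + 1) (m + 1))
        - τ k (l + 2) m * (τ (k + 1) l (m + 1) * τ (k + 1) l m * τ k l (m + 1)))
      + α 2 * (τ (k + 1) (l + 1) (m - 1)
            * (τ k l (m + 1) * τ (k + 1) l (m + 1) * τ k (l + 1) (m + 1))
        - τ k l (m + 2) * (τ (k + 1) (l + 1) m * τ (k + 1) l m * τ k (l + 1) m))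
      + α 3 * (τ k l m * (τ (k + 1) (l + 1) m * τ k (l + 1) (m + 1) * τ (k + 1) l (m + 1))
        - τ (k + 1) (l + 1) (m + 1) * (τ (k + 1) l m * τ k (l + 1) m * τ k l (m + 1))) := rfl

lemma isDAKPSolution_of_dakpNum {α : Fin 4 → ℂ} {τ : LatticeFun}
    (h : ∀ k l m, dakpNum α τ k l m = 0) : IsDAKPSolution α τ := by
  intro k l m h1 h2 h3 h12 h13 h23
  have h := h k l m
  rw [dakpNum_eq] at h
  unfold dakpLHS
  field_simp
  linear_combination h

/-- The BKP equation polarised in two functions. For a given `τ` it is a linear equation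
for `φ`. -/
def IsMixedBKP (A B C D : ℂ) (τ φ : LatticeFun) : Prop :=
  ∀ k l m : ℤ,
    A * (φ (k + 1) l m * τ k (l + 1) (m + 1)) + B * (φ k (l + 1) m * τ (k + 1) l (m + 1))
      + C * (φ k l (m + 1) * τ (k + 1) (l + 1) m)
      + D * (τ k l m * φ (k + 1) (l + 1) (m + 1)) = 0

/-- The eight unit cubes around a site give eight linear equations for the thirteen values of `φ`
at that site and at its twelve neighbours at face-diagonal distance. Each neighbour lies in two of
the cubes and can be eliminated, so the dual AKP expression annihilates the value of `φ` at the
centre. -/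
lemma IsMixedBKP.mul_dakpNum_eq_zero {A B C D : ℂ} {τ φ : LatticeFun}
    (h : IsMixedBKP A B C D τ φ) (h' : IsMixedBKP A B C D φ τ) (k l m : ℤ) :
    φ (l + m + 1) (k + m + 1) (k + l + 1)
      * dakpNum ![A ^ 2, B ^ 2, C ^ 2, -D ^ 2] (changeVars (fun _ => 1) τ) k l m = 0 := by
  rw [dakpNum_eq]
  simp only [changeVars, one_mul, Matrix.cons_val]
  obtain ⟨x, hx⟩ : ∃ x, x = l + m + 1 := ⟨_, rfl⟩
  obtain ⟨y, hy⟩ : ∃ y, y = k + m + 1 := ⟨_, rfl⟩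
  obtain ⟨z, hz⟩ : ∃ z, z = k + l + 1 := ⟨_, rfl⟩
  rw [show l + 1 + (m + 1) = x + 1 by lia, show k - 1 + (m + 1) = y - 1 by lia,
    show k - 1 + (l + 1) = z - 1 by lia, show l + m = x - 1 by lia, show k + 1 + m = y by lia,
    show k + 1 + l = z by lia, show l + 1 + m = x by lia, show k + 1 + (l + 1) = z + 1 by lia,
    show l + (m + 1) = x by lia, show k + 1 + (m + 1) = y + 1 by lia, show k + 2 + m = y + 1 by lia,
    show k + 2 + l = z + 1 by lia, show k + (m + 1) = y by lia, show k + (l + 1) = z by lia,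
    show k + m = y - 1 by lia, show k + l = z - 1 by lia, show l - 1 + (m + 1) = x - 1 by lia,
    show k + 1 + (l - 1) = z - 1 by lia, show l + 2 + m = x + 1 by lia,
    show k + (l + 2) = z + 1 by lia, show l + 1 + (m - 1) = x - 1 by lia,
    show k + 1 + (m - 1) = y - 1 by lia, show l + (m + 2) = x + 1 by lia,
    show k + (m + 2) = y + 1 by lia, sub_add_cancel, sub_add_cancel, sub_add_cancel]
  have c000 := h (x - 1) (y - 1) (z - 1)
  have c011 := h (x - 1) y z
  have c101 := h x (y - 1) z
  have c110 := h x y (z - 1)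
  have c111 := h' x y z
  have c100 := h' x (y - 1) (z - 1)
  have c010 := h' (x - 1) y (z - 1)
  have c001 := h' (x - 1) (y - 1) z
  simp only [sub_add_cancel] at c000 c011 c101 c110 c111 c100 c010 c001
  linear_combination (D) * (τ (x - 1) y z * τ x (y - 1) z * τ x y (z - 1)) * c111
    + (-A) * (τ (x + 1) y z * τ x (y - 1) z * τ x y (z - 1)) * c011
    + (-B) * (τ (x - 1) y z * τ x (y + 1) z * τ x y (z - 1)) * c101
    + (-C) * (τ (x - 1) y z * τ x (y - 1) z * τ x y (z + 1)) * c110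
    + (-D) * (τ (x + 1) y z * τ x (y + 1) z * τ x y (z + 1)) * c000
    + (A) * (τ (x - 1) y z * τ x (y + 1) z * τ x y (z + 1)) * c100
    + (B) * (τ (x + 1) y z * τ x (y - 1) z * τ x y (z + 1)) * c010
    + (C) * (τ (x + 1) y z * τ x (y + 1) z * τ x y (z - 1)) * c001

/-! ### Soliton solutions -/

section NSoliton

variable {N : ℕ}

lemma nSoliton_eq_solitonSum (R : Fin N → Fin N → ℂ) (c x y z : Fin N → ℂ) (k l m : ℤ) :
    nSoliton R c x y z k l m
      = solitonSum R Finset.univ (fun i => c i * x i ^ k * y i ^ l * z i ^ m) := by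
  simp only [nSoliton, solitonSum, pairProd, Finset.powerset_univ, Finset.prod_mul_distrib,
    Finset.prod_zpow, mul_assoc]

lemma nSoliton_congr {R R' : Fin N → Fin N → ℂ} (h : ∀ i j, i < j → R i j = R' i j)
    (c x y z : Fin N → ℂ) : nSoliton R c x y z = nSoliton R' c x y z := by
  ext k l m
  simp only [nSoliton_eq_solitonSum, solitonSum]
  exact Finset.sum_congr rfl fun w _ => by rw [pairProd_congr fun i _ j _ hij => h i j hij]

lemma differentiable_nSoliton (R : Fin N → Fin N → ℂ) (c x y z : Fin N → ℂ) (k l m : ℤ) :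
    Differentiable ℂ fun σ : ℂ => nSoliton R (σ • c) x y z k l m := by
  convert differentiable_solitonSum R Finset.univ
    (fun i => c i * x i ^ k * y i ^ l * z i ^ m) using 2 with σ
  rw [nSoliton_eq_solitonSum]
  congr 1
  ext i
  simp [mul_assoc]

lemma nSoliton_zero (R : Fin N → Fin N → ℂ) (x y z : Fin N → ℂ) (k l m : ℤ) :
    nSoliton R 0 x y z k l m = 1 := by
  rw [nSoliton_eq_solitonSum, ← solitonSum_zero R Finset.univ]
  congr 1
  ext i
  simp

lemma changeVars_nSoliton (ε : Fin 3 → ℤ) (R : Fin N → Fin N → ℂ) (d : Fin N → ℂ)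
    {X Y Z x y z : Fin N → ℂ} (hX : ∀ i, X i ≠ 0) (hY : ∀ i, Y i ≠ 0) (hZ : ∀ i, Z i ≠ 0)
    (hx : ∀ i, x i = Y i ^ ε 1 * Z i ^ ε 2) (hy : ∀ i, y i = X i ^ ε 0 * Z i ^ ε 2)
    (hz : ∀ i, z i = X i ^ ε 0 * Y i ^ ε 1) :
    nSoliton R d x y z = changeVars ε (nSoliton R d X Y Z) := by
  ext k l m
  simp only [changeVars, nSoliton_eq_solitonSum]
  congr 1
  ext i
  simp only [hx, hy, hz, mul_zpow, ← zpow_mul, mul_add, zpow_add₀ (hX i), zpow_add₀ (hY i),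
    zpow_add₀ (hZ i)]
  ring

/-- If the soliton sums `τ` with arbitrary amplitudes admit solutions `Φ` of the associated linear
problem that depend analytically on the amplitudes and do not vanish on the vacuum, then they solve
the dual AKP equation in the variables `(l + m, k + m, k + l)`. -/
lemma dakpNum_changeVars_nSoliton_eq_zero {A B C D : ℂ} (R : Fin N → Fin N → ℂ)
    (X Y Z : Fin N → ℂ) (Φ : (Fin N → ℂ) → LatticeFun)
    (hΦ : ∀ c k l m, Differentiable ℂ fun σ : ℂ => Φ (σ • c) k l m)
    (hΦ0 : ∀ k l m, Φ 0 k l m ≠ 0)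
    (h : ∀ c, IsMixedBKP A B C D (nSoliton R c X Y Z) (Φ c))
    (h' : ∀ c, IsMixedBKP A B C D (Φ c) (nSoliton R c X Y Z)) (c : Fin N → ℂ) (k l m : ℤ) :
    dakpNum ![A ^ 2, B ^ 2, C ^ 2, -D ^ 2]
      (changeVars (fun _ => 1) (nSoliton R c X Y Z)) k l m = 0 := by
  have := eq_zero_of_mul_eq_zero_of_entire
    (f := fun σ : ℂ => dakpNum ![A ^ 2, B ^ 2, C ^ 2, -D ^ 2]
      (changeVars (fun _ => 1) (nSoliton R (σ • c) X Y Z)) k l m)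
    (g := fun σ : ℂ => Φ (σ • c) (l + m + 1) (k + m + 1) (k + l + 1))
    (by
      have hd := fun k l m => differentiable_nSoliton R c X Y Z k l m
      simp only [dakpNum_eq, changeVars]
      fun_prop)
    (hΦ c _ _ _)
    (fun σ => by rw [mul_comm]; exact (h (σ • c)).mul_dakpNum_eq_zero (h' (σ • c)) k l m)
    (w := 0) (by rw [zero_smul]; exact hΦ0 _ _ _) 1
  simpa using this

/-- The derivative of `dakpForm` at `u` in the direction `v`. -/
def dakpFormDeriv (α : Fin 4 → ℂ) (u v : Fin 14 → ℂ) : ℂ :=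
  let P := fun i j k l : Fin 14 => v i * u j * u k * u l + u i * v j * u k * u l
    + u i * u j * v k * u l + u i * u j * u k * v l
  α 0 * (P 0 8 11 12 - P 1 13 9 10) + α 1 * (P 2 9 11 13 - P 3 12 8 10)
    + α 2 * (P 4 10 12 13 - P 5 11 8 9) + α 3 * (P 6 11 13 12 - P 7 8 9 10)

/-- The mixed second derivative of `dakpForm` along a curve `(s, t) ↦ 1 + s u + t v + s t w`
at the origin. -/
def dakpFormMixedDeriv (α : Fin 4 → ℂ) (u v w : Fin 14 → ℂ) : ℂ :=
  let P := fun i j k l : Fin 14 => w i + w j + w k + w l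
    + (u i + u j + u k + u l) * (v i + v j + v k + v l)
    - (u i * v i + u j * v j + u k * v k + u l * v l)
  α 0 * (P 0 8 11 12 - P 1 13 9 10) + α 1 * (P 2 9 11 13 - P 3 12 8 10)
    + α 2 * (P 4 10 12 13 - P 5 11 8 9) + α 3 * (P 6 11 13 12 - P 7 8 9 10)

-- The linear coefficient of a polynomial `f` of degree at most four is
-- `(8 (f 1 - f (-1)) - (f 2 - f (-2))) / 12`.
lemma dakpFormDeriv_eq_zero {α : Fin 4 → ℂ} {u v : Fin 14 → ℂ}
    (h : ∀ s : ℂ, dakpForm α (fun i => u i + s * v i) = 0) : dakpFormDeriv α u v = 0 := by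
  have h1 := h 1
  have h2 := h (-1)
  have h3 := h 2
  have h4 := h (-2)
  simp only [dakpForm] at h1 h2 h3 h4
  simp only [dakpFormDeriv]
  linear_combination (8 * (h1 - h2) - (h3 - h4)) / 12

lemma dakpFormMixedDeriv_eq_zero {α : Fin 4 → ℂ} {u v w : Fin 14 → ℂ}
    (h : ∀ s t : ℂ, dakpForm α (fun i => 1 + t * v i + s * (u i + t * w i)) = 0) :
    dakpFormMixedDeriv α u v w = 0 := by
  have h0 : ∀ t, dakpFormDeriv α (fun i => 1 + t * v i) (fun i => u i + t * w i) = 0 :=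
    fun t => dakpFormDeriv_eq_zero fun s => h s t
  have h1 := h0 1
  have h2 := h0 (-1)
  have h3 := h0 2
  have h4 := h0 (-2)
  simp only [dakpFormDeriv] at h1 h2 h3 h4
  simp only [dakpFormMixedDeriv]
  linear_combination (8 * (h1 - h2) - (h3 - h4)) / 12

/-- The values at the fourteen sites of the stencil at `(1, 1, 1)` of a plane wave. -/
noncomputable def planeWave (x y z : ℂ) : Fin 14 → ℂ :=
  stencil (fun k l m => x ^ k * y ^ l * z ^ m) 1 1 1

/-- The one-soliton solution obeys the dispersion relation. -/
lemma dispQ_eq_zero_of_soliton {α : Fin 4 → ℂ} {x y z : ℂ}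
    (h : ∀ s : ℂ, dakpNum α (fun k l m => 1 + s * (x ^ k * y ^ l * z ^ m)) 1 1 1 = 0) :
    dispQ α x y z = 0 := by
  have h1 := dakpFormDeriv_eq_zero (α := α) (u := fun _ => 1) (v := planeWave x y z) (fun s => by
    rw [← h s, dakpNum]
    congr 1
    ext i
    fin_cases i <;> rfl)
  simp only [dakpFormDeriv, planeWave, stencil, Matrix.cons_val] at h1
  norm_num at h1
  unfold dispQ
  linear_combination -h1

/-- The coefficient of the product of the two amplitudes in the two-soliton solution determines the
interaction term. -/
lemma interaction_of_soliton {α : Fin 4 → ℂ} {x y z x' y' z' r : ℂ}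
    (h : ∀ s t : ℂ, dakpNum α (fun k l m => 1 + t * (x' ^ k * y' ^ l * z' ^ m)
      + s * (x ^ k * y ^ l * z ^ m + t * (r * ((x * x') ^ k * (y * y') ^ l * (z * z') ^ m))))
      1 1 1 = 0) :
    r * dispQ α (x * x') (y * y') (z * z') = α 0 * S₁ x y z x' y' z' + α 1 * S₁ y x z y' x' z'
      + α 2 * S₁ z y x z' y' x' + α 3 * S₄ x y z x' y' z' := by
  have h1 := dakpFormMixedDeriv_eq_zero (α := α) (u := planeWave x y z) (v := planeWave x' y' z')
    (w := fun i => r * planeWave (x * x') (y * y') (z * z') i) (fun s t => by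
      rw [← h s t, dakpNum]
      congr 1
      ext i
      fin_cases i <;> rfl)
  simp only [dakpFormMixedDeriv, planeWave, stencil, Matrix.cons_val] at h1
  norm_num at h1
  unfold dispQ S₁ S₄
  linear_combination -h1

lemma nSoliton_one (r s x y z : ℂ) :
    nSoliton (fun _ _ : Fin 1 => r) (fun _ => s) (fun _ => x) (fun _ => y) (fun _ => z)
      = fun k l m => 1 + s * (x ^ k * y ^ l * z ^ m) := by
  ext k l m
  rw [nSoliton_eq_solitonSum, show (Finset.univ : Finset (Fin 1)) = insert 0 ∅ from rfl,
    solitonSum_insert _ (by simp)]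
  simp only [solitonSum_empty]
  ring

lemma nSoliton_two (R : Fin 2 → Fin 2 → ℂ) (c x y z : Fin 2 → ℂ) :
    nSoliton R c x y z
      = fun k l m => 1 + c 1 * (x 1 ^ k * y 1 ^ l * z 1 ^ m)
        + c 0 * (x 0 ^ k * y 0 ^ l * z 0 ^ m
          + c 1 * (R 0 1 * ((x 0 * x 1) ^ k * (y 0 * y 1) ^ l * (z 0 * z 1) ^ m))) := by
  ext k l m
  rw [nSoliton_eq_solitonSum,
    show (Finset.univ : Finset (Fin 2)) = insert 1 (insert 0 ∅) from by decide,
    solitonSum_insert _ (by simp), solitonSum_insert _ (by simp), solitonSum_insert _ (by simp)]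
  simp only [solitonSum_empty, mul_zpow]
  ring

lemma dispQ_eq_zero_of_nSoliton {α : Fin 4 → ℂ} {r x y z : ℂ}
    (h : ∀ d : Fin 1 → ℂ, dakpNum α
      (nSoliton (fun _ _ => r) d (fun _ => x) (fun _ => y) (fun _ => z)) 1 1 1 = 0) :
    dispQ α x y z = 0 :=
  dispQ_eq_zero_of_soliton fun s => by rw [← nSoliton_one r s x y z]; exact h _

lemma mul_dispQ_eq_of_nSoliton {α : Fin 4 → ℂ} {R : Fin 2 → Fin 2 → ℂ} {x y z : Fin 2 → ℂ}
    (h : ∀ d, dakpNum α (nSoliton R d x y z) 1 1 1 = 0) :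
    R 0 1 * dispQ α (x 0 * x 1) (y 0 * y 1) (z 0 * z 1)
      = α 0 * S₁ (x 0) (y 0) (z 0) (x 1) (y 1) (z 1) + α 1 * S₁ (y 0) (x 0) (z 0) (y 1) (x 1) (z 1)
        + α 2 * S₁ (z 0) (y 0) (x 0) (z 1) (y 1) (x 1)
        + α 3 * S₄ (x 0) (y 0) (z 0) (x 1) (y 1) (z 1) :=
  interaction_of_soliton fun s t => by
    have := h ![s, t]
    rwa [nSoliton_two] at this

lemma dakpR_eq_of_nSoliton {α : Fin 4 → ℂ} {R : Fin 2 → Fin 2 → ℂ} {x y z : Fin 2 → ℂ}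
    (h : ∀ d, dakpNum α (nSoliton R d x y z) 1 1 1 = 0)
    (hQ : dispQ α (x 0 * x 1) (y 0 * y 1) (z 0 * z 1) ≠ 0) :
    dakpR α (x 0) (y 0) (z 0) (x 1) (y 1) (z 1) = R 0 1 := by
  rw [dakpR, ← mul_dispQ_eq_of_nSoliton h, mul_div_cancel_right₀ _ hQ]

end NSoliton

/-! ### Soliton sums as solutions of the polarised BKP equation -/

section Lattice

variable {N : ℕ}

/-- The four-letter relation read as a polarised BKP equation. The fourth lattice point `d` produces
the solution `φ` of the linear problem: the soliton sum with amplitudes dressed by `d`, times a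
plane wave. -/
lemma isMixedBKP_nSoliton {V : Type*} {ξ : V → V → ℂ} (hξ : IsPfaffianKernel ξ) (a b c d : V)
    (p q : Fin N → V) (hpq : ∀ i, ξ (p i) (q i) ≠ 0)
    (ha : ∀ i, dressing ξ p q a i ≠ 0) (hb : ∀ i, dressing ξ p q b i ≠ 0)
    (hc : ∀ i, dressing ξ p q c i ≠ 0)
    (had : ξ a d ≠ 0) (hbd : ξ b d ≠ 0) (hcd : ξ c d ≠ 0) (x : Fin N → ℂ) :
    IsMixedBKP (ξ b c) (-ξ a c) (ξ a b) (-(ξ a b * ξ a c * ξ b c))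
      (nSoliton (interaction ξ p q) x (dressing ξ p q a) (dressing ξ p q b) (dressing ξ p q c))
      (fun k l m => ξ a d ^ k * ξ b d ^ l * ξ c d ^ m
        * nSoliton (interaction ξ p q) (x * dressing ξ p q d)
          (dressing ξ p q a) (dressing ξ p q b) (dressing ξ p q c) k l m) := by
  intro k l m
  set S := solitonSum (interaction ξ p q) Finset.univ with hS
  set L := dressing ξ p q with hL
  set y : Fin N → ℂ := fun i => x i * L a i ^ k * L b i ^ l * L c i ^ m with hy
  have h := solitonSum_pfaffian hξ p q Finset.univ (fun i _ => hpq i) hS hL y a b c d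
  have shift : ∀ (x' f : Fin N → ℂ) (k' l' m' : ℤ),
      (∀ i, x' i * L a i ^ k' * L b i ^ l' * L c i ^ m' = y i * f i) →
      nSoliton (interaction ξ p q) x' (L a) (L b) (L c) k' l' m' = S (y * f) := by
    intro x' f k' l' m' h'
    rw [nSoliton_eq_solitonSum, funext h']
    rfl
  have e : ∀ i, L a i ^ (k + 1) = L a i ^ k * L a i ∧ L b i ^ (l + 1) = L b i ^ l * L b i
      ∧ L c i ^ (m + 1) = L c i ^ m * L c i := fun i =>
    ⟨zpow_add_one₀ (ha i) k, zpow_add_one₀ (hb i) l, zpow_add_one₀ (hc i) m⟩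
  rw [shift x (L b * L c) k (l + 1) (m + 1) fun i => by simp only [e, hy, Pi.mul_apply]; ring,
    shift x (L a * L c) (k + 1) l (m + 1) fun i => by simp only [e, hy, Pi.mul_apply]; ring,
    shift x (L a * L b) (k + 1) (l + 1) m fun i => by simp only [e, hy, Pi.mul_apply]; ring,
    shift x 1 k l m fun i => by simp [hy]]
  simp only
  rw [shift _ (L a * L d) (k + 1) l m fun i => by simp only [e, hy, Pi.mul_apply]; ring,
    shift _ (L b * L d) k (l + 1) m fun i => by simp only [e, hy, Pi.mul_apply]; ring,
    shift _ (L c * L d) k l (m + 1) fun i => by simp only [e, hy, Pi.mul_apply]; ring,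
    shift _ (L a * L b * L c * L d) (k + 1) (l + 1) (m + 1) fun i => by
      simp only [e, hy, Pi.mul_apply]; ring,
    zpow_add_one₀ had, zpow_add_one₀ hbd, zpow_add_one₀ hcd, mul_one]
  linear_combination (-ξ a d ^ k * ξ b d ^ l * ξ c d ^ m) * h

lemma tendsto_nSoliton {T : Type*} {F : Filter T} {R : T → Fin N → Fin N → ℂ}
    {x y z : T → Fin N → ℂ} {R₀ : Fin N → Fin N → ℂ} {x₀ y₀ z₀ : Fin N → ℂ} (c : Fin N → ℂ)
    (hR : ∀ i j, i < j → Tendsto (fun t => R t i j) F (𝓝 (R₀ i j)))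
    (hx : ∀ i, Tendsto (fun t => x t i) F (𝓝 (x₀ i)))
    (hy : ∀ i, Tendsto (fun t => y t i) F (𝓝 (y₀ i)))
    (hz : ∀ i, Tendsto (fun t => z t i) F (𝓝 (z₀ i)))
    (hx0 : ∀ i, x₀ i ≠ 0) (hy0 : ∀ i, y₀ i ≠ 0) (hz0 : ∀ i, z₀ i ≠ 0) (k l m : ℤ) :
    Tendsto (fun t => nSoliton (R t) c (x t) (y t) (z t) k l m) F
      (𝓝 (nSoliton R₀ c x₀ y₀ z₀ k l m)) := by
  simp only [nSoliton_eq_solitonSum, solitonSum, pairProd]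
  refine tendsto_finsetSum _ fun w _ => Tendsto.mul ?_ (tendsto_finsetProd _ fun i _ => ?_)
  · refine tendsto_finsetProd _ fun v hv => hR _ _ (Finset.mem_filter.1 hv).2
  · exact ((tendsto_const_nhds.mul ((hx i).zpow₀ k (Or.inl (hx0 i)))).mul
      ((hy i).zpow₀ l (Or.inl (hy0 i)))).mul ((hz i).zpow₀ m (Or.inl (hz0 i)))

/-- The points of the spectral curve attached to an `N`-soliton solution: three lattice points,
an auxiliary point `o`, and two end points for each soliton. -/
inductive Letter (N : ℕ)
  | a | b | c | o
  | p (i : Fin N)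
  | q (i : Fin N)

/-! ### Solitons of BKP -/

/-- The rational Pfaffian kernel `(v - v') / (v + v')`, written for points `v = s / r` of the
projective line. -/
lemma isPfaffianKernel_rational {V : Type*} {s r : V → ℂ}
    (h : ∀ i j, i ≠ j → s i * r j + s j * r i ≠ 0) :
    IsPfaffianKernel fun i j => (s i * r j - s j * r i) / (s i * r j + s j * r i) := by
  refine .of_ne (fun i j => ?_) fun a b c d hab hac had hbc hbd hcd => ?_
  · rw [← neg_div]
    congr 1 <;> ring
  · have h1 := h a b hab
    have h2 := h a c hac
    have h3 := h a d had
    have h4 := h b c hbc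
    have h5 := h b d hbd
    have h6 := h c d hcd
    generalize hD1 : s a * r b + s b * r a = D1 at *
    generalize hD2 : s a * r c + s c * r a = D2 at *
    generalize hD3 : s a * r d + s d * r a = D3 at *
    generalize hD4 : s b * r c + s c * r b = D4 at *
    generalize hD5 : s b * r d + s d * r b = D5 at *
    generalize hD6 : s c * r d + s d * r c = D6 at *
    field_simp
    rw [← hD1, ← hD2, ← hD3, ← hD4, ← hD5, ← hD6]
    ring

/-- The points of the projective line attached to BKP solitons, as quotients `bkpNumer / bkpDenom`:
the lattice points are `1 / a`, `1 / b`, `1 / c`, and `o` is the point `0`. -/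
def bkpNumer (p q : Fin N → ℂ) : Letter N → ℂ
  | .a => 1 | .b => 1 | .c => 1 | .o => 0 | .p i => p i | .q i => q i

/-- The denominators of the points `bkpNumer / bkpDenom`. -/
def bkpDenom (a b c : ℂ) : Letter N → ℂ
  | .a => a | .b => b | .c => c | .o => 1 | .p _ => 1 | .q _ => 1

lemma isBKPSolution_of_generic {a b c : ℂ} {p q : Fin N → ℂ}
    (hreg : ∀ i, BKPRegular a (p i) (q i) ∧ BKPRegular b (p i) (q i) ∧ BKPRegular c (p i) (q i))
    (hab : a + b ≠ 0) (hac : a + c ≠ 0) (hbc : b + c ≠ 0)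
    (hp : ∀ i, p i ≠ 0) (hq : ∀ i, q i ≠ 0) (hpp : ∀ i j, i ≠ j → p i + p j ≠ 0)
    (hqq : ∀ i j, i ≠ j → q i + q j ≠ 0) (hpq : ∀ i j, p i + q j ≠ 0) (hne : ∀ i, p i ≠ q i)
    (d : Fin N → ℂ) :
    IsBKPSolution (bkpA a b c) (bkpB a b c) (bkpC a b c) (bkpD a b c)
      (nSoliton (fun i j => bkpR (p i) (q i) (p j) (q j)) d (fun i => bkpX a (p i) (q i))
        (fun i => bkpX b (p i) (q i)) (fun i => bkpX c (p i) (q i))) := by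
  have hsum : ∀ i j : Letter N, i ≠ j →
      bkpNumer p q i * bkpDenom a b c j + bkpNumer p q j * bkpDenom a b c i ≠ 0 := by
    have hr1 := fun i => (hreg i).1
    have hr2 := fun i => (hreg i).2.1
    have hr3 := fun i => (hreg i).2.2
    simp only [BKPRegular] at hr1 hr2 hr3
    intro i j hij
    cases i <;> cases j <;> simp only [bkpNumer, bkpDenom, ne_eq] at hij ⊢ <;> grind
  have hξ := isPfaffianKernel_rational hsum
  set ξ : Letter N → Letter N → ℂ := fun i j =>
    (bkpNumer p q i * bkpDenom a b c j - bkpNumer p q j * bkpDenom a b c i) /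
      (bkpNumer p q i * bkpDenom a b c j + bkpNumer p q j * bkpDenom a b c i) with hξdef
  have hA : dressing ξ .p .q .a = fun i => bkpX a (p i) (q i) := by
    ext i; simp only [dressing, hξdef, bkpNumer, bkpDenom, bkpX]; rw [div_mul_div_comm]; ring_nf
  have hB : dressing ξ .p .q .b = fun i => bkpX b (p i) (q i) := by
    ext i; simp only [dressing, hξdef, bkpNumer, bkpDenom, bkpX]; rw [div_mul_div_comm]; ring_nf
  have hC : dressing ξ .p .q .c = fun i => bkpX c (p i) (q i) := by
    ext i; simp only [dressing, hξdef, bkpNumer, bkpDenom, bkpX]; rw [div_mul_div_comm]; ring_nf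
  have hO : dressing ξ .p .q .o = 1 := by
    ext i
    simp only [dressing, hξdef, bkpNumer, bkpDenom, Pi.one_apply]
    have hneg : ∀ v : ℂ, v ≠ 0 → (0 * 1 - v * 1) / (0 * 1 + v * 1) = -1 := fun v hv => by
      rw [div_eq_iff (by simpa using hv)]; ring
    rw [hneg _ (hp i), hneg _ (hq i)]
    ring
  have hR : interaction ξ .p .q = fun i j => bkpR (p i) (q i) (p j) (q j) := by
    ext i j
    simp only [interaction, hξdef, bkpNumer, bkpDenom, bkpR]
    rw [div_mul_div_comm, div_mul_div_comm, div_mul_div_comm]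
    ring_nf
  have hX : ∀ v : ℂ, ∀ i, BKPRegular v (p i) (q i) → bkpX v (p i) (q i) ≠ 0 := fun v i h =>
    div_ne_zero (mul_ne_zero h.1 h.2.1) (mul_ne_zero h.2.2.1 h.2.2.2)
  have main := isMixedBKP_nSoliton hξ (.a : Letter N) .b .c .o .p .q
    (fun i => by
      simp only [hξdef, bkpNumer, bkpDenom, mul_one]
      exact div_ne_zero (sub_ne_zero.2 (hne i)) (hpq i i))
    (fun i => by rw [hA]; exact hX a i (hreg i).1) (fun i => by rw [hB]; exact hX b i (hreg i).2.1)
    (fun i => by rw [hC]; exact hX c i (hreg i).2.2)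
    (by simp [hξdef, bkpNumer, bkpDenom]) (by simp [hξdef, bkpNumer, bkpDenom])
    (by simp [hξdef, bkpNumer, bkpDenom]) d
  rw [hA, hB, hC, hO, hR] at main
  intro k l m
  have h := main k l m
  have e1 : ξ .a .o = 1 := by simp [hξdef, bkpNumer, bkpDenom]
  have e2 : ξ .b .o = 1 := by simp [hξdef, bkpNumer, bkpDenom]
  have e3 : ξ .c .o = 1 := by simp [hξdef, bkpNumer, bkpDenom]
  have e4 : ξ .a .b = (b - a) / (a + b) := by simp [hξdef, bkpNumer, bkpDenom, add_comm]
  have e5 : ξ .a .c = (c - a) / (a + c) := by simp [hξdef, bkpNumer, bkpDenom, add_comm]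
  have e6 : ξ .b .c = (c - b) / (b + c) := by simp [hξdef, bkpNumer, bkpDenom, add_comm]
  simp only [e1, e2, e3, e4, e5, e6, one_zpow, one_mul, mul_one] at h
  field_simp at h
  unfold bkpA bkpB bkpC bkpD
  linear_combination -h

lemma eventually_add_mul_ne_zero (u : ℂ) {s : ℂ} (hs : s ≠ 0) :
    ∀ᶠ t in 𝓝[≠] (0 : ℂ), u + t * s ≠ 0 :=
  eventually_ne_of_differentiable (f := fun t => u + t * s) (by fun_prop) (w := (1 - u) / s)
    (by field_simp; simp) 0

lemma bkpX_ne_zero {a p q : ℂ} (h : BKPRegular a p q) : bkpX a p q ≠ 0 :=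
  div_ne_zero (mul_ne_zero h.1 h.2.1) (mul_ne_zero h.2.2.1 h.2.2.2)

lemma continuousAt_bkpX {T : Type*} [TopologicalSpace T] {a p q : T → ℂ} {t : T}
    (ha : ContinuousAt a t) (hp : ContinuousAt p t) (hq : ContinuousAt q t)
    (h : BKPRegular (a t) (p t) (q t)) : ContinuousAt (fun t => bkpX (a t) (p t) (q t)) t := by
  unfold bkpX
  exact ContinuousAt.div (by fun_prop) (by fun_prop) (mul_ne_zero h.2.2.1 h.2.2.2)

lemma eventually_bkpRegular {T : Type*} [TopologicalSpace T] {a p q : T → ℂ} {t : T}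
    (ha : ContinuousAt a t) (hp : ContinuousAt p t) (hq : ContinuousAt q t)
    (h : BKPRegular (a t) (p t) (q t)) : ∀ᶠ t in 𝓝 t, BKPRegular (a t) (p t) (q t) := by
  have h1 : ContinuousAt (fun t => 1 - a t * p t) t := by fun_prop
  have h2 : ContinuousAt (fun t => 1 - a t * q t) t := by fun_prop
  have h3 : ContinuousAt (fun t => a t * p t + 1) t := by fun_prop
  have h4 : ContinuousAt (fun t => a t * q t + 1) t := by fun_prop
  exact (h1.eventually_ne h.1).and ((h2.eventually_ne h.2.1).and
    ((h3.eventually_ne h.2.2.1).and (h4.eventually_ne h.2.2.2)))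

/-- The BKP soliton solution in Miwa coordinates. Coinciding or opposite parameters are reached as a
limit. -/
theorem isBKPSolution_nSoliton {a b c : ℂ} {p q : Fin N → ℂ}
    (hreg : ∀ i, BKPRegular a (p i) (q i) ∧ BKPRegular b (p i) (q i) ∧ BKPRegular c (p i) (q i))
    (hR : ∀ i j, i < j → q i + q j ≠ 0 ∧ q i + p j ≠ 0 ∧ p i + q j ≠ 0 ∧ p i + p j ≠ 0)
    (d : Fin N → ℂ) :
    IsBKPSolution (bkpA a b c) (bkpB a b c) (bkpC a b c) (bkpD a b c)
      (nSoliton (fun i j => bkpR (p i) (q i) (p j) (q j)) d (fun i => bkpX a (p i) (q i))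
        (fun i => bkpX b (p i) (q i)) (fun i => bkpX c (p i) (q i))) := by
  -- the parameters move away from the exceptional set with pairwise different positive speeds
  let a' : ℂ → ℂ := fun t => a + t
  let b' : ℂ → ℂ := fun t => b + t * 2
  let c' : ℂ → ℂ := fun t => c + t * 3
  let p' : ℂ → Fin N → ℂ := fun t i => p i + t * ((2 * i + 1 : ℕ) : ℂ)
  let q' : ℂ → Fin N → ℂ := fun t i => q i + t * ((2 * i + 2 : ℕ) : ℂ)
  have ha' : Continuous a' := by fun_prop
  have hb' : Continuous b' := by fun_prop
  have hc' : Continuous c' := by fun_prop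
  have hp' : ∀ i, Continuous fun t => p' t i := fun i => by fun_prop
  have hq' : ∀ i, Continuous fun t => q' t i := fun i => by fun_prop
  have a0 : a' 0 = a := by simp [a']
  have b0 : b' 0 = b := by simp [b']
  have c0 : c' 0 = c := by simp [c']
  have p0 : ∀ i, p' 0 i = p i := fun i => by simp [p']
  have q0 : ∀ i, q' 0 i = q i := fun i => by simp [q']
  have cast_ne : ∀ n : ℕ, n ≠ 0 → (n : ℂ) ≠ 0 := fun n hn => Nat.cast_ne_zero.2 hn
  have hev : ∀ᶠ t in 𝓝[≠] (0 : ℂ), IsBKPSolution (bkpA (a' t) (b' t) (c' t))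
      (bkpB (a' t) (b' t) (c' t)) (bkpC (a' t) (b' t) (c' t)) (bkpD (a' t) (b' t) (c' t))
      (nSoliton (fun i j => bkpR (p' t i) (q' t i) (p' t j) (q' t j)) d
        (fun i => bkpX (a' t) (p' t i) (q' t i))
        (fun i => bkpX (b' t) (p' t i) (q' t i)) (fun i => bkpX (c' t) (p' t i) (q' t i))) := by
    have key : ∀ (u v : ℂ) (m n : ℕ), m + n ≠ 0 →
        ∀ᶠ t in 𝓝[≠] (0 : ℂ), (u + t * m) + (v + t * n) ≠ 0 := fun u v m n hmn =>
      (eventually_add_mul_ne_zero (u + v) (cast_ne _ hmn)).mono fun t ht => by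
        push_cast at ht; convert ht using 1; ring
    have hr : ∀ (v : ℂ → ℂ), Continuous v → (∀ i, BKPRegular (v 0) (p i) (q i)) →
        ∀ᶠ t in 𝓝[≠] (0 : ℂ), ∀ i, BKPRegular (v t) (p' t i) (q' t i) := fun v hv h =>
      eventually_all.2 fun i => (eventually_bkpRegular hv.continuousAt (hp' i).continuousAt
        (hq' i).continuousAt (by rw [p0, q0]; exact h i)).filter_mono nhdsWithin_le_nhds
    filter_upwards [hr a' ha' (fun i => a0 ▸ (hreg i).1), hr b' hb' (fun i => b0 ▸ (hreg i).2.1),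
      hr c' hc' (fun i => c0 ▸ (hreg i).2.2), key a b 1 2 (by simp), key a c 1 3 (by simp),
      key b c 2 3 (by simp),
      eventually_all.2 fun i : Fin N => key (p i) 0 (2 * i + 1) 0 (by simp),
      eventually_all.2 fun i : Fin N => key (q i) 0 (2 * i + 2) 0 (by simp),
      eventually_all.2 fun i : Fin N => eventually_all.2 fun j : Fin N =>
        key (p i) (p j) (2 * i + 1) (2 * j + 1) (by simp),
      eventually_all.2 fun i : Fin N => eventually_all.2 fun j : Fin N =>
        key (q i) (q j) (2 * i + 2) (2 * j + 2) (by simp),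
      eventually_all.2 fun i : Fin N => eventually_all.2 fun j : Fin N =>
        key (p i) (q j) (2 * i + 1) (2 * j + 2) (by simp),
      eventually_all.2 fun i : Fin N =>
        eventually_add_mul_ne_zero (q i - p i) (one_ne_zero)] with
        t h1 h2 h3 h4 h5 h6 h7 h8 h9 h10 h11 h12
    refine isBKPSolution_of_generic (fun i => ⟨h1 i, h2 i, h3 i⟩) (by simpa [a', b'] using h4)
      (by simpa [a', c'] using h5) (by simpa [b', c'] using h6)
      (fun i => by simpa [p'] using h7 i) (fun i => by simpa [q'] using h8 i)
      (fun i j _ => h9 i j) (fun i j _ => h10 i j) (fun i j => h11 i j) (fun i h => h12 i ?_) d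
    simp only [p', q'] at h
    push_cast at h
    linear_combination -h
  intro k l m
  have hX : ∀ v : ℂ → ℂ, Continuous v → (∀ i, BKPRegular (v 0) (p i) (q i)) → ∀ i,
      Tendsto (fun t => bkpX (v t) (p' t i) (q' t i)) (𝓝[≠] 0) (𝓝 (bkpX (v 0) (p i) (q i))) :=
    fun v hv h i => by
      have := (continuousAt_bkpX hv.continuousAt (hp' i).continuousAt (hq' i).continuousAt
        (t := 0) (by rw [p0, q0]; exact h i)).tendsto.mono_left
        (nhdsWithin_le_nhds (s := {0}ᶜ))
      rwa [p0, q0] at this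
  have hlim := fun k l m => tendsto_nSoliton (F := 𝓝[≠] (0 : ℂ)) d
    (R := fun t i j => bkpR (p' t i) (q' t i) (p' t j) (q' t j))
    (R₀ := fun i j => bkpR (p i) (q i) (p j) (q j))
    (fun i j hij => by
      have : ContinuousAt (fun t => bkpR (p' t i) (q' t i) (p' t j) (q' t j)) 0 := by
        have h1 := hp' i
        have h2 := hq' i
        have h3 := hp' j
        have h4 := hq' j
        unfold bkpR
        refine ContinuousAt.div (by fun_prop) (by fun_prop) ?_
        obtain ⟨g1, g2, g3, g4⟩ := hR i j hij
        simp only [p0, q0]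
        exact mul_ne_zero (mul_ne_zero (mul_ne_zero g1 g2) g3) g4
      have := this.tendsto.mono_left (nhdsWithin_le_nhds (s := {0}ᶜ))
      simpa only [p0, q0] using this)
    (hX a' ha' fun i => a0 ▸ (hreg i).1) (hX b' hb' fun i => b0 ▸ (hreg i).2.1)
    (hX c' hc' fun i => c0 ▸ (hreg i).2.2)
    (fun i => bkpX_ne_zero (a0 ▸ (hreg i).1)) (fun i => bkpX_ne_zero (b0 ▸ (hreg i).2.1))
    (fun i => bkpX_ne_zero (c0 ▸ (hreg i).2.2)) k l m
  simp only [a0, b0, c0] at hlim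
  have hcoef : ∀ f : ℂ → ℂ → ℂ → ℂ, Continuous (fun v : ℂ × ℂ × ℂ => f v.1 v.2.1 v.2.2) →
      Tendsto (fun t => f (a' t) (b' t) (c' t)) (𝓝[≠] 0) (𝓝 (f a b c)) := fun f hf => by
    have := (hf.comp (ha'.prodMk (hb'.prodMk hc'))).tendsto 0
    simp only [Function.comp, a0, b0, c0] at this
    exact this.mono_left nhdsWithin_le_nhds
  have h := ((((hcoef bkpA (by unfold bkpA; fun_prop)).mul
      ((hlim (k + 1) l m).mul (hlim k (l + 1) (m + 1)))).add
    ((hcoef bkpB (by unfold bkpB; fun_prop)).mul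
      ((hlim k (l + 1) m).mul (hlim (k + 1) l (m + 1))))).add
    ((hcoef bkpC (by unfold bkpC; fun_prop)).mul
      ((hlim k l (m + 1)).mul (hlim (k + 1) (l + 1) m)))).add
    ((hcoef bkpD (by unfold bkpD; fun_prop)).mul
      ((hlim k l m).mul (hlim (k + 1) (l + 1) (m + 1))))
  exact tendsto_nhds_unique h (tendsto_const_nhds.congr' (hev.mono fun t ht => (ht k l m).symm))

/-- A soliton solution of an equation of BKP type gives one of the dual AKP equation: the function
`σ` itself solves the linear problem. -/
lemma dakpNum_of_isBKPSolution {A B C D : ℂ} {R : Fin N → Fin N → ℂ} {X Y Z x y z : Fin N → ℂ}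
    (hX : ∀ i, X i ≠ 0) (hY : ∀ i, Y i ≠ 0) (hZ : ∀ i, Z i ≠ 0)
    (hx : ∀ i, x i = Y i * Z i) (hy : ∀ i, y i = X i * Z i) (hz : ∀ i, z i = X i * Y i)
    (h : ∀ c, IsBKPSolution A B C D (nSoliton R c X Y Z)) (d : Fin N → ℂ) (k l m : ℤ) :
    dakpNum ![A ^ 2, B ^ 2, C ^ 2, -D ^ 2] (nSoliton R d x y z) k l m = 0 := by
  rw [changeVars_nSoliton (fun _ => 1) R d hX hY hZ (by simpa using hx) (by simpa using hy)
    (by simpa using hz)]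
  exact dakpNum_changeVars_nSoliton_eq_zero R X Y Z (fun c => nSoliton R c X Y Z)
    (fun c k l m => differentiable_nSoliton R c X Y Z k l m)
    (fun k l m => by rw [nSoliton_zero]; exact one_ne_zero) h h d k l m

lemma dakpNum_bkp {a b c : ℂ} {p q : Fin N → ℂ}
    (hreg : ∀ i, BKPRegular a (p i) (q i) ∧ BKPRegular b (p i) (q i) ∧ BKPRegular c (p i) (q i))
    (hR : ∀ i j, i < j → q i + q j ≠ 0 ∧ q i + p j ≠ 0 ∧ p i + q j ≠ 0 ∧ p i + p j ≠ 0)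
    (d : Fin N → ℂ) (k l m : ℤ) :
    dakpNum (bkpParams a b c) (nSoliton (fun i j => bkpR (p i) (q i) (p j) (q j)) d
      (fun i => bkpX b (p i) (q i) * bkpX c (p i) (q i))
      (fun i => bkpX a (p i) (q i) * bkpX c (p i) (q i))
      (fun i => bkpX a (p i) (q i) * bkpX b (p i) (q i))) k l m = 0 :=
  dakpNum_of_isBKPSolution (fun i => bkpX_ne_zero (hreg i).1) (fun i => bkpX_ne_zero (hreg i).2.1)
    (fun i => bkpX_ne_zero (hreg i).2.2) (fun _ => rfl) (fun _ => rfl) (fun _ => rfl)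
    (isBKPSolution_nSoliton hreg hR) d k l m

lemma dispQ_bkp {a b c p q : ℂ} (ha : BKPRegular a p q) (hb : BKPRegular b p q)
    (hc : BKPRegular c p q) : dispQ (bkpParams a b c) (bkpX b p q * bkpX c p q)
      (bkpX a p q * bkpX c p q) (bkpX a p q * bkpX b p q) = 0 :=
  dispQ_eq_zero_of_nSoliton (r := bkpR p q p q) fun d =>
    dakpNum_bkp (N := 1) (p := fun _ => p) (q := fun _ => q) (fun _ => ⟨ha, hb, hc⟩)
      (fun i j hij => by omega) d 1 1 1

lemma bkpX_comm (a p q : ℂ) : bkpX a p q = bkpX a q p := by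
  unfold bkpX
  ring_nf

lemma BKPRegular.symm {a p q : ℂ} (h : BKPRegular a p q) : BKPRegular a q p :=
  ⟨h.2.1, h.1, h.2.2.2, h.2.2.1⟩

/-- If `q + q' = 0`, the factors of `q` and `q'` cancel. -/
lemma bkpX_mul_bkpX {a p q p' q' : ℂ} (h : BKPRegular a p q) (h' : BKPRegular a p' q')
    (hqq : q + q' = 0) : bkpX a p q * bkpX a p' q' = bkpX a p p' := by
  obtain rfl : q' = -q := by linear_combination hqq
  obtain ⟨h1, h2, h3, h4⟩ := h
  obtain ⟨h1', h2', h3', h4'⟩ := h'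
  unfold bkpX
  rw [div_mul_div_comm, div_eq_div_iff (mul_ne_zero (mul_ne_zero h3 h4) (mul_ne_zero h3' h4'))
    (mul_ne_zero h3 h3')]
  ring

/-- If an end point of the first soliton is opposite to one of the second, then the product of the
two momenta is the momentum of a single soliton, and it obeys the dispersion relation. -/
lemma dispQ_mul_eq_zero_of_add_eq_zero {a b c p q p' q' : ℂ}
    (h : BKPRegular a p q ∧ BKPRegular b p q ∧ BKPRegular c p q)
    (h' : BKPRegular a p' q' ∧ BKPRegular b p' q' ∧ BKPRegular c p' q') (hqq : q + q' = 0) :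
    dispQ (bkpParams a b c) (bkpX b p q * bkpX c p q * (bkpX b p' q' * bkpX c p' q'))
      (bkpX a p q * bkpX c p q * (bkpX a p' q' * bkpX c p' q'))
      (bkpX a p q * bkpX b p q * (bkpX a p' q' * bkpX b p' q')) = 0 := by
  have hr : ∀ v, BKPRegular v p q → BKPRegular v p' q' → BKPRegular v p p' := fun v h h' =>
    ⟨h.1, h'.1, h.2.2.1, h'.2.2.1⟩
  rw [mul_mul_mul_comm (bkpX b p q), mul_mul_mul_comm (bkpX a p q) (bkpX c p q),
    mul_mul_mul_comm (bkpX a p q) (bkpX b p q),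
    bkpX_mul_bkpX h.1 h'.1 hqq, bkpX_mul_bkpX h.2.1 h'.2.1 hqq, bkpX_mul_bkpX h.2.2 h'.2.2 hqq]
  exact dispQ_bkp (hr a h.1 h'.1) (hr b h.2.1 h'.2.1) (hr c h.2.2 h'.2.2)

lemma dakpR_bkp {a b c p q p' q' : ℂ}
    (h : BKPRegular a p q ∧ BKPRegular b p q ∧ BKPRegular c p q)
    (h' : BKPRegular a p' q' ∧ BKPRegular b p' q' ∧ BKPRegular c p' q')
    (hQ : dispQ (bkpParams a b c) (bkpX b p q * bkpX c p q * (bkpX b p' q' * bkpX c p' q'))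
      (bkpX a p q * bkpX c p q * (bkpX a p' q' * bkpX c p' q'))
      (bkpX a p q * bkpX b p q * (bkpX a p' q' * bkpX b p' q')) ≠ 0) :
    dakpR (bkpParams a b c) (bkpX b p q * bkpX c p q) (bkpX a p q * bkpX c p q)
      (bkpX a p q * bkpX b p q) (bkpX b p' q' * bkpX c p' q') (bkpX a p' q' * bkpX c p' q')
      (bkpX a p' q' * bkpX b p' q') = bkpR p q p' q' := by
  have symm : ∀ {p q : ℂ}, (BKPRegular a p q ∧ BKPRegular b p q ∧ BKPRegular c p q) →
      BKPRegular a q p ∧ BKPRegular b q p ∧ BKPRegular c q p := fun h =>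
    ⟨h.1.symm, h.2.1.symm, h.2.2.symm⟩
  have h1 : q + q' ≠ 0 := fun h0 => hQ (dispQ_mul_eq_zero_of_add_eq_zero h h' h0)
  have h2 : q + p' ≠ 0 := fun h0 => hQ (by
    simp only [bkpX_comm _ p' q']; exact dispQ_mul_eq_zero_of_add_eq_zero h (symm h') h0)
  have h3 : p + q' ≠ 0 := fun h0 => hQ (by
    simp only [bkpX_comm _ p q]; exact dispQ_mul_eq_zero_of_add_eq_zero (symm h) h' h0)
  have h4 : p + p' ≠ 0 := fun h0 => hQ (by
    simp only [bkpX_comm _ p q, bkpX_comm _ p' q']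
    exact dispQ_mul_eq_zero_of_add_eq_zero (symm h) (symm h') h0)
  have hsol := dakpNum_bkp (a := a) (b := b) (c := c) (N := 2) (p := ![p, p']) (q := ![q, q'])
    (Fin.forall_fin_two.2 ⟨h, h'⟩) (fun i j hij => by
      obtain ⟨rfl, rfl⟩ : i = 0 ∧ j = 1 := by omega
      exact ⟨h1, h2, h3, h4⟩)
  have := dakpR_eq_of_nSoliton fun d => hsol d 1 1 1
  simp only [Matrix.cons_val] at this
  exact this hQ

theorem bkp_miwa (a b c : ℂ) (N : ℕ) (p q : Fin N → ℂ)
    (hreg : ∀ i, BKPRegular a (p i) (q i) ∧ BKPRegular b (p i) (q i) ∧ BKPRegular c (p i) (q i))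
    (X Y Z x y z : Fin N → ℂ)
    (hX : ∀ i, X i = bkpX a (p i) (q i)) (hY : ∀ i, Y i = bkpX b (p i) (q i))
    (hZ : ∀ i, Z i = bkpX c (p i) (q i))
    (hx : ∀ i, x i = Y i * Z i) (hy : ∀ i, y i = X i * Z i) (hz : ∀ i, z i = X i * Y i) :
    (∀ i, dispQ (bkpParams a b c) (x i) (y i) (z i) = 0) ∧
    (∀ i j, i ≠ j → dispQ (bkpParams a b c) (x i * x j) (y i * y j) (z i * z j) ≠ 0 →
      dakpR (bkpParams a b c) (x i) (y i) (z i) (x j) (y j) (z j)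
        = bkpR (p i) (q i) (p j) (q j)) ∧
    ((∀ i j, i < j → q i + q j ≠ 0 ∧ q i + p j ≠ 0 ∧ p i + q j ≠ 0 ∧ p i + p j ≠ 0) →
      ∀ (d : Fin N → ℂ) (R : Fin N → Fin N → ℂ),
      (∀ i j, R i j = bkpR (p i) (q i) (p j) (q j)) →
      IsBKPSolution (bkpA a b c) (bkpB a b c) (bkpC a b c) (bkpD a b c)
        (nSoliton R d X Y Z) ∧
      nSoliton R d x y z = changeVars (fun _ => 1) (nSoliton R d X Y Z) ∧
      IsDAKPSolution (bkpParams a b c) (nSoliton R d x y z)) := by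
  obtain rfl := funext hX
  obtain rfl := funext hY
  obtain rfl := funext hZ
  obtain rfl := funext hx
  obtain rfl := funext hy
  obtain rfl := funext hz
  refine ⟨fun i => dispQ_bkp (hreg i).1 (hreg i).2.1 (hreg i).2.2,
    fun i j _ hQ => dakpR_bkp (hreg i) (hreg j) hQ, fun hR d R hRR => ?_⟩
  obtain rfl : R = fun i j => bkpR (p i) (q i) (p j) (q j) := funext fun i => funext fun j => hRR i j
  refine ⟨isBKPSolution_nSoliton hreg hR d, ?_,
    isDAKPSolution_of_dakpNum (dakpNum_bkp hreg hR d)⟩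
  exact changeVars_nSoliton _ _ d (fun i => bkpX_ne_zero (hreg i).1)
    (fun i => bkpX_ne_zero (hreg i).2.1) (fun i => bkpX_ne_zero (hreg i).2.2)
    (by simp) (by simp) (by simp)

end Lattice

/-! ### Solitons of AKP -/

section AKP

variable {N : ℕ}

lemma akpX_ne_zero {a p q : ℂ} (h : AKPRegular a p q) : akpX a p q ≠ 0 := div_ne_zero h.2 h.1

lemma eventually_affine_ne_zero {u v : ℂ} (h : u ≠ 0 ∨ v ≠ 0) :
    ∀ᶠ s in 𝓝[≠] (0 : ℂ), u + s * v ≠ 0 := by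
  rcases eq_or_ne v 0 with rfl | hv
  · simpa using h
  · exact eventually_add_mul_ne_zero u hv

/-- AKP solitons are limits of BKP solitons: the end points `1 + s q` and `-1 - s p` and the lattice
points `(a + s) / a` of the projective line come together in the two opposite points `1` and `-1`
as `s → 0`. -/
lemma isAKPSolution_nSoliton_of_ne_zero {a b c : ℂ} (ha : a ≠ 0) (hb : b ≠ 0) (hc : c ≠ 0)
    {p q : Fin N → ℂ}
    (hreg : ∀ i, AKPRegular a (p i) (q i) ∧ AKPRegular b (p i) (q i) ∧ AKPRegular c (p i) (q i))
    (hR : ∀ i j, i < j → p j ≠ q i ∧ p i ≠ q j) (d : Fin N → ℂ) :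
    IsAKPSolution (akpA a b c) (akpB a b c) (akpC a b c)
      (nSoliton (fun i j => akpR (p i) (q i) (p j) (q j)) d (fun i => akpX a (p i) (q i))
        (fun i => akpX b (p i) (q i)) (fun i => akpX c (p i) (q i))) := by
  have small : ∀ v : ℂ, v ≠ 0 → ∀ w : ℂ, ∀ᶠ s in 𝓝[≠] (0 : ℂ), v + s * w ≠ 0 := fun v hv w =>
    eventually_affine_ne_zero (Or.inl hv)
  have hs0 : ∀ᶠ s in 𝓝[≠] (0 : ℂ), s ≠ 0 := self_mem_nhdsWithin
  -- explicit form of the BKP data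
  have form : ∀ v : ℂ, v ≠ 0 → ∀ i, AKPRegular v (p i) (q i) → ∀ᶠ s in 𝓝[≠] (0 : ℂ),
      BKPRegular (v / (v + s)) (1 + s * q i) (-1 - s * p i) ∧
      bkpX (v / (v + s)) (1 + s * q i) (-1 - s * p i)
        = akpX v (p i) (q i) * ((2 * v + s * (1 + v * p i)) / (2 * v + s * (1 + v * q i))) := by
    intro v hv i h
    filter_upwards [hs0, small v hv 1, small (2 * v) (by simpa using hv) (1 + v * p i),
      small (2 * v) (by simpa using hv) (1 + v * q i)] with s hs h1 h2 h3
    rw [mul_one] at h1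
    have e1 : 1 - v / (v + s) * (1 + s * q i) = s * (1 - v * q i) / (v + s) := by field_simp; ring
    have e2 : 1 - v / (v + s) * (-1 - s * p i) = (2 * v + s * (1 + v * p i)) / (v + s) := by
      field_simp; ring
    have e3 : v / (v + s) * (1 + s * q i) + 1 = (2 * v + s * (1 + v * q i)) / (v + s) := by
      field_simp; ring
    have e4 : v / (v + s) * (-1 - s * p i) + 1 = s * (1 - v * p i) / (v + s) := by field_simp; ring
    have h4 := h.1
    have h5 := h.2
    constructor
    · unfold BKPRegular
      rw [e1, e2, e3, e4]
      simp [*]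
    · unfold bkpX akpX
      rw [e1, e2, e3, e4]
      field_simp
  have lim : ∀ v : ℂ, v ≠ 0 → (∀ i, AKPRegular v (p i) (q i)) → ∀ i,
      Tendsto (fun s => bkpX (v / (v + s)) (1 + s * q i) (-1 - s * p i)) (𝓝[≠] 0)
        (𝓝 (akpX v (p i) (q i))) := by
    intro v hv h i
    have hc : ContinuousAt (fun s : ℂ => akpX v (p i) (q i)
        * ((2 * v + s * (1 + v * p i)) / (2 * v + s * (1 + v * q i)))) 0 := by
      refine continuousAt_const.mul (ContinuousAt.div (by fun_prop) (by fun_prop) (by simpa using hv))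
    have := hc.tendsto.mono_left (nhdsWithin_le_nhds (s := {0}ᶜ))
    simp only [zero_mul, add_zero, div_self (mul_ne_zero two_ne_zero hv), mul_one] at this
    exact this.congr' ((form v hv i (h i)).mono fun s hs => hs.2.symm)
  have limR : ∀ i j, i < j → Tendsto (fun s => bkpR (1 + s * q i) (-1 - s * p i) (1 + s * q j)
      (-1 - s * p j)) (𝓝[≠] 0) (𝓝 (akpR (p i) (q i) (p j) (q j))) := by
    intro i j hij
    obtain ⟨g1, g2⟩ := hR i j hij
    have g1 := sub_ne_zero.2 g1
    have g2 := sub_ne_zero.2 g2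
    have hc : ContinuousAt (fun s : ℂ => akpR (p i) (q i) (p j) (q j)
        * ((2 + s * (p i + q j)) * (2 + s * (q i + p j))
          / ((2 + s * (p i + p j)) * (2 + s * (q i + q j))))) 0 := by
      refine continuousAt_const.mul (ContinuousAt.div (by fun_prop) (by fun_prop) (by simp))
    have := hc.tendsto.mono_left (nhdsWithin_le_nhds (s := {0}ᶜ))
    simp only [zero_mul, add_zero] at this
    rw [div_self (by norm_num), mul_one] at this
    refine this.congr' ?_
    filter_upwards [hs0, small 2 two_ne_zero (p i + p j), small 2 two_ne_zero (q i + q j)] with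
      s hs h1 h2
    have e1 : -1 - s * p i + (-1 - s * p j) = -(2 + s * (p i + p j)) := by ring
    have e2 : -1 - s * p i + (1 + s * q j) = -(s * (p i - q j)) := by ring
    have e3 : 1 + s * q i + (-1 - s * p j) = -(s * (p j - q i)) := by ring
    have e4 : 1 + s * q i + (1 + s * q j) = 2 + s * (q i + q j) := by ring
    unfold akpR bkpR
    rw [e1, e2, e3, e4]
    field_simp
    ring
  have hev : ∀ᶠ s in 𝓝[≠] (0 : ℂ), IsBKPSolution (bkpA (a / (a + s)) (b / (b + s)) (c / (c + s)))
      (bkpB (a / (a + s)) (b / (b + s)) (c / (c + s)))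
      (bkpC (a / (a + s)) (b / (b + s)) (c / (c + s)))
      (bkpD (a / (a + s)) (b / (b + s)) (c / (c + s)))
      (nSoliton (fun i j => bkpR (1 + s * q i) (-1 - s * p i) (1 + s * q j) (-1 - s * p j)) d
        (fun i => bkpX (a / (a + s)) (1 + s * q i) (-1 - s * p i))
        (fun i => bkpX (b / (b + s)) (1 + s * q i) (-1 - s * p i))
        (fun i => bkpX (c / (c + s)) (1 + s * q i) (-1 - s * p i))) := by
    filter_upwards [hs0, eventually_all.2 fun i => form a ha i (hreg i).1,
      eventually_all.2 fun i => form b hb i (hreg i).2.1,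
      eventually_all.2 fun i => form c hc i (hreg i).2.2,
      eventually_all.2 fun i => eventually_all.2 fun j => small 2 two_ne_zero (p i + p j),
      eventually_all.2 fun i => eventually_all.2 fun j => small 2 two_ne_zero (q i + q j)]
      with s hs h1 h2 h3 h4 h5
    refine isBKPSolution_nSoliton (p := fun i => 1 + s * q i) (q := fun i => -1 - s * p i)
      (fun i => ⟨(h1 i).1, (h2 i).1, (h3 i).1⟩) (fun i j hij => ?_) d
    obtain ⟨g1, g2⟩ := hR i j hij
    have e1 : -1 - s * p i + (-1 - s * p j) = -(2 + s * (p i + p j)) := by ring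
    have e2 : -1 - s * p i + (1 + s * q j) = -(s * (p i - q j)) := by ring
    have e3 : 1 + s * q i + (-1 - s * p j) = -(s * (p j - q i)) := by ring
    have e4 : 1 + s * q i + (1 + s * q j) = 2 + s * (q i + q j) := by ring
    rw [e1, e2, e3, e4]
    exact ⟨neg_ne_zero.2 (h4 i j), neg_ne_zero.2 (mul_ne_zero hs (sub_ne_zero.2 g2)),
      neg_ne_zero.2 (mul_ne_zero hs (sub_ne_zero.2 g1)), h5 i j⟩
  intro k l m
  have hlim := fun k l m => tendsto_nSoliton d limR (lim a ha fun i => (hreg i).1)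
    (lim b hb fun i => (hreg i).2.1) (lim c hc fun i => (hreg i).2.2)
    (fun i => akpX_ne_zero (hreg i).1) (fun i => akpX_ne_zero (hreg i).2.1)
    (fun i => akpX_ne_zero (hreg i).2.2) k l m
  have hcoef : ∀ f : ℂ → ℂ, ContinuousAt f 0 → Tendsto f (𝓝[≠] 0) (𝓝 (f 0)) := fun f hf =>
    hf.tendsto.mono_left nhdsWithin_le_nhds
  -- the BKP coefficients, multiplied by `(a + s) (b + s) (c + s) / s`
  have cA := hcoef (fun s => (b / (b + s) + a / (a + s)) * (c / (c + s) + a / (a + s))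
    * ((b - c) * (a + s))) (by fun_prop (disch := simpa))
  have cB := hcoef (fun s => (c / (c + s) + b / (b + s)) * (b / (b + s) + a / (a + s))
    * ((c - a) * (b + s))) (by fun_prop (disch := simpa))
  have cC := hcoef (fun s => (c / (c + s) + a / (a + s)) * (c / (c + s) + b / (b + s))
    * ((a - b) * (c + s))) (by fun_prop (disch := simpa))
  have cD := hcoef (fun s => s ^ 2 * ((a - b) * (b - c) * (c - a))
    / ((a + s) * (b + s) * (c + s))) (by fun_prop (disch := simp [*]))
  have h := (((cA.mul ((hlim (k + 1) l m).mul (hlim k (l + 1) (m + 1)))).add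
    (cB.mul ((hlim k (l + 1) m).mul (hlim (k + 1) l (m + 1))))).add
    (cC.mul ((hlim k l (m + 1)).mul (hlim (k + 1) (l + 1) m)))).add
    (cD.mul ((hlim k l m).mul (hlim (k + 1) (l + 1) (m + 1))))
  have h0 := tendsto_nhds_unique h (tendsto_const_nhds.congr' (f₁ := fun _ => (0 : ℂ)) (by
    filter_upwards [hev, hs0, small a ha 1, small b hb 1, small c hc 1] with s hs hs0 h1 h2 h3
    rw [mul_one] at h1 h2 h3
    have := hs k l m
    have eA : (b / (b + s) + a / (a + s)) * (c / (c + s) + a / (a + s)) * ((b - c) * (a + s))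
        = bkpA (a / (a + s)) (b / (b + s)) (c / (c + s)) * ((a + s) * (b + s) * (c + s) / s) := by
      unfold bkpA; field_simp; ring
    have eB : (c / (c + s) + b / (b + s)) * (b / (b + s) + a / (a + s)) * ((c - a) * (b + s))
        = bkpB (a / (a + s)) (b / (b + s)) (c / (c + s)) * ((a + s) * (b + s) * (c + s) / s) := by
      unfold bkpB; field_simp; ring
    have eC : (c / (c + s) + a / (a + s)) * (c / (c + s) + b / (b + s)) * ((a - b) * (c + s))
        = bkpC (a / (a + s)) (b / (b + s)) (c / (c + s)) * ((a + s) * (b + s) * (c + s) / s) := by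
      unfold bkpC; field_simp; ring
    have eD : s ^ 2 * ((a - b) * (b - c) * (c - a)) / ((a + s) * (b + s) * (c + s))
        = bkpD (a / (a + s)) (b / (b + s)) (c / (c + s)) * ((a + s) * (b + s) * (c + s) / s) := by
      unfold bkpD; field_simp; ring
    rw [eA, eB, eC, eD]
    linear_combination (-((a + s) * (b + s) * (c + s) / s)) * this))
  simp only [add_zero, div_self ha, div_self hb, div_self hc, zero_pow two_ne_zero, zero_mul,
    zero_div] at h0
  unfold akpA akpB akpC
  linear_combination h0 / 4

lemma nSoliton_eq_of_x_eq_one {R : Fin N → Fin N → ℂ} {c x y z : Fin N → ℂ}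
    (h : ∀ i, x i = 1) (k k' l m : ℤ) : nSoliton R c x y z k l m = nSoliton R c x y z k' l m := by
  simp [nSoliton_eq_solitonSum, h]

lemma nSoliton_eq_of_y_eq_one {R : Fin N → Fin N → ℂ} {c x y z : Fin N → ℂ}
    (h : ∀ i, y i = 1) (k l l' m : ℤ) : nSoliton R c x y z k l m = nSoliton R c x y z k l' m := by
  simp [nSoliton_eq_solitonSum, h]

lemma nSoliton_eq_of_z_eq_one {R : Fin N → Fin N → ℂ} {c x y z : Fin N → ℂ}
    (h : ∀ i, z i = 1) (k l m m' : ℤ) : nSoliton R c x y z k l m = nSoliton R c x y z k l m' := by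
  simp [nSoliton_eq_solitonSum, h]

/-- The AKP soliton solution in Miwa coordinates. If a lattice parameter vanishes, the function does
not depend on the corresponding variable and the equation is trivial. -/
theorem isAKPSolution_nSoliton {a b c : ℂ} {p q : Fin N → ℂ}
    (hreg : ∀ i, AKPRegular a (p i) (q i) ∧ AKPRegular b (p i) (q i) ∧ AKPRegular c (p i) (q i))
    (hR : ∀ i j, i < j → p j ≠ q i ∧ p i ≠ q j) (d : Fin N → ℂ) :
    IsAKPSolution (akpA a b c) (akpB a b c) (akpC a b c)
      (nSoliton (fun i j => akpR (p i) (q i) (p j) (q j)) d (fun i => akpX a (p i) (q i))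
        (fun i => akpX b (p i) (q i)) (fun i => akpX c (p i) (q i))) := by
  have h0 : ∀ p q, akpX 0 p q = 1 := fun p q => by simp [akpX]
  rcases eq_or_ne a 0 with rfl | ha
  · intro k l m
    rw [nSoliton_eq_of_x_eq_one (fun i => h0 (p i) (q i)) (k + 1) k l (m + 1),
      nSoliton_eq_of_x_eq_one (fun i => h0 (p i) (q i)) (k + 1) k (l + 1) m]
    unfold akpA akpB akpC
    ring
  rcases eq_or_ne b 0 with rfl | hb
  · intro k l m
    rw [nSoliton_eq_of_y_eq_one (fun i => h0 (p i) (q i)) k (l + 1) l (m + 1),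
      nSoliton_eq_of_y_eq_one (fun i => h0 (p i) (q i)) (k + 1) (l + 1) l m]
    unfold akpA akpB akpC
    ring
  rcases eq_or_ne c 0 with rfl | hc
  · intro k l m
    rw [nSoliton_eq_of_z_eq_one (fun i => h0 (p i) (q i)) k (l + 1) (m + 1) m,
      nSoliton_eq_of_z_eq_one (fun i => h0 (p i) (q i)) (k + 1) l (m + 1) m]
    unfold akpA akpB akpC
    ring
  exact isAKPSolution_nSoliton_of_ne_zero ha hb hc hreg hR d

/-- Reversing one lattice direction turns the AKP equation into an equation of BKP type in which
another one of the four terms is missing. -/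
lemma exists_isBKPSolution_reversal (ν : Fin 4) (a b c : ℂ) :
    ∃ A B C D : ℂ, akpParams ν a b c = ![A ^ 2, B ^ 2, C ^ 2, -D ^ 2] ∧
      ∀ (R : Fin N → Fin N → ℂ) (d X Y Z : Fin N → ℂ),
        IsAKPSolution (akpA a b c) (akpB a b c) (akpC a b c) (nSoliton R d X Y Z) →
        IsBKPSolution A B C D (nSoliton R d (fun i => X i ^ reversal ν 0)
          (fun i => Y i ^ reversal ν 1) (fun i => Z i ^ reversal ν 2)) := by
  have hrev : ∀ (R : Fin N → Fin N → ℂ) (d X Y Z : Fin N → ℂ) (k l m : ℤ),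
      nSoliton R d (fun i => X i ^ reversal ν 0) (fun i => Y i ^ reversal ν 1)
        (fun i => Z i ^ reversal ν 2) k l m
      = nSoliton R d X Y Z (reversal ν 0 * k) (reversal ν 1 * l) (reversal ν 2 * m) := by
    intro R d X Y Z k l m
    simp only [nSoliton_eq_solitonSum, zpow_mul]
  match ν with
  | 0 =>
    refine ⟨0, akpC a b c, akpB a b c, akpA a b c, by simp [akpParams], fun R d X Y Z h k l m => ?_⟩
    simp only [hrev]
    simp only [show reversal 0 0 = -1 from rfl, show reversal 0 1 = 1 from rfl,
      show reversal 0 2 = 1 from rfl, one_mul, neg_one_mul]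
    have := h (-(k + 1)) l m
    rw [show -(k + 1) + 1 = -k by ring] at this
    linear_combination this
  | 1 =>
    refine ⟨akpC a b c, 0, akpA a b c, akpB a b c, by simp [akpParams], fun R d X Y Z h k l m => ?_⟩
    simp only [hrev]
    simp only [show reversal 1 0 = 1 from rfl, show reversal 1 1 = -1 from rfl,
      show reversal 1 2 = 1 from rfl, one_mul, neg_one_mul]
    have := h k (-(l + 1)) m
    rw [show -(l + 1) + 1 = -l by ring] at this
    linear_combination this
  | 2 =>
    refine ⟨akpB a b c, akpA a b c, 0, akpC a b c, by simp [akpParams], fun R d X Y Z h k l m => ?_⟩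
    simp only [hrev]
    simp only [show reversal 2 0 = 1 from rfl, show reversal 2 1 = 1 from rfl,
      show reversal 2 2 = -1 from rfl, one_mul, neg_one_mul]
    have := h k l (-(m + 1))
    rw [show -(m + 1) + 1 = -m by ring] at this
    linear_combination this
  | 3 =>
    refine ⟨akpA a b c, akpB a b c, akpC a b c, 0, by simp [akpParams], fun R d X Y Z h k l m => ?_⟩
    simp only [hrev]
    simp only [show reversal 3 0 = 1 from rfl, show reversal 3 1 = 1 from rfl,
      show reversal 3 2 = 1 from rfl, one_mul]
    have := h k l m
    linear_combination this

lemma dakpNum_akp (ν : Fin 4) {a b c : ℂ} {p q : Fin N → ℂ}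
    (hreg : ∀ i, AKPRegular a (p i) (q i) ∧ AKPRegular b (p i) (q i) ∧ AKPRegular c (p i) (q i))
    (hR : ∀ i j, i < j → p j ≠ q i ∧ p i ≠ q j) (d : Fin N → ℂ) (k l m : ℤ) :
    dakpNum (akpParams ν a b c) (nSoliton (fun i j => akpR (p i) (q i) (p j) (q j)) d
      (fun i => akpX b (p i) (q i) ^ reversal ν 1 * akpX c (p i) (q i) ^ reversal ν 2)
      (fun i => akpX a (p i) (q i) ^ reversal ν 0 * akpX c (p i) (q i) ^ reversal ν 2)
      (fun i => akpX a (p i) (q i) ^ reversal ν 0 * akpX b (p i) (q i) ^ reversal ν 1)) k l m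
      = 0 := by
  obtain ⟨A, B, C, D, hparams, h⟩ := exists_isBKPSolution_reversal (N := N) ν a b c
  rw [hparams]
  exact dakpNum_of_isBKPSolution (fun i => zpow_ne_zero _ (akpX_ne_zero (hreg i).1))
    (fun i => zpow_ne_zero _ (akpX_ne_zero (hreg i).2.1))
    (fun i => zpow_ne_zero _ (akpX_ne_zero (hreg i).2.2)) (fun _ => rfl) (fun _ => rfl)
    (fun _ => rfl) (fun d => h _ d _ _ _ (isAKPSolution_nSoliton hreg hR d)) d k l m

lemma dispQ_akp (ν : Fin 4) {a b c p q : ℂ} (ha : AKPRegular a p q) (hb : AKPRegular b p q)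
    (hc : AKPRegular c p q) : dispQ (akpParams ν a b c)
      (akpX b p q ^ reversal ν 1 * akpX c p q ^ reversal ν 2)
      (akpX a p q ^ reversal ν 0 * akpX c p q ^ reversal ν 2)
      (akpX a p q ^ reversal ν 0 * akpX b p q ^ reversal ν 1) = 0 :=
  dispQ_eq_zero_of_nSoliton (r := akpR p q p q) fun d =>
    dakpNum_akp ν (N := 1) (p := fun _ => p) (q := fun _ => q) (fun _ => ⟨ha, hb, hc⟩)
      (fun i j hij => by omega) d 1 1 1

/-- If an end point of one soliton coincides with one of opposite type of the other, then the
product of the two momenta is the momentum of a single soliton, and it obeys the dispersion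
relation. -/
lemma dispQ_akp_mul_eq_zero (ν : Fin 4) {a b c p q p' q' : ℂ}
    (h : AKPRegular a p q ∧ AKPRegular b p q ∧ AKPRegular c p q)
    (h' : AKPRegular a p' q' ∧ AKPRegular b p' q' ∧ AKPRegular c p' q') (hpq : p' = q ∨ p = q') :
    dispQ (akpParams ν a b c)
      (akpX b p q ^ reversal ν 1 * akpX c p q ^ reversal ν 2
        * (akpX b p' q' ^ reversal ν 1 * akpX c p' q' ^ reversal ν 2))
      (akpX a p q ^ reversal ν 0 * akpX c p q ^ reversal ν 2
        * (akpX a p' q' ^ reversal ν 0 * akpX c p' q' ^ reversal ν 2))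
      (akpX a p q ^ reversal ν 0 * akpX b p q ^ reversal ν 1
        * (akpX a p' q' ^ reversal ν 0 * akpX b p' q' ^ reversal ν 1)) = 0 := by
  rw [mul_mul_mul_comm (akpX b p q ^ _), mul_mul_mul_comm (akpX a p q ^ _) (akpX c p q ^ _),
    mul_mul_mul_comm (akpX a p q ^ _) (akpX b p q ^ _)]
  simp only [← mul_zpow]
  rcases hpq with rfl | rfl
  · have e : ∀ v, AKPRegular v p p' → akpX v p p' * akpX v p' q' = akpX v p q' := fun v h => by
      have := h.2
      unfold akpX
      field_simp
    rw [e a h.1, e b h.2.1, e c h.2.2]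
    exact dispQ_akp ν ⟨h.1.1, h'.1.2⟩ ⟨h.2.1.1, h'.2.1.2⟩ ⟨h.2.2.1, h'.2.2.2⟩
  · have e : ∀ v, AKPRegular v p q → akpX v p q * akpX v p' p = akpX v p' q := fun v h => by
      have := h.1
      unfold akpX
      field_simp
    rw [e a h.1, e b h.2.1, e c h.2.2]
    exact dispQ_akp ν ⟨h'.1.1, h.1.2⟩ ⟨h'.2.1.1, h.2.1.2⟩ ⟨h'.2.2.1, h.2.2.2⟩

lemma dakpR_akp (ν : Fin 4) {a b c p q p' q' : ℂ}
    (h : AKPRegular a p q ∧ AKPRegular b p q ∧ AKPRegular c p q)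
    (h' : AKPRegular a p' q' ∧ AKPRegular b p' q' ∧ AKPRegular c p' q')
    (hQ : dispQ (akpParams ν a b c)
      (akpX b p q ^ reversal ν 1 * akpX c p q ^ reversal ν 2
        * (akpX b p' q' ^ reversal ν 1 * akpX c p' q' ^ reversal ν 2))
      (akpX a p q ^ reversal ν 0 * akpX c p q ^ reversal ν 2
        * (akpX a p' q' ^ reversal ν 0 * akpX c p' q' ^ reversal ν 2))
      (akpX a p q ^ reversal ν 0 * akpX b p q ^ reversal ν 1
        * (akpX a p' q' ^ reversal ν 0 * akpX b p' q' ^ reversal ν 1)) ≠ 0) :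
    dakpR (akpParams ν a b c) (akpX b p q ^ reversal ν 1 * akpX c p q ^ reversal ν 2)
      (akpX a p q ^ reversal ν 0 * akpX c p q ^ reversal ν 2)
      (akpX a p q ^ reversal ν 0 * akpX b p q ^ reversal ν 1)
      (akpX b p' q' ^ reversal ν 1 * akpX c p' q' ^ reversal ν 2)
      (akpX a p' q' ^ reversal ν 0 * akpX c p' q' ^ reversal ν 2)
      (akpX a p' q' ^ reversal ν 0 * akpX b p' q' ^ reversal ν 1) = akpR p q p' q' := by
  have h1 : p' ≠ q := fun h0 => hQ (dispQ_akp_mul_eq_zero ν h h' (Or.inl h0))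
  have h2 : p ≠ q' := fun h0 => hQ (dispQ_akp_mul_eq_zero ν h h' (Or.inr h0))
  have hsol := dakpNum_akp ν (a := a) (b := b) (c := c) (N := 2) (p := ![p, p']) (q := ![q, q'])
    (Fin.forall_fin_two.2 ⟨h, h'⟩) (fun i j hij => by
      obtain ⟨rfl, rfl⟩ : i = 0 ∧ j = 1 := by omega
      exact ⟨h1, h2⟩)
  have := dakpR_eq_of_nSoliton fun d => hsol d 1 1 1
  simp only [Matrix.cons_val] at this
  exact this hQ

theorem akp_miwa (ν : Fin 4) (a b c : ℂ) (N : ℕ) (p q : Fin N → ℂ)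
    (hreg : ∀ i, AKPRegular a (p i) (q i) ∧ AKPRegular b (p i) (q i) ∧ AKPRegular c (p i) (q i))
    (X Y Z x y z : Fin N → ℂ)
    (hX : ∀ i, X i = akpX a (p i) (q i)) (hY : ∀ i, Y i = akpX b (p i) (q i))
    (hZ : ∀ i, Z i = akpX c (p i) (q i))
    (hx : ∀ i, x i = Y i ^ reversal ν 1 * Z i ^ reversal ν 2)
    (hy : ∀ i, y i = X i ^ reversal ν 0 * Z i ^ reversal ν 2)
    (hz : ∀ i, z i = X i ^ reversal ν 0 * Y i ^ reversal ν 1) :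
    (∀ i, dispQ (akpParams ν a b c) (x i) (y i) (z i) = 0) ∧
    (∀ i j, i ≠ j → dispQ (akpParams ν a b c) (x i * x j) (y i * y j) (z i * z j) ≠ 0 →
      dakpR (akpParams ν a b c) (x i) (y i) (z i) (x j) (y j) (z j)
        = akpR (p i) (q i) (p j) (q j)) ∧
    ((∀ i j, i < j → p j ≠ q i ∧ p i ≠ q j) →
      ∀ (d : Fin N → ℂ) (R : Fin N → Fin N → ℂ),
      (∀ i j, R i j = akpR (p i) (q i) (p j) (q j)) →
      IsAKPSolution (akpA a b c) (akpB a b c) (akpC a b c) (nSoliton R d X Y Z) ∧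
      nSoliton R d x y z = changeVars (reversal ν) (nSoliton R d X Y Z) ∧
      IsDAKPSolution (akpParams ν a b c) (nSoliton R d x y z)) := by
  obtain rfl := funext hX
  obtain rfl := funext hY
  obtain rfl := funext hZ
  obtain rfl := funext hx
  obtain rfl := funext hy
  obtain rfl := funext hz
  refine ⟨fun i => dispQ_akp ν (hreg i).1 (hreg i).2.1 (hreg i).2.2,
    fun i j _ hQ => dakpR_akp ν (hreg i) (hreg j) hQ, fun hR d R hRR => ?_⟩
  obtain rfl : R = fun i j => akpR (p i) (q i) (p j) (q j) := funext fun i => funext fun j => hRR i j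
  exact ⟨isAKPSolution_nSoliton hreg hR d,
    changeVars_nSoliton _ _ d (fun i => akpX_ne_zero (hreg i).1)
      (fun i => akpX_ne_zero (hreg i).2.1) (fun i => akpX_ne_zero (hreg i).2.2)
      (fun _ => rfl) (fun _ => rfl) (fun _ => rfl),
    isDAKPSolution_of_dakpNum (dakpNum_akp ν hreg hR d)⟩

end AKP

/-! ### Gauge transformations -/

/-- The gauge factor `g₁^{lm} g₂^{km} g₃^{kl}` changes only the ratios of the four parameters, and
three factors suffice to adjust the three ratios. Everything is written with `exp` to avoid a choice
of square roots: with `α i = β i * exp (v i)`, the factors are determined by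
`g₂ g₃ = exp (v 0 - v 3)`, `g₁ g₃ = exp (v 1 - v 3)` and `g₁ g₂ = exp (v 2 - v 3)`. -/
theorem exists_gauge {α β : Fin 4 → ℂ} (h : ∀ i, β i = 0 ↔ α i = 0) :
    ∃ g₁ g₂ g₃ : ℂ, g₁ ≠ 0 ∧ g₂ ≠ 0 ∧ g₃ ≠ 0 ∧
      ∀ τ : LatticeFun, IsDAKPSolution β τ ↔ IsDAKPSolution α (gaugeMul g₁ g₂ g₃ τ) := by
  have hv : ∀ i, ∃ v : ℂ, α i = β i * Complex.exp v := by
    intro i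
    by_cases hi : β i = 0
    · exact ⟨0, by simp [hi, (h i).1 hi]⟩
    · exact ⟨Complex.log (α i / β i), by
        rw [Complex.exp_log (div_ne_zero (fun h0 => hi ((h i).2 h0)) hi), mul_div_cancel₀ _ hi]⟩
  choose v hv using hv
  set u₁ := (v 1 + v 2 - v 0 - v 3) / 2 with hu₁
  set u₂ := (v 0 + v 2 - v 1 - v 3) / 2 with hu₂
  set u₃ := (v 0 + v 1 - v 2 - v 3) / 2 with hu₃
  refine ⟨_, _, _, Complex.exp_ne_zero u₁, Complex.exp_ne_zero u₂, Complex.exp_ne_zero u₃,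
    fun τ => ?_⟩
  have hG : ∀ k l m : ℤ, gaugeMul (Complex.exp u₁) (Complex.exp u₂) (Complex.exp u₃) τ k l m
      = Complex.exp (l * m * u₁ + k * m * u₂ + k * l * u₃) * τ k l m := by
    intro k l m
    simp only [gaugeMul, ← Complex.exp_int_mul, Complex.exp_add]
    push_cast
    rfl
  have key : ∀ k l m, dakpLHS α (gaugeMul (Complex.exp u₁) (Complex.exp u₂) (Complex.exp u₃) τ) k l m
      = Complex.exp (v 3 - (2 * l * m + l + m) * u₁ - (2 * k * m + k + m) * u₂
          - (2 * k * l + k + l) * u₃) * dakpLHS β τ k l m := by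
    intro k l m
    have ratio : ∀ (i : Fin 4) (e e₁ e₂ e₃ t t₁ t₂ t₃ : ℂ),
        v i + e = v 3 - (2 * l * m + l + m) * u₁ - (2 * k * m + k + m) * u₂
          - (2 * k * l + k + l) * u₃ + (e₁ + e₂ + e₃) →
        α i * (Complex.exp e * t / (Complex.exp e₁ * t₁ * (Complex.exp e₂ * t₂)
          * (Complex.exp e₃ * t₃)))
        = Complex.exp (v 3 - (2 * l * m + l + m) * u₁ - (2 * k * m + k + m) * u₂
          - (2 * k * l + k + l) * u₃) * (β i * (t / (t₁ * t₂ * t₃))) := by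
      intro i e e₁ e₂ e₃ t t₁ t₂ t₃ hexp
      have := congrArg Complex.exp hexp
      rw [Complex.exp_add, Complex.exp_add _ (e₁ + e₂ + e₃), Complex.exp_add, Complex.exp_add e₁]
        at this
      rw [show Complex.exp e₁ * t₁ * (Complex.exp e₂ * t₂) * (Complex.exp e₃ * t₃)
        = (Complex.exp e₁ * Complex.exp e₂ * Complex.exp e₃) * (t₁ * t₂ * t₃) by ring,
        mul_div_mul_comm, hv i]
      have h1 := Complex.exp_ne_zero e₁
      have h2 := Complex.exp_ne_zero e₂
      have h3 := Complex.exp_ne_zero e₃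
      have : Complex.exp (v i) * (Complex.exp e
          / (Complex.exp e₁ * Complex.exp e₂ * Complex.exp e₃)) = Complex.exp (v 3
          - (2 * l * m + l + m) * u₁ - (2 * k * m + k + m) * u₂ - (2 * k * l + k + l) * u₃) := by
        rw [← mul_div_assoc, this, mul_div_cancel_right₀]
        simp
      rw [← this]
      ring
    simp only [dakpLHS, hG, mul_sub, mul_add]
    rw [ratio 0, ratio 0, ratio 1, ratio 1, ratio 2, ratio 2, ratio 3, ratio 3] <;>
      (push_cast; rw [hu₁, hu₂, hu₃]; ring)
  simp only [IsDAKPSolution, key, hG]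
  simp [Complex.exp_ne_zero]

lemma bkpParams_ne_zero {a b c : ℂ} (hA : bkpA a b c ≠ 0) (hB : bkpB a b c ≠ 0)
    (hC : bkpC a b c ≠ 0) (hD : bkpD a b c ≠ 0) (i : Fin 4) : bkpParams a b c i ≠ 0 := by
  fin_cases i <;> simp [bkpParams, *]

lemma akpParams_eq_zero_iff {a b c : ℂ} (hA : akpA a b c ≠ 0) (hB : akpB a b c ≠ 0)
    (hC : akpC a b c ≠ 0) (ν i : Fin 4) : akpParams ν a b c i = 0 ↔ i = ν := by
  fin_cases ν <;> fin_cases i <;> simp [akpParams, *]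

theorem bkp_gauge (α : Fin 4 → ℂ) (a b c : ℂ) (hα : ∀ i, α i ≠ 0) (hA : bkpA a b c ≠ 0)
    (hB : bkpB a b c ≠ 0) (hC : bkpC a b c ≠ 0) (hD : bkpD a b c ≠ 0) :
    ∃ g₁ g₂ g₃ : ℂ, g₁ ≠ 0 ∧ g₂ ≠ 0 ∧ g₃ ≠ 0 ∧
      ∀ τ : LatticeFun,
        IsDAKPSolution (bkpParams a b c) τ ↔ IsDAKPSolution α (gaugeMul g₁ g₂ g₃ τ) :=
  exists_gauge fun i => iff_of_false (bkpParams_ne_zero hA hB hC hD i) (hα i)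

theorem akp_gauge (ν : Fin 4) (α : Fin 4 → ℂ) (a b c : ℂ) (hα : ∀ i, α i = 0 ↔ i = ν)
    (hA : akpA a b c ≠ 0) (hB : akpB a b c ≠ 0) (hC : akpC a b c ≠ 0) :
    ∃ g₁ g₂ g₃ : ℂ, g₁ ≠ 0 ∧ g₂ ≠ 0 ∧ g₃ ≠ 0 ∧
      ∀ τ : LatticeFun,
        IsDAKPSolution (akpParams ν a b c) τ ↔ IsDAKPSolution α (gaugeMul g₁ g₂ g₃ τ) :=
  exists_gauge fun i => (akpParams_eq_zero_iff hA hB hC ν i).trans (hα i).symm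

/-! ### Miwa coordinates of the points of the dispersion surfaces -/

lemma exists_pairwise_mul_eq {x y z : ℂ} (hx : x ≠ 0) (hy : y ≠ 0) (hz : z ≠ 0) :
    ∃ X Y Z : ℂ, X ≠ 0 ∧ Y ≠ 0 ∧ Z ≠ 0 ∧ x = Y * Z ∧ y = X * Z ∧ z = X * Y := by
  obtain ⟨X, hX⟩ := IsAlgClosed.exists_eq_mul_self (y * z / x)
  rw [← pow_two] at hX
  have hX0 : X ≠ 0 := by
    rintro rfl
    exact div_ne_zero (mul_ne_zero hy hz) hx (by simpa using hX)
  refine ⟨X, z / X, y / X, hX0, div_ne_zero hz hX0, div_ne_zero hy hX0, ?_, ?_, ?_⟩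
  · rw [div_mul_div_comm, ← pow_two, ← hX]
    field_simp
  · field_simp
  · field_simp

/-- The vanishing of this determinant is the condition that `X`, `Y`, `Z` are the Miwa factors
`bkpX a p q`, `bkpX b p q`, `bkpX c p q` for some `p`, `q` on the projective line. -/
def bkpMatrix (a b c X Y Z : ℂ) : Matrix (Fin 3) (Fin 3) ℂ :=
  !![1 - X, -a * (1 + X), a ^ 2 * (1 - X);
     1 - Y, -b * (1 + Y), b ^ 2 * (1 - Y);
     1 - Z, -c * (1 + Z), c ^ 2 * (1 - Z)]

lemma dispQ_bkpParams (a b c X Y Z : ℂ) :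
    dispQ (bkpParams a b c) (Y * Z) (X * Z) (X * Y)
      = (X * Y * Z) ^ 2 * ((bkpMatrix a b c X Y Z).det * (bkpMatrix a b c (-X) (-Y) (-Z)).det) := by
  simp only [bkpMatrix, Matrix.det_fin_three, dispQ, bkpParams, bkpA, bkpB, bkpC, bkpD]
  simp
  ring

/-- A kernel vector of `bkpMatrix` lists the coefficients of a quadratic polynomial, and `p`, `q`
are the roots of that polynomial. If its leading coefficient vanishes, then one of the roots is at
infinity, where a Miwa factor is the negative of its value at `0`. -/
lemma exists_bkpX_of_det_eq_zero {a b c X Y Z : ℂ} (ha : a ≠ 0) (hb : b ≠ 0) (hc : c ≠ 0)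
    (hab : a ^ 2 ≠ b ^ 2) (hbc : b ^ 2 ≠ c ^ 2) (hca : c ^ 2 ≠ a ^ 2)
    (hX : X ≠ 0) (hY : Y ≠ 0) (hZ : Z ≠ 0) (h : (bkpMatrix a b c X Y Z).det = 0)
    (h1 : ¬ (Y = 1 ∧ Z = 1)) (h2 : ¬ (X = 1 ∧ Z = 1)) (h3 : ¬ (X = 1 ∧ Y = 1)) :
    ∃ p q δ : ℂ, δ ^ 2 = 1 ∧ BKPRegular a p q ∧ BKPRegular b p q ∧ BKPRegular c p q ∧
      X = δ * bkpX a p q ∧ Y = δ * bkpX b p q ∧ Z = δ * bkpX c p q := by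
  obtain ⟨e, he, hM⟩ := Matrix.exists_mulVec_eq_zero_iff.2 h
  have r0 := congrFun hM 0
  have r1 := congrFun hM 1
  have r2 := congrFun hM 2
  simp only [bkpMatrix, Matrix.mulVec, dotProduct, Fin.sum_univ_three, Matrix.of_apply,
    Matrix.cons_val, Pi.zero_apply] at r0 r1 r2
  have he2 : e 1 = 0 → e 0 = 0 → e 2 ≠ 0 := fun h1 h0 h2 => he (by
    ext i; fin_cases i <;> simp [*])
  -- a common zero of numerator and denominator forces the other two factors to be `1`
  have hD : ∀ u v w U V W : ℂ, u ≠ 0 → u ^ 2 ≠ v ^ 2 → u ^ 2 ≠ w ^ 2 →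
      (1 - U) * e 0 + -u * (1 + U) * e 1 + u ^ 2 * (1 - U) * e 2 = 0 →
      (1 - V) * e 0 + -v * (1 + V) * e 1 + v ^ 2 * (1 - V) * e 2 = 0 →
      (1 - W) * e 0 + -w * (1 + W) * e 1 + w ^ 2 * (1 - W) * e 2 = 0 →
      ¬ (V = 1 ∧ W = 1) → e 0 + u * e 1 + u ^ 2 * e 2 ≠ 0 := by
    intro u v w U V W hu huv huw hU hV hW h1 h0
    have e1 : e 1 = 0 := by
      have : 2 * u * e 1 = 0 := by linear_combination (1 - U) * h0 - hU
      simpa [hu] using this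
    have e0 : e 0 = -u ^ 2 * e 2 := by linear_combination h0 - u * e1
    have e2 : e 2 ≠ 0 := fun h2 => he2 e1 (by rw [e0, h2, mul_zero]) h2
    have key : ∀ v V : ℂ, u ^ 2 ≠ v ^ 2 →
        (1 - V) * e 0 + -v * (1 + V) * e 1 + v ^ 2 * (1 - V) * e 2 = 0 → V = 1 := by
      intro v V huv hV
      have : (1 - V) * (e 2 * (v ^ 2 - u ^ 2)) = 0 := by
        rw [e1, e0] at hV
        linear_combination hV
      have := (mul_eq_zero.1 this).resolve_right (mul_ne_zero e2 (sub_ne_zero.2 huv.symm))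
      linear_combination -this
    exact h1 ⟨key v V huv hV, key w W huw hW⟩
  have dA := hD a b c X Y Z ha hab hca.symm r0 r1 r2 h1
  have dB := hD b a c Y X Z hb hab.symm hbc r1 r0 r2 h2
  have dC := hD c a b Z X Y hc hca hbc.symm r2 r0 r1 h3
  have fin : ∀ p q δ : ℂ, δ ^ 2 = 1 →
      (∀ u : ℂ, u ≠ 0 → ∃ j : ℂ, j ≠ 0 ∧ e 0 + u * e 1 + u ^ 2 * e 2 = j * ((u * p + 1) * (u * q + 1)) ∧
        e 0 - u * e 1 + u ^ 2 * e 2 = δ * j * ((1 - u * p) * (1 - u * q))) →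
      ∀ u U : ℂ, u ≠ 0 → U ≠ 0 →
        (1 - U) * e 0 + -u * (1 + U) * e 1 + u ^ 2 * (1 - U) * e 2 = 0 →
        e 0 + u * e 1 + u ^ 2 * e 2 ≠ 0 → BKPRegular u p q ∧ U = δ * bkpX u p q := by
    intro p q δ hδ hf u U hu hU hrow hd
    obtain ⟨j, hj, f1, f2⟩ := hf u hu
    have hrow' : e 0 - u * e 1 + u ^ 2 * e 2 = U * (e 0 + u * e 1 + u ^ 2 * e 2) := by
      linear_combination hrow
    have hn : e 0 - u * e 1 + u ^ 2 * e 2 ≠ 0 := hrow' ▸ mul_ne_zero hU hd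
    rw [f1] at hd
    rw [f2] at hn
    have d1 := left_ne_zero_of_mul (right_ne_zero_of_mul hd)
    have d2 := right_ne_zero_of_mul (right_ne_zero_of_mul hd)
    refine ⟨⟨left_ne_zero_of_mul (right_ne_zero_of_mul hn),
      right_ne_zero_of_mul (right_ne_zero_of_mul hn), d1, d2⟩, ?_⟩
    rw [f1, f2] at hrow'
    rw [bkpX, ← mul_div_assoc, eq_div_iff (mul_ne_zero d1 d2)]
    refine mul_left_cancel₀ hj ?_
    linear_combination -hrow'
  by_cases h0 : e 0 = 0
  · by_cases h10 : e 1 = 0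
    · have e2 := he2 h10 h0
      have : ∀ u U : ℂ, u ≠ 0 →
          (1 - U) * e 0 + -u * (1 + U) * e 1 + u ^ 2 * (1 - U) * e 2 = 0 → U = 1 := by
        intro u U hu hU
        rw [h0, h10] at hU
        have : (1 - U) * (u ^ 2 * e 2) = 0 := by linear_combination hU
        have := (mul_eq_zero.1 this).resolve_right (mul_ne_zero (pow_ne_zero 2 hu) e2)
        linear_combination -this
      exact absurd ⟨this b Y hb r1, this c Z hc r2⟩ h1
    · have hf := fin (e 2 / e 1) 0 (-1) (by norm_num) fun u hu => ⟨u * e 1, mul_ne_zero hu h10,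
        by rw [h0]; field_simp; ring, by rw [h0]; field_simp; ring⟩
      obtain ⟨a1, a2⟩ := hf a X ha hX r0 dA
      obtain ⟨b1, b2⟩ := hf b Y hb hY r1 dB
      obtain ⟨c1, c2⟩ := hf c Z hc hZ r2 dC
      exact ⟨_, _, _, by norm_num, a1, b1, c1, a2, b2, c2⟩
  · obtain ⟨s, hs⟩ := IsAlgClosed.exists_eq_mul_self (e 1 ^ 2 - 4 * e 0 * e 2)
    have hf := fin ((e 1 + s) / (2 * e 0)) ((e 1 - s) / (2 * e 0)) 1 (by norm_num) fun u hu =>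
      ⟨e 0, h0, by field_simp; linear_combination -u ^ 2 * hs,
        by field_simp; linear_combination -u ^ 2 * hs⟩
    obtain ⟨a1, a2⟩ := hf a X ha hX r0 dA
    obtain ⟨b1, b2⟩ := hf b Y hb hY r1 dB
    obtain ⟨c1, c2⟩ := hf c Z hc hZ r2 dC
    exact ⟨_, _, _, by norm_num, a1, b1, c1, a2, b2, c2⟩

theorem bkp_converse (a b c : ℂ) (ha : a ≠ 0) (hb : b ≠ 0) (hc : c ≠ 0)
    (hA : bkpA a b c ≠ 0) (hB : bkpB a b c ≠ 0) (hC : bkpC a b c ≠ 0)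
    (x y z : ℂ) (hx : x ≠ 0) (hy : y ≠ 0) (hz : z ≠ 0)
    (hQ : dispQ (bkpParams a b c) x y z = 0)
    (h1 : ¬ (x = 1 ∧ y = z)) (h2 : ¬ (y = 1 ∧ x = z)) (h3 : ¬ (z = 1 ∧ x = y)) :
    ∃ p q : ℂ, BKPRegular a p q ∧ BKPRegular b p q ∧ BKPRegular c p q ∧
      x = bkpX b p q * bkpX c p q ∧ y = bkpX a p q * bkpX c p q ∧
      z = bkpX a p q * bkpX b p q := by
  obtain ⟨X, Y, Z, hX, hY, hZ, rfl, rfl, rfl⟩ := exists_pairwise_mul_eq hx hy hz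
  simp only [bkpA, bkpB, bkpC, mul_ne_zero_iff] at hA hB hC
  obtain ⟨⟨n1, n2⟩, n3⟩ := hA
  obtain ⟨⟨n4, n5⟩, n6⟩ := hB
  obtain ⟨⟨n7, n8⟩, n9⟩ := hC
  have key : ∀ X Y Z : ℂ, X ≠ 0 → Y ≠ 0 → Z ≠ 0 → ¬ (Y * Z = 1 ∧ X * Z = X * Y) →
      ¬ (X * Z = 1 ∧ Y * Z = X * Y) → ¬ (X * Y = 1 ∧ Y * Z = X * Z) →
      (bkpMatrix a b c X Y Z).det = 0 →
      ∃ p q : ℂ, BKPRegular a p q ∧ BKPRegular b p q ∧ BKPRegular c p q ∧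
      Y * Z = bkpX b p q * bkpX c p q ∧ X * Z = bkpX a p q * bkpX c p q ∧
      X * Y = bkpX a p q * bkpX b p q := by
    intro X Y Z hX hY hZ h1 h2 h3 h
    obtain ⟨p, q, δ, hδ, g1, g2, g3, eX, eY, eZ⟩ := exists_bkpX_of_det_eq_zero ha hb hc
      (fun h => mul_ne_zero n5 n9 (by linear_combination h))
      (fun h => mul_ne_zero n4 n3 (by linear_combination h))
      (fun h => mul_ne_zero n2 n6 (by linear_combination h)) hX hY hZ h
      (fun ⟨e1, e2⟩ => h1 (by simp [e1, e2])) (fun ⟨e1, e2⟩ => h2 (by simp [e1, e2]))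
      (fun ⟨e1, e2⟩ => h3 (by simp [e1, e2]))
    refine ⟨p, q, g1, g2, g3, ?_, ?_, ?_⟩
    · rw [eY, eZ]; linear_combination bkpX b p q * bkpX c p q * hδ
    · rw [eX, eZ]; linear_combination bkpX a p q * bkpX c p q * hδ
    · rw [eX, eY]; linear_combination bkpX a p q * bkpX b p q * hδ
  rw [dispQ_bkpParams] at hQ
  rcases mul_eq_zero.1 ((mul_eq_zero.1 hQ).resolve_left (by simp [*])) with h | h
  · exact key X Y Z hX hY hZ h1 h2 h3 h
  · simpa only [neg_mul_neg] using key (-X) (-Y) (-Z) (neg_ne_zero.2 hX) (neg_ne_zero.2 hY)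
      (neg_ne_zero.2 hZ) (by simpa only [neg_mul_neg] using h1)
      (by simpa only [neg_mul_neg] using h2) (by simpa only [neg_mul_neg] using h3) h

/-- The vanishing of this determinant is the condition that `X`, `Y`, `Z` are the Miwa factors
`akpX a p q`, `akpX b p q`, `akpX c p q` for some `p`, `q`, or a limit of such values. -/
def akpMatrix (a b c X Y Z : ℂ) : Matrix (Fin 3) (Fin 3) ℂ :=
  !![X - 1, -a * X, a; Y - 1, -b * Y, b; Z - 1, -c * Z, c]

lemma exists_akpX_of_det_eq_zero {a b c X Y Z : ℂ} (ha : a ≠ 0) (hb : b ≠ 0) (hc : c ≠ 0)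
    (hab : a ≠ b) (hbc : b ≠ c) (hca : c ≠ a) (hX : X ≠ 0) (hY : Y ≠ 0) (hZ : Z ≠ 0)
    (h : (akpMatrix a b c X Y Z).det = 0)
    (h1 : ¬ (Y = 1 ∧ Z = 1)) (h2 : ¬ (X = 1 ∧ Z = 1)) (h3 : ¬ (X = 1 ∧ Y = 1)) :
    (∃ p q : ℂ, AKPRegular a p q ∧ AKPRegular b p q ∧ AKPRegular c p q ∧
      X = akpX a p q ∧ Y = akpX b p q ∧ Z = akpX c p q) ∨
    (∃ t : ℂ, t ≠ 0 ∧ X = t ∧ Y = t ∧ Z = t) := by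
  obtain ⟨e, he, hM⟩ := Matrix.exists_mulVec_eq_zero_iff.2 h
  have r0 := congrFun hM 0
  have r1 := congrFun hM 1
  have r2 := congrFun hM 2
  simp only [akpMatrix, Matrix.mulVec, dotProduct, Fin.sum_univ_three, Matrix.of_apply,
    Matrix.cons_val, Pi.zero_apply] at r0 r1 r2
  by_cases h0 : e 0 = 0
  · right
    have row : ∀ u U : ℂ, u ≠ 0 → (U - 1) * e 0 + -u * U * e 1 + u * e 2 = 0 → U * e 1 = e 2 := by
      intro u U hu hU
      have : u * (U * e 1 - e 2) = 0 := by linear_combination (U - 1) * h0 - hU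
      exact sub_eq_zero.1 ((mul_eq_zero.1 this).resolve_left hu)
    have rX := row a X ha r0
    have e1 : e 1 ≠ 0 := fun h1 => he (by
      ext i; fin_cases i
      · exact h0
      · exact h1
      · simpa [h1] using rX.symm)
    exact ⟨X, hX, rfl, mul_right_cancel₀ e1 ((row b Y hb r1).trans rX.symm),
      mul_right_cancel₀ e1 ((row c Z hc r2).trans rX.symm)⟩
  · left
    have row : ∀ u U : ℂ, (U - 1) * e 0 + -u * U * e 1 + u * e 2 = 0 →
        U * (1 - u * (e 1 / e 0)) = 1 - u * (e 2 / e 0) := by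
      intro u U hU
      field_simp
      linear_combination hU
    have rX := row a X r0
    have rY := row b Y r1
    have rZ := row c Z r2
    set p := e 1 / e 0
    set q := e 2 / e 0
    -- a common zero of numerator and denominator forces the other two factors to be `1`
    have hD : ∀ u v w U V W : ℂ, u ≠ 0 → u ≠ v → u ≠ w → U * (1 - u * p) = 1 - u * q →
        V * (1 - v * p) = 1 - v * q → W * (1 - w * p) = 1 - w * q → ¬ (V = 1 ∧ W = 1) →
        1 - u * p ≠ 0 := by
      intro u v w U V W hu huv huw hU hV hW h1 hp
      have hq : 1 - u * q = 0 := by rw [← hU, hp, mul_zero]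
      have key : ∀ v V : ℂ, u ≠ v → V * (1 - v * p) = 1 - v * q → V = 1 := by
        intro v V huv hV
        have : (V - 1) * (u - v) = 0 := by
          linear_combination u * hV + (v - V * v) * hp - v * hp + v * hq
        exact sub_eq_zero.1 ((mul_eq_zero.1 this).resolve_right (sub_ne_zero.2 huv))
      exact h1 ⟨key v V huv hV, key w W huw hW⟩
    have dA := hD a b c X Y Z ha hab hca.symm rX rY rZ h1
    have dB := hD b a c Y X Z hb hab.symm hbc rY rX rZ h2
    have dC := hD c a b Z X Y hc hca hbc.symm rZ rX rY h3
    exact ⟨p, q, ⟨dA, rX ▸ mul_ne_zero hX dA⟩, ⟨dB, rY ▸ mul_ne_zero hY dB⟩,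
      ⟨dC, rZ ▸ mul_ne_zero hZ dC⟩, by rw [akpX, eq_div_iff dA, rX], by rw [akpX, eq_div_iff dB, rY],
      by rw [akpX, eq_div_iff dC, rZ]⟩

lemma exists_dispQ_akpParams (ν : Fin 4) (a b c : ℂ) {X Y Z : ℂ} (hX : X ≠ 0) (hY : Y ≠ 0)
    (hZ : Z ≠ 0) : ∃ f : ℂ, f ≠ 0 ∧
      dispQ (akpParams ν a b c) (Y ^ reversal ν 1 * Z ^ reversal ν 2)
        (X ^ reversal ν 0 * Z ^ reversal ν 2) (X ^ reversal ν 0 * Y ^ reversal ν 1)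
      = f * ((akpMatrix a b c X Y Z).det * (akpMatrix a b c (-X) (-Y) (-Z)).det) := by
  match ν with
  | 0 =>
    refine ⟨-((X * Y * Z) ^ 2 / X ^ 6), by simp [*], ?_⟩
    simp only [show reversal 0 0 = -1 from rfl, show reversal 0 1 = 1 from rfl,
      show reversal 0 2 = 1 from rfl, zpow_one, zpow_neg, akpMatrix, Matrix.det_fin_three, dispQ,
      akpParams, akpA, akpB, akpC]
    simp
    field_simp
    ring
  | 1 =>
    refine ⟨-((X * Y * Z) ^ 2 / Y ^ 6), by simp [*], ?_⟩
    simp only [show reversal 1 0 = 1 from rfl, show reversal 1 1 = -1 from rfl,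
      show reversal 1 2 = 1 from rfl, zpow_one, zpow_neg, akpMatrix, Matrix.det_fin_three, dispQ,
      akpParams, akpA, akpB, akpC]
    simp
    field_simp
    ring
  | 2 =>
    refine ⟨-((X * Y * Z) ^ 2 / Z ^ 6), by simp [*], ?_⟩
    simp only [show reversal 2 0 = 1 from rfl, show reversal 2 1 = 1 from rfl,
      show reversal 2 2 = -1 from rfl, zpow_one, zpow_neg, akpMatrix, Matrix.det_fin_three, dispQ,
      akpParams, akpA, akpB, akpC]
    simp
    field_simp
    ring
  | 3 =>
    refine ⟨(X * Y * Z) ^ 2, by simp [*], ?_⟩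
    simp only [show reversal 3 0 = 1 from rfl, show reversal 3 1 = 1 from rfl,
      show reversal 3 2 = 1 from rfl, zpow_one, akpMatrix, Matrix.det_fin_three, dispQ,
      akpParams, akpA, akpB, akpC]
    simp
    ring

lemma reversal_eq (ν : Fin 4) (i : Fin 3) : reversal ν i = 1 ∨ reversal ν i = -1 := by
  unfold reversal
  split_ifs <;> simp

theorem akp_converse (ν : Fin 4) (a b c : ℂ) (hA : akpA a b c ≠ 0) (hB : akpB a b c ≠ 0)
    (hC : akpC a b c ≠ 0) (x y z : ℂ) (hx : x ≠ 0) (hy : y ≠ 0) (hz : z ≠ 0)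
    (hQ : dispQ (akpParams ν a b c) x y z = 0)
    (h1 : ¬ (x = 1 ∧ y = z)) (h2 : ¬ (y = 1 ∧ x = z)) (h3 : ¬ (z = 1 ∧ x = y)) :
    (∃ p q : ℂ, AKPRegular a p q ∧ AKPRegular b p q ∧ AKPRegular c p q ∧
      x = akpX b p q ^ reversal ν 1 * akpX c p q ^ reversal ν 2 ∧
      y = akpX a p q ^ reversal ν 0 * akpX c p q ^ reversal ν 2 ∧
      z = akpX a p q ^ reversal ν 0 * akpX b p q ^ reversal ν 1) ∨
    (∃ t : ℂ, t ≠ 0 ∧ x = t ^ reversal ν 1 * t ^ reversal ν 2 ∧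
      y = t ^ reversal ν 0 * t ^ reversal ν 2 ∧
      z = t ^ reversal ν 0 * t ^ reversal ν 1) := by
  obtain ⟨X, Y, Z, hX, hY, hZ, rfl, rfl, rfl⟩ := exists_pairwise_mul_eq hx hy hz
  simp only [akpA, akpB, akpC, mul_ne_zero_iff, sub_ne_zero] at hA hB hC
  have inv : ∀ i (V : ℂ), (V ^ reversal ν i) ^ reversal ν i = V := fun i V => by
    rcases reversal_eq ν i with h | h <;> simp [h]
  have invneg : ∀ i (V : ℂ), (-V) ^ reversal ν i = -V ^ reversal ν i := fun i V => by
    rcases reversal_eq ν i with h | h <;> simp [h, inv_neg]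
  have one : ∀ i (V : ℂ), V ^ reversal ν i = 1 → V = 1 := fun i V h => by
    rw [← inv i V, h, one_zpow]
  have key : ∀ X Y Z : ℂ, X ≠ 0 → Y ≠ 0 → Z ≠ 0 → ¬ (Y * Z = 1 ∧ X * Z = X * Y) →
      ¬ (X * Z = 1 ∧ Y * Z = X * Y) → ¬ (X * Y = 1 ∧ Y * Z = X * Z) →
      (akpMatrix a b c (X ^ reversal ν 0) (Y ^ reversal ν 1) (Z ^ reversal ν 2)).det = 0 →
      (∃ p q : ℂ, AKPRegular a p q ∧ AKPRegular b p q ∧ AKPRegular c p q ∧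
        Y * Z = akpX b p q ^ reversal ν 1 * akpX c p q ^ reversal ν 2 ∧
        X * Z = akpX a p q ^ reversal ν 0 * akpX c p q ^ reversal ν 2 ∧
        X * Y = akpX a p q ^ reversal ν 0 * akpX b p q ^ reversal ν 1) ∨
      (∃ t : ℂ, t ≠ 0 ∧ Y * Z = t ^ reversal ν 1 * t ^ reversal ν 2 ∧
        X * Z = t ^ reversal ν 0 * t ^ reversal ν 2 ∧
        X * Y = t ^ reversal ν 0 * t ^ reversal ν 1) := by
    intro X Y Z hX hY hZ h1 h2 h3 h
    rcases exists_akpX_of_det_eq_zero hA.1 hB.1 hC.1 hC.2 hA.2 hB.2 (zpow_ne_zero _ hX)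
      (zpow_ne_zero _ hY) (zpow_ne_zero _ hZ) h
      (fun ⟨e1, e2⟩ => h1 (by simp [one _ _ e1, one _ _ e2]))
      (fun ⟨e1, e2⟩ => h2 (by simp [one _ _ e1, one _ _ e2]))
      (fun ⟨e1, e2⟩ => h3 (by simp [one _ _ e1, one _ _ e2])) with
      ⟨p, q, g1, g2, g3, eX, eY, eZ⟩ | ⟨t, ht, eX, eY, eZ⟩
    · exact Or.inl ⟨p, q, g1, g2, g3, by simp only [← eY, ← eZ, inv], by simp only [← eX, ← eZ, inv],
        by simp only [← eX, ← eY, inv]⟩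
    · refine Or.inr ⟨t, ht, ?_, ?_, ?_⟩
      · conv_rhs => rw [← eY, inv, eY, ← eZ, inv]
      · conv_rhs => rw [← eX, inv, eX, ← eZ, inv]
      · conv_rhs => rw [← eX, inv, eX, ← eY, inv]
  obtain ⟨f, hf, hQf⟩ := exists_dispQ_akpParams ν a b c (zpow_ne_zero (reversal ν 0) hX)
    (zpow_ne_zero (reversal ν 1) hY) (zpow_ne_zero (reversal ν 2) hZ)
  simp only [inv] at hQf
  rw [hQf] at hQ
  rcases mul_eq_zero.1 ((mul_eq_zero.1 hQ).resolve_left hf) with h | h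
  · exact key X Y Z hX hY hZ h1 h2 h3 h
  · simp only [← invneg] at h
    simpa only [neg_mul_neg] using key (-X) (-Y) (-Z) (neg_ne_zero.2 hX) (neg_ne_zero.2 hY)
      (neg_ne_zero.2 hZ) (by simpa only [neg_mul_neg] using h1)
      (by simpa only [neg_mul_neg] using h2) (by simpa only [neg_mul_neg] using h3) h

/-! ### Elliptic solitons -/

section Elliptic

/-- The affine elliptic curve on which the points of the solitons of the dual AKP equation with
parameters `A²`, `B²`, `C²`, `-(A B C)²` lie. -/
def OnCurve (A B C : ℂ) (P : ℂ × ℂ) : Prop :=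
  (A * P.1 + B * P.2) * (B * P.1 + A * P.2)
    = C ^ 2 * (1 + A * B * (P.1 * P.2)) * (A * B + P.1 * P.2)

/-- The elliptic Pfaffian kernel, in the affine coordinates of the curve. -/
noncomputable def ellKernel (C : ℂ) (P Q : ℂ × ℂ) : ℂ :=
  (P.1 * Q.2 - Q.1 * P.2) / (C * (1 - P.1 * P.2 * (Q.1 * Q.2)))

/-- Up to sign, the value of the kernel at a point of the curve and the lattice point `(B, -A)`.
The values at the other two lattice points `(0, C)` and `(-C, 0)` are the coordinates. -/
noncomputable def ellZ (A B C : ℂ) (P : ℂ × ℂ) : ℂ :=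
  (A * P.1 + B * P.2) / (C * (1 + A * B * (P.1 * P.2)))

/-- The coordinates of the point and `ellZ` are finite and different from zero. -/
structure EllRegular (A B : ℂ) (P : ℂ × ℂ) : Prop where
  fst : P.1 ≠ 0
  snd : P.2 ≠ 0
  numer : A * P.1 + B * P.2 ≠ 0
  denom : 1 + A * B * (P.1 * P.2) ≠ 0

variable {A B C : ℂ}

/-- Two points of the curve, compared through the products of their coordinates. -/
lemma OnCurve.cross_mul (hA : A ≠ 0) (hB : B ≠ 0) {P Q : ℂ × ℂ} (hP : OnCurve A B C P)
    (hQ : OnCurve A B C Q) :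
    (P.1 * Q.2 - Q.1 * P.2) * (P.1 * Q.1 - P.2 * Q.2)
      = C ^ 2 * (Q.1 * Q.2 - P.1 * P.2) * (1 - P.1 * P.2 * (Q.1 * Q.2)) := by
  refine mul_left_cancel₀ (mul_ne_zero hA hB) ?_
  unfold OnCurve at hP hQ
  linear_combination (Q.1 * Q.2) * hP - (P.1 * P.2) * hQ

lemma isPfaffianKernel_ellKernel {V : Type*} (hA : A ≠ 0) (hB : B ≠ 0) (hC : C ≠ 0) {P : V → ℂ × ℂ}
    (hP : ∀ v, OnCurve A B C (P v))
    (h : ∀ i j, i ≠ j → 1 - (P i).1 * (P i).2 * ((P j).1 * (P j).2) ≠ 0) :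
    IsPfaffianKernel fun i j => ellKernel C (P i) (P j) := by
  refine .of_ne (fun i j => ?_) fun i j k l hij hik hil hjk hjl hkl => ?_
  · simp only [ellKernel]
    rw [← neg_div]
    congr 1 <;> ring
  · have d12 := h i j hij
    have d13 := h i k hik
    have d14 := h i l hil
    have d23 := h j k hjk
    have d24 := h j l hjl
    have d34 := h k l hkl
    have r12 := (hP i).cross_mul hA hB (hP j)
    have r14 := (hP i).cross_mul hA hB (hP l)
    have r23 := (hP j).cross_mul hA hB (hP k)
    have r34 := (hP k).cross_mul hA hB (hP l)
    simp only [ellKernel]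
    generalize P i = P₁ at *
    generalize P j = P₂ at *
    generalize P k = P₃ at *
    generalize P l = P₄ at *
    obtain ⟨x₁, y₁⟩ := P₁
    obtain ⟨x₂, y₂⟩ := P₂
    obtain ⟨x₃, y₃⟩ := P₃
    obtain ⟨x₄, y₄⟩ := P₄
    simp only at *
    have h1 : C ^ 4 * ((1 - x₁ * y₁ * (x₃ * y₃)) * (1 - x₁ * y₁ * (x₄ * y₄))
          * (1 - x₂ * y₂ * (x₃ * y₃)) * (1 - x₂ * y₂ * (x₄ * y₄))
        - (1 - x₁ * y₁ * (x₂ * y₂)) * (1 - x₁ * y₁ * (x₄ * y₄))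
          * (1 - x₂ * y₂ * (x₃ * y₃)) * (1 - x₃ * y₃ * (x₄ * y₄)))
        = (x₁ * y₄ - x₄ * y₁) * (x₁ * x₄ - y₁ * y₄)
          * ((x₂ * y₃ - x₃ * y₂) * (x₂ * x₃ - y₂ * y₃)) := by
      rw [r14, r23]
      ring
    have h3 : C ^ 4 * ((1 - x₁ * y₁ * (x₂ * y₂)) * (1 - x₁ * y₁ * (x₃ * y₃))
          * (1 - x₂ * y₂ * (x₄ * y₄)) * (1 - x₃ * y₃ * (x₄ * y₄))
        - (1 - x₁ * y₁ * (x₂ * y₂)) * (1 - x₁ * y₁ * (x₄ * y₄))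
          * (1 - x₂ * y₂ * (x₃ * y₃)) * (1 - x₃ * y₃ * (x₄ * y₄)))
        = -((x₁ * y₂ - x₂ * y₁) * (x₁ * x₂ - y₁ * y₂)
          * ((x₃ * y₄ - x₄ * y₃) * (x₃ * x₄ - y₃ * y₄))) := by
      rw [r12, r34]
      ring
    have key : C ^ 4 * ((x₁ * y₂ - x₂ * y₁) * (x₃ * y₄ - x₄ * y₃)
          * ((1 - x₁ * y₁ * (x₃ * y₃)) * (1 - x₁ * y₁ * (x₄ * y₄))
            * (1 - x₂ * y₂ * (x₃ * y₃)) * (1 - x₂ * y₂ * (x₄ * y₄)))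
        - (x₁ * y₃ - x₃ * y₁) * (x₂ * y₄ - x₄ * y₂)
          * ((1 - x₁ * y₁ * (x₂ * y₂)) * (1 - x₁ * y₁ * (x₄ * y₄))
            * (1 - x₂ * y₂ * (x₃ * y₃)) * (1 - x₃ * y₃ * (x₄ * y₄)))
        + (x₁ * y₄ - x₄ * y₁) * (x₂ * y₃ - x₃ * y₂)
          * ((1 - x₁ * y₁ * (x₂ * y₂)) * (1 - x₁ * y₁ * (x₃ * y₃))
            * (1 - x₂ * y₂ * (x₄ * y₄)) * (1 - x₃ * y₃ * (x₄ * y₄))))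
        = (x₁ * y₂ - x₂ * y₁) * (x₁ * y₃ - x₃ * y₁) * (x₁ * y₄ - x₄ * y₁)
          * (x₂ * y₃ - x₃ * y₂) * (x₂ * y₄ - x₄ * y₂) * (x₃ * y₄ - x₄ * y₃) := by
      linear_combination (x₁ * y₂ - x₂ * y₁) * (x₃ * y₄ - x₄ * y₃) * h1
        + (x₁ * y₄ - x₄ * y₁) * (x₂ * y₃ - x₃ * y₂) * h3
    generalize hD1 : 1 - x₁ * y₁ * (x₂ * y₂) = D1 at *
    generalize hD2 : 1 - x₁ * y₁ * (x₃ * y₃) = D2 at *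
    generalize hD3 : 1 - x₁ * y₁ * (x₄ * y₄) = D3 at *
    generalize hD4 : 1 - x₂ * y₂ * (x₃ * y₃) = D4 at *
    generalize hD5 : 1 - x₂ * y₂ * (x₄ * y₄) = D5 at *
    generalize hD6 : 1 - x₃ * y₃ * (x₄ * y₄) = D6 at *
    generalize x₁ * y₂ - x₂ * y₁ = n1 at *
    generalize x₁ * y₃ - x₃ * y₁ = n2 at *
    generalize x₁ * y₄ - x₄ * y₁ = n3 at *
    generalize x₂ * y₃ - x₃ * y₂ = n4 at *
    generalize x₂ * y₄ - x₄ * y₂ = n5 at *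
    generalize x₃ * y₄ - x₄ * y₃ = n6 at *
    field_simp
    linear_combination key

/-- The involution `(X, Y) ↦ (1 / X, 1 / Y)` of the curve inverts the kernel. -/
lemma ellKernel_inv (hA : A ≠ 0) (hB : B ≠ 0) (hC : C ≠ 0) {P Q : ℂ × ℂ} (hP : OnCurve A B C P)
    (hQ : OnCurve A B C Q) (h1 : P.1 ≠ 0) (h2 : P.2 ≠ 0) (hw : P.1 * P.2 ≠ Q.1 * Q.2)
    (hn : P.1 * Q.2 - Q.1 * P.2 ≠ 0) :
    ellKernel C Q (P.1⁻¹, P.2⁻¹) = (ellKernel C Q P)⁻¹ := by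
  have r := hP.cross_mul hA hB hQ
  have hw := sub_ne_zero.2 hw
  have hn' : Q.1 * P.2 - P.1 * Q.2 ≠ 0 := by rwa [← neg_sub, neg_ne_zero]
  have e : ellKernel C Q (P.1⁻¹, P.2⁻¹)
      = (P.1 * Q.1 - P.2 * Q.2) / (C * (P.1 * P.2 - Q.1 * Q.2)) := by
    have e1 : 1 - Q.1 * Q.2 * (P.1⁻¹ * P.2⁻¹) = (P.1 * P.2 - Q.1 * Q.2) / (P.1 * P.2) := by
      field_simp
    have e2 : Q.1 * P.2⁻¹ - P.1⁻¹ * Q.2 = (P.1 * Q.1 - P.2 * Q.2) / (P.1 * P.2) := by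
      field_simp
    simp only [ellKernel]
    rw [e1, e2]
    field_simp
  rw [e, ellKernel, inv_div, div_eq_div_iff (mul_ne_zero hC hw) hn']
  linear_combination -r

/-- The points of the curve attached to an `N`-soliton solution. -/
def ellPoint {N : ℕ} (A B C : ℂ) (p q : Fin N → ℂ × ℂ) (o : ℂ × ℂ) : Letter N → ℂ × ℂ
  | .a => (0, C) | .b => (-C, 0) | .c => (B, -A) | .o => o | .p i => p i | .q i => q i

lemma OnCurve.inv {P : ℂ × ℂ} (hP : OnCurve A B C P) (h1 : P.1 ≠ 0) (h2 : P.2 ≠ 0) :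
    OnCurve A B C (P.1⁻¹, P.2⁻¹) := by
  unfold OnCurve at hP ⊢
  field_simp
  linear_combination hP

lemma ellPoint_onCurve {N : ℕ} {p q : Fin N → ℂ × ℂ} {o : ℂ × ℂ} (hp : ∀ i, OnCurve A B C (p i))
    (hq : ∀ i, OnCurve A B C (q i)) (ho : OnCurve A B C o) (v : Letter N) :
    OnCurve A B C (ellPoint A B C p q o v) := by
  cases v
  case a => simp only [ellPoint, OnCurve]; ring
  case b => simp only [ellPoint, OnCurve]; ring
  case c => simp only [ellPoint, OnCurve]; ring
  case o => exact ho
  case p i => exact hp i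
  case q i => exact hq i

/-- `v` is in general position with respect to the point `P`. -/
structure EllGeneric (P v : ℂ × ℂ) : Prop where
  mul_ne_one : 1 - P.1 * P.2 * (v.1 * v.2) ≠ 0
  cross_ne : P.1 * v.2 - v.1 * P.2 ≠ 0

lemma EllGeneric.symm {P v : ℂ × ℂ} (h : EllGeneric P v) : EllGeneric v P :=
  ⟨by rw [mul_comm (v.1 * v.2)]; exact h.1, by rw [← neg_sub, neg_ne_zero]; exact h.2⟩

lemma EllGeneric.ellKernel_ne_zero {P v : ℂ × ℂ} (h : EllGeneric P v) (hC : C ≠ 0) :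
    ellKernel C P v ≠ 0 :=
  div_ne_zero h.cross_ne (mul_ne_zero hC h.mul_ne_one)

variable {N : ℕ} {p q : Fin N → ℂ × ℂ} {o : ℂ × ℂ}

lemma isPfaffianKernel_ellPoint (hA : A ≠ 0) (hB : B ≠ 0) (hC : C ≠ 0)
    (hp : ∀ i, OnCurve A B C (p i)) (hq : ∀ i, OnCurve A B C (q i)) (ho : OnCurve A B C o)
    (rp : ∀ i, EllRegular A B (p i)) (rq : ∀ i, EllRegular A B (q i))
    (gpp : ∀ i j, i ≠ j → EllGeneric (p i) (p j)) (gqq : ∀ i j, i ≠ j → EllGeneric (q i) (q j))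
    (gpq : ∀ i j, EllGeneric (p i) (q j))
    (hoc : 1 - o.1 * o.2 * (B * -A) ≠ 0) (hop : ∀ i, 1 - o.1 * o.2 * ((p i).1 * (p i).2) ≠ 0)
    (hoq : ∀ i, 1 - o.1 * o.2 * ((q i).1 * (q i).2) ≠ 0) :
    IsPfaffianKernel fun i j => ellKernel C (ellPoint A B C p q o i) (ellPoint A B C p q o j) := by
  refine isPfaffianKernel_ellKernel hA hB hC (ellPoint_onCurve hp hq ho) fun i j hij => ?_
  have hpp := fun i j hij => (gpp i j hij).mul_ne_one
  have hqq := fun i j hij => (gqq i j hij).mul_ne_one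
  have hpq := fun i j => (gpq i j).mul_ne_one
  have hp := fun i => (rp i).denom
  have hq := fun i => (rq i).denom
  cases i <;> cases j <;> simp only [ellPoint, ne_eq] at hij ⊢ <;> grind

/-- The soliton sums form solutions of the polarised BKP equation, one for each generic point `o` of
the curve. -/
lemma isMixedBKP_ellPoint (hC : C ≠ 0)
    (hξ : IsPfaffianKernel fun i j =>
      ellKernel C (ellPoint A B C p q o i) (ellPoint A B C p q o j))
    (rp : ∀ i, EllRegular A B (p i)) (rq : ∀ i, EllRegular A B (q i))
    (gpq : ∀ i, EllGeneric (p i) (q i))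
    (ha : ellKernel C (0, C) o ≠ 0) (hb : ellKernel C (-C, 0) o ≠ 0)
    (hc : ellKernel C (B, -A) o ≠ 0) (x : Fin N → ℂ) :
    IsMixedBKP A B C (A * B * C)
      (nSoliton (interaction (ellKernel C) p q) x (fun i => (p i).1 * (q i).1)
        (fun i => (p i).2 * (q i).2) (fun i => ellZ A B C (p i) * ellZ A B C (q i)))
      (fun k l m => ellKernel C (0, C) o ^ k * ellKernel C (-C, 0) o ^ l
        * ellKernel C (B, -A) o ^ m
        * nSoliton (interaction (ellKernel C) p q) (x * dressing (ellKernel C) p q o)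
          (fun i => (p i).1 * (q i).1) (fun i => (p i).2 * (q i).2)
          (fun i => ellZ A B C (p i) * ellZ A B C (q i)) k l m) := by
  have ka : ∀ P : ℂ × ℂ, ellKernel C (0, C) P = -P.1 := fun P => by
    simp only [ellKernel]; field_simp; ring
  have kb : ∀ P : ℂ × ℂ, ellKernel C (-C, 0) P = -P.2 := fun P => by
    simp only [ellKernel]; field_simp; ring
  have kc : ∀ P : ℂ × ℂ, ellKernel C (B, -A) P = ellZ A B C P := fun P => by
    simp only [ellKernel, ellZ]; congr 1 <;> ring
  have da : dressing (ellKernel C) p q (0, C) = fun i => (p i).1 * (q i).1 := by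
    ext i; simp only [dressing, ka]; ring
  have db : dressing (ellKernel C) p q (-C, 0) = fun i => (p i).2 * (q i).2 := by
    ext i; simp only [dressing, kb]; ring
  have dc : dressing (ellKernel C) p q (B, -A) = fun i => ellZ A B C (p i) * ellZ A B C (q i) := by
    ext i; simp only [dressing, kc]
  have hZ : ∀ P, EllRegular A B P → ellZ A B C P ≠ 0 := fun P h =>
    div_ne_zero h.numer (mul_ne_zero hC h.denom)
  have main := isMixedBKP_nSoliton hξ (.a : Letter N) .b .c .o .p .q
    (fun i => (gpq i).ellKernel_ne_zero hC)
    (fun i => by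
      have := congrFun da i
      exact this ▸ mul_ne_zero (rp i).fst (rq i).fst)
    (fun i => by
      have := congrFun db i
      exact this ▸ mul_ne_zero (rp i).snd (rq i).snd)
    (fun i => by
      have := congrFun dc i
      exact this ▸ mul_ne_zero (hZ _ (rp i)) (hZ _ (rq i)))
    ha hb hc x
  have c1 : ellKernel C (-C, 0) (B, -A) = A := by rw [kb]; simp
  have c2 : ellKernel C (0, C) (B, -A) = -B := by rw [ka]
  have c3 : ellKernel C (0, C) (-C, 0) = C := by rw [ka]; simp
  change IsMixedBKP (ellKernel C (-C, 0) (B, -A)) (-ellKernel C (0, C) (B, -A))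
    (ellKernel C (0, C) (-C, 0)) (-(ellKernel C (0, C) (-C, 0) * ellKernel C (0, C) (B, -A)
      * ellKernel C (-C, 0) (B, -A))) (nSoliton (interaction (ellKernel C) p q) x
        (dressing (ellKernel C) p q (0, C)) (dressing (ellKernel C) p q (-C, 0))
        (dressing (ellKernel C) p q (B, -A)))
      (fun k l m => ellKernel C (0, C) o ^ k * ellKernel C (-C, 0) o ^ l
        * ellKernel C (B, -A) o ^ m
        * nSoliton (interaction (ellKernel C) p q) (x * dressing (ellKernel C) p q o)
          (dressing (ellKernel C) p q (0, C)) (dressing (ellKernel C) p q (-C, 0))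
        (dressing (ellKernel C) p q (B, -A)) k l m) at main
  rw [da, db, dc, c1, c2, c3] at main
  convert main using 1 <;> ring

lemma eventually_biquadratic_ne_zero {a b c : ℂ} (h : a ≠ 0 ∨ c ≠ 0) (z : ℂ) :
    ∀ᶠ s in 𝓝[≠] z, a * s ^ 4 + b * s ^ 2 + c ≠ 0 := by
  have hw : ∃ w : ℂ, a * w ^ 4 + b * w ^ 2 + c ≠ 0 := by
    by_contra! h0
    have h1 := h0 0
    have h2 := h0 1
    have h3 := h0 2
    rcases h with h | h
    · exact h (by linear_combination (h3 - 4 * h2 + 3 * h1) / 12)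
    · exact h (by linear_combination h1)
  obtain ⟨w, hw⟩ := hw
  exact eventually_ne_of_differentiable (f := fun s => a * s ^ 4 + b * s ^ 2 + c) (by fun_prop) hw z

/-- Every point of the curve with `X ≠ 0` can be moved slightly so that the product of its
coordinates avoids a finite set, and so that it is not proportional to any of finitely many given
points. The assumption `C ^ 4 ≠ 1` excludes that the curve contains a line `X = const`. -/
lemma exists_onCurve_near (hA : A ≠ 0) (hB : B ≠ 0) (hC : C ≠ 0) (hC4 : C ^ 4 ≠ 1) {P : ℂ × ℂ}
    (hP : OnCurve A B C P) {K : Set ℂ} (hK : K.Finite) {S : Set (ℂ × ℂ)}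
    (hS : S.Finite) (hS0 : ∀ v ∈ S, v.1 ≠ 0) {U : Set (ℂ × ℂ)} (hU : U ∈ 𝓝 P) :
    ∃ P' ∈ U, OnCurve A B C P' ∧ P'.1 * P'.2 ∉ K ∧ ∀ v ∈ S, P'.1 * v.2 - v.1 * P'.2 ≠ 0 := by
  have hAB := mul_ne_zero hA hB
  obtain ⟨X₀, Y₀⟩ := P
  obtain ⟨U₁, hU₁, U₂, hU₂, hUU⟩ := mem_nhds_prod_iff.1 hU
  let f : ℂ → ℂ → ℂ := fun X Y => (A * X + B * Y) * (B * X + A * Y)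
    - C ^ 2 * (1 + A * B * (X * Y)) * (A * B + X * Y)
  have hw : ∃ w, f X₀ w ≠ 0 := by
    by_contra! h0
    have h1 := h0 0
    have h2 := h0 1
    have h3 := h0 (-1)
    simp only [f] at h1 h2 h3
    have e1 : X₀ ^ 2 - C ^ 2 = 0 := mul_left_cancel₀ hAB (by linear_combination h1)
    have e2 : 1 - C ^ 2 * X₀ ^ 2 = 0 := mul_left_cancel₀ hAB (by
      linear_combination (h2 + h3) / 2 - h1)
    exact hC4 (by linear_combination -e2 - C ^ 2 * e1)
  obtain ⟨w, hw⟩ := hw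
  have hnear := eventually_exists_zero_near (f := f) (p₀ := X₀) (t₀ := Y₀)
    (by unfold f Function.uncurry; fun_prop) (fun X => by unfold f; fun_prop)
    (sub_eq_zero.2 hP) hw hU₂
  have hk : ∀ᶠ X in 𝓝[≠] X₀, ∀ κ ∈ K, A * B * X ^ 4 + (κ * (A ^ 2 + B ^ 2)
      - C ^ 2 * (1 + A * B * κ) * (A * B + κ)) * X ^ 2 + A * B * κ ^ 2 ≠ 0 :=
    (eventually_all_finite hK).2 fun κ _ => eventually_biquadratic_ne_zero (Or.inl hAB) X₀
  have hv : ∀ᶠ X in 𝓝[≠] X₀, ∀ v ∈ S, (-(C ^ 2 * (A * B) * v.2 ^ 2)) * X ^ 4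
      + ((A * v.1 + B * v.2) * (B * v.1 + A * v.2)
        - C ^ 2 * (1 + A ^ 2 * B ^ 2) * (v.1 * v.2)) * X ^ 2 + -(C ^ 2 * (A * B) * v.1 ^ 2) ≠ 0 :=
    (eventually_all_finite hS).2 fun v hv => eventually_biquadratic_ne_zero (Or.inr
      (neg_ne_zero.2 (mul_ne_zero (mul_ne_zero (pow_ne_zero 2 hC) hAB)
        (pow_ne_zero 2 (hS0 v hv))))) X₀
  obtain ⟨X, ⟨hX1, hX2⟩, ⟨Y, hY, hf⟩, hX⟩ := ((hk.and hv).and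
    ((hnear.and hU₁).filter_mono nhdsWithin_le_nhds)).exists
  simp only [f] at hf
  refine ⟨(X, Y), hUU ⟨hX, hY⟩, sub_eq_zero.1 hf, fun hmem => hX1 _ hmem ?_, fun v hvS h0 =>
    hX2 v hvS ?_⟩
  · simp only
    linear_combination X ^ 2 * hf
  · simp only at h0
    linear_combination v.1 ^ 2 * hf + (A * B * (X * v.2 + v.1 * Y) + (A ^ 2 + B ^ 2) * X * v.1
      - C ^ 2 * (1 + A ^ 2 * B ^ 2) * X * v.1 - C ^ 2 * (A * B) * X ^ 2 * (X * v.2 + v.1 * Y)) * h0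

end Elliptic

section EllipticSolitons

variable {A B C : ℂ} {N : ℕ} {p q : Fin N → ℂ × ℂ}

lemma ellKernel_swap (C : ℂ) (P Q : ℂ × ℂ) : ellKernel C Q P = -ellKernel C P Q := by
  simp only [ellKernel]
  rw [← neg_div]
  congr 1 <;> ring

/-- The polarised BKP equation is symmetric for elliptic solitons: the linear problem is solved by
the sum dressed at a generic point `o` of the curve, and dressing at the image of `o` under the
involution `(X, Y) ↦ (1 / X, 1 / Y)` undoes the first one. -/
lemma dakpNum_ellSoliton (hA : A ≠ 0) (hB : B ≠ 0) (hC : C ≠ 0) (hC4 : C ^ 4 ≠ 1)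
    (hp : ∀ i, OnCurve A B C (p i)) (hq : ∀ i, OnCurve A B C (q i))
    (rp : ∀ i, EllRegular A B (p i)) (rq : ∀ i, EllRegular A B (q i))
    (gpp : ∀ i j, i ≠ j → EllGeneric (p i) (p j)) (gqq : ∀ i j, i ≠ j → EllGeneric (q i) (q j))
    (gpq : ∀ i j, EllGeneric (p i) (q j)) {X Y Z x y z : Fin N → ℂ}
    (hX : ∀ i, X i = (p i).1 * (q i).1) (hY : ∀ i, Y i = (p i).2 * (q i).2)
    (hZ : ∀ i, Z i = ellZ A B C (p i) * ellZ A B C (q i))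
    (hx : ∀ i, x i = Y i * Z i) (hy : ∀ i, y i = X i * Z i) (hz : ∀ i, z i = X i * Y i)
    (d : Fin N → ℂ) (k l m : ℤ) :
    dakpNum ![A ^ 2, B ^ 2, C ^ 2, -(A * B * C) ^ 2]
      (nSoliton (interaction (ellKernel C) p q) d x y z) k l m = 0 := by
  obtain rfl := funext hX
  obtain rfl := funext hY
  obtain rfl := funext hZ
  have hc : OnCurve A B C (B, -A) := by simp only [OnCurve]; ring
  set S : Set (ℂ × ℂ) := insert (B, -A) (Set.range p ∪ Set.range q) with hS
  have hSfin : S.Finite := ((Set.finite_range p).union (Set.finite_range q)).insert _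
  have hS0 : ∀ v ∈ S, v.1 ≠ 0 := by
    rintro v (rfl | ⟨i, rfl⟩ | ⟨i, rfl⟩)
    · exact hB
    · exact (rp i).fst
    · exact (rq i).fst
  obtain ⟨o, -, ho, hK, hn⟩ := exists_onCurve_near hA hB hC hC4 hc
    (K := insert 0 ((fun v => v.1 * v.2) '' S ∪ (fun v => (v.1 * v.2)⁻¹) '' S))
    (((hSfin.image _).union (hSfin.image _)).insert 0) hSfin hS0 univ_mem
  simp only [Set.mem_insert_iff, Set.mem_union, Set.mem_image, not_or, not_exists, not_and] at hK
  obtain ⟨h0, hw, hw'⟩ := hK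
  obtain ⟨o1, o2⟩ := mul_ne_zero_iff.1 h0
  have hw1 : ∀ v ∈ S, 1 - o.1 * o.2 * (v.1 * v.2) ≠ 0 := fun v hv h =>
    hw' v hv (eq_inv_of_mul_eq_one_left (sub_eq_zero.1 h).symm).symm
  have hw2 : ∀ v ∈ S, 1 - o.1⁻¹ * o.2⁻¹ * (v.1 * v.2) ≠ 0 := fun v hv h => hw v hv (by
    field_simp at h
    linear_combination -h)
  have mc : (B, -A) ∈ S := Set.mem_insert _ _
  have mp : ∀ i, p i ∈ S := fun i => Or.inr (Or.inl ⟨i, rfl⟩)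
  have mq : ∀ i, q i ∈ S := fun i => Or.inr (Or.inr ⟨i, rfl⟩)
  have hξ := isPfaffianKernel_ellPoint hA hB hC hp hq ho rp rq gpp gqq gpq (hw1 _ mc)
    (fun i => hw1 _ (mp i)) (fun i => hw1 _ (mq i))
  have hξ' := isPfaffianKernel_ellPoint hA hB hC hp hq (ho.inv o1 o2) rp rq gpp gqq gpq (hw2 _ mc)
    (fun i => hw2 _ (mp i)) (fun i => hw2 _ (mq i))
  have hinv : ∀ v ∈ S, OnCurve A B C v →
      ellKernel C v (o.1⁻¹, o.2⁻¹) = (ellKernel C v o)⁻¹ := fun v hv hvc =>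
    ellKernel_inv hA hB hC ho hvc o1 o2 (fun h => hw v hv h.symm) (hn v hv)
  have hne : ∀ v ∈ S, ellKernel C v o ≠ 0 := fun v hv =>
    EllGeneric.ellKernel_ne_zero (EllGeneric.symm ⟨hw1 v hv, hn v hv⟩) hC
  have va : ellKernel C (0, C) o ≠ 0 := EllGeneric.ellKernel_ne_zero (EllGeneric.symm
    ⟨by simp, by simpa using ⟨o1, hC⟩⟩) hC
  have vb : ellKernel C (-C, 0) o ≠ 0 := EllGeneric.ellKernel_ne_zero (EllGeneric.symm
    ⟨by simp, by simpa using ⟨hC, o2⟩⟩) hC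
  have ia : ellKernel C (0, C) (o.1⁻¹, o.2⁻¹) = (ellKernel C (0, C) o)⁻¹ :=
    ellKernel_inv hA hB hC ho (by simp only [OnCurve]; ring) o1 o2 (by simpa using ⟨o1, o2⟩)
      (by simpa using ⟨o1, hC⟩)
  have ib : ellKernel C (-C, 0) (o.1⁻¹, o.2⁻¹) = (ellKernel C (-C, 0) o)⁻¹ :=
    ellKernel_inv hA hB hC ho (by simp only [OnCurve]; ring) o1 o2 (by simpa using ⟨o1, o2⟩)
      (by simpa using ⟨hC, o2⟩)
  have ic := hinv _ mc hc
  have vc := hne _ mc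
  have m1 := isMixedBKP_ellPoint hC hξ rp rq (fun i => gpq i i) va vb vc
  have m2 := isMixedBKP_ellPoint hC hξ' rp rq (fun i => gpq i i) (by rw [ia]; exact inv_ne_zero va)
    (by rw [ib]; exact inv_ne_zero vb) (by rw [ic]; exact inv_ne_zero vc)
  have hdress : dressing (ellKernel C) p q o * dressing (ellKernel C) p q (o.1⁻¹, o.2⁻¹) = 1 := by
    ext i
    simp only [dressing, Pi.mul_apply, Pi.one_apply]
    rw [ellKernel_swap C (p i), ellKernel_swap C (q i), ellKernel_swap C (p i) (o.1⁻¹, _),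
      ellKernel_swap C (q i) (o.1⁻¹, _), hinv _ (mp i) (hp i), hinv _ (mq i) (hq i)]
    have := hne _ (mp i)
    have := hne _ (mq i)
    field_simp
  rw [ia, ib, ic] at m2
  set ua := ellKernel C (0, C) o
  set ub := ellKernel C (-C, 0) o
  set uc := ellKernel C (B, -A) o
  set R := interaction (ellKernel C) p q
  set L := dressing (ellKernel C) p q o
  have hZ0 : ∀ P, EllRegular A B P → ellZ A B C P ≠ 0 := fun P h =>
    div_ne_zero h.numer (mul_ne_zero hC h.denom)
  rw [changeVars_nSoliton (fun _ => 1) R d (fun i => mul_ne_zero (rp i).fst (rq i).fst)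
    (fun i => mul_ne_zero (rp i).snd (rq i).snd)
    (fun i => mul_ne_zero (hZ0 _ (rp i)) (hZ0 _ (rq i))) (by simpa using hx) (by simpa using hy)
    (by simpa using hz)]
  refine dakpNum_changeVars_nSoliton_eq_zero R _ _ _ (fun c k l m => ua ^ k * ub ^ l * uc ^ m
    * nSoliton R (c * L) (fun i => (p i).1 * (q i).1) (fun i => (p i).2 * (q i).2)
      (fun i => ellZ A B C (p i) * ellZ A B C (q i)) k l m) (fun c k l m => ?_) (fun k l m => ?_)
    m1 (fun c k l m => ?_) d k l m
  · simp only [smul_mul_assoc]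
    exact (differentiable_nSoliton R (c * L) _ _ _ k l m).const_mul _
  · rw [zero_mul, nSoliton_zero, mul_one]
    exact mul_ne_zero (mul_ne_zero (zpow_ne_zero _ va) (zpow_ne_zero _ vb)) (zpow_ne_zero _ vc)
  · have h := m2 (c * L) k l m
    rw [mul_assoc c, hdress, mul_one] at h
    simp only [inv_zpow, zpow_add_one₀ va, zpow_add_one₀ vb, zpow_add_one₀ vc] at h ⊢
    have hka := zpow_ne_zero k va
    have hkb := zpow_ne_zero l vb
    have hkc := zpow_ne_zero m vc
    generalize ua ^ k = ta at *
    generalize ub ^ l = tb at *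
    generalize uc ^ m = tc at *
    have e := congrArg (fun t => ta ^ 2 * tb ^ 2 * tc ^ 2 * ua * ub * uc * t) h
    simp only [mul_zero] at e
    rw [← e]
    field_simp

end EllipticSolitons

/-- The soliton form with the interaction term of the dual AKP equation solves that equation. The
datum `t` consists of the four parameters and of the triples `(x i, y i, z i)`; if an interaction
term is undefined, nothing is claimed. -/
def IsSolitonDatum {N : ℕ} (t : (Fin 4 → ℂ) × (Fin N → ℂ × ℂ × ℂ)) : Prop :=
  (∀ i j, i < j → dispQ t.1 ((t.2 i).1 * (t.2 j).1) ((t.2 i).2.1 * (t.2 j).2.1)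
    ((t.2 i).2.2 * (t.2 j).2.2) ≠ 0) →
  ∀ (d : Fin N → ℂ) (k l m : ℤ), dakpNum t.1
    (nSoliton (fun i j => dakpR t.1 (t.2 i).1 (t.2 i).2.1 (t.2 i).2.2
      (t.2 j).1 (t.2 j).2.1 (t.2 j).2.2) d (fun i => (t.2 i).1) (fun i => (t.2 i).2.1)
      (fun i => (t.2 i).2.2)) k l m = 0

lemma isSolitonDatum_of_mem_closure {N : ℕ} {t₀ : (Fin 4 → ℂ) × (Fin N → ℂ × ℂ × ℂ)}
    (h : t₀ ∈ closure {t | IsSolitonDatum t})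
    (h0 : ∀ i, (t₀.2 i).1 ≠ 0 ∧ (t₀.2 i).2.1 ≠ 0 ∧ (t₀.2 i).2.2 ≠ 0) : IsSolitonDatum t₀ := by
  intro hQ d k l m
  have hQc : ∀ i j, Continuous fun t : (Fin 4 → ℂ) × (Fin N → ℂ × ℂ × ℂ) =>
      dispQ t.1 ((t.2 i).1 * (t.2 j).1) ((t.2 i).2.1 * (t.2 j).2.1)
        ((t.2 i).2.2 * (t.2 j).2.2) := fun i j => by unfold dispQ; fun_prop
  have hev : ∀ᶠ t : (Fin 4 → ℂ) × (Fin N → ℂ × ℂ × ℂ) in 𝓝 t₀, ∀ i j, i < j →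
      dispQ t.1 ((t.2 i).1 * (t.2 j).1) ((t.2 i).2.1 * (t.2 j).2.1)
        ((t.2 i).2.2 * (t.2 j).2.2) ≠ 0 := by
    simp only [eventually_all]
    exact fun i j hij => (hQc i j).continuousAt.eventually_ne (hQ i j hij)
  have hτ : ∀ k l m, ContinuousAt (fun t : (Fin 4 → ℂ) × (Fin N → ℂ × ℂ × ℂ) =>
      nSoliton (fun i j => dakpR t.1 (t.2 i).1 (t.2 i).2.1 (t.2 i).2.2
      (t.2 j).1 (t.2 j).2.1 (t.2 j).2.2) d (fun i => (t.2 i).1) (fun i => (t.2 i).2.1)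
      (fun i => (t.2 i).2.2) k l m) t₀ := by
    refine fun k l m => tendsto_nSoliton d (fun i j hij => ?_) (fun i => ?_) (fun i => ?_)
      (fun i => ?_) (fun i => (h0 i).1) (fun i => (h0 i).2.1) (fun i => (h0 i).2.2) k l m
    · have : ContinuousAt (fun t : (Fin 4 → ℂ) × (Fin N → ℂ × ℂ × ℂ) =>
          dakpR t.1 (t.2 i).1 (t.2 i).2.1 (t.2 i).2.2 (t.2 j).1 (t.2 j).2.1 (t.2 j).2.2) t₀ := by
        unfold dakpR
        refine ContinuousAt.div ?_ (hQc i j).continuousAt (hQ i j hij)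
        unfold S₁ S₄
        fun_prop
      exact this
    · exact Continuous.tendsto (f := fun t : (Fin 4 → ℂ) × (Fin N → ℂ × ℂ × ℂ) => (t.2 i).1)
        (by fun_prop) t₀
    · exact Continuous.tendsto (f := fun t : (Fin 4 → ℂ) × (Fin N → ℂ × ℂ × ℂ) => (t.2 i).2.1)
        (by fun_prop) t₀
    · exact Continuous.tendsto (f := fun t : (Fin 4 → ℂ) × (Fin N → ℂ × ℂ × ℂ) => (t.2 i).2.2)
        (by fun_prop) t₀
  have hcont : ContinuousAt (fun t : (Fin 4 → ℂ) × (Fin N → ℂ × ℂ × ℂ) => dakpNum t.1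
    (nSoliton (fun i j => dakpR t.1 (t.2 i).1 (t.2 i).2.1 (t.2 i).2.2
      (t.2 j).1 (t.2 j).2.1 (t.2 j).2.2) d (fun i => (t.2 i).1) (fun i => (t.2 i).2.1)
      (fun i => (t.2 i).2.2)) k l m) t₀ := by
    simp only [dakpNum_eq]
    fun_prop
  by_contra hne
  obtain ⟨t, ht, hQt, hne⟩ := ((mem_closure_iff_frequently.1 h).and_eventually
    (hev.and (hcont.eventually_ne hne))).exists
  exact hne (ht hQt d k l m)

lemma IsSolitonDatum.const_mul {N : ℕ} {α : Fin 4 → ℂ} {v : Fin N → ℂ × ℂ × ℂ}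
    (h : IsSolitonDatum (α, v)) {μ : ℂ} (hμ : μ ≠ 0) : IsSolitonDatum (fun i => μ * α i, v) := by
  have hQ : ∀ x y z, dispQ (fun i => μ * α i) x y z = μ * dispQ α x y z := fun x y z => by
    simp only [dispQ]; ring
  have hR : ∀ x y z x' y' z', dakpR (fun i => μ * α i) x y z x' y' z' = dakpR α x y z x' y' z' :=
    fun x y z x' y' z' => by
      simp only [dakpR, hQ]
      conv_rhs => rw [← mul_div_mul_left _ _ hμ]
      congr 1
      ring
  intro h1 d k l m
  simp only [hQ, hR] at h1 ⊢
  have := h (fun i j hij => right_ne_zero_of_mul (h1 i j hij)) d k l m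
  rw [dakpNum_eq] at this ⊢
  linear_combination μ * this

section EllipticSolitons

variable {A B C : ℂ} {N : ℕ}

/-- Points of the curve can be moved to pairwise general position. -/
lemma exists_ellGeneric_near (hA : A ≠ 0) (hB : B ≠ 0) (hC : C ≠ 0) (hC4 : C ^ 4 ≠ 1) {ι : Type*}
    [Finite ι] {P : ι → ℂ × ℂ} (hP : ∀ i, OnCurve A B C (P i)) {U : ι → Set (ℂ × ℂ)}
    (hU : ∀ i, U i ∈ 𝓝 (P i)) (hU0 : ∀ i, ∀ v ∈ U i, v.1 ≠ 0) :
    ∃ P' : ι → ℂ × ℂ, (∀ i, P' i ∈ U i) ∧ (∀ i, OnCurve A B C (P' i)) ∧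
      ∀ i j, i ≠ j → EllGeneric (P' i) (P' j) := by
  classical
  have := Fintype.ofFinite ι
  suffices h : ∀ s : Finset ι, ∃ P' : ι → ℂ × ℂ, (∀ i, P' i ∈ U i) ∧ (∀ i, OnCurve A B C (P' i)) ∧
      ∀ i ∈ s, ∀ j ∈ s, i ≠ j → EllGeneric (P' i) (P' j) by
    obtain ⟨P', h1, h2, h3⟩ := h Finset.univ
    exact ⟨P', h1, h2, fun i j => h3 i (Finset.mem_univ i) j (Finset.mem_univ j)⟩
  intro s
  induction s using Finset.induction_on with
  | empty => exact ⟨P, fun i => mem_of_mem_nhds (hU i), hP, by simp⟩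
  | insert a s ha ih =>
    obtain ⟨P', h1, h2, h3⟩ := ih
    have hfin : (P' '' (s : Set ι)).Finite := s.finite_toSet.image _
    obtain ⟨Q, hQU, hQ, hK, hn⟩ := exists_onCurve_near hA hB hC hC4 (hP a)
      (hfin.image fun v => (v.1 * v.2)⁻¹) hfin (by
        rintro _ ⟨i, -, rfl⟩
        exact hU0 i _ (h1 i)) (hU a)
    have hg : ∀ j ∈ s, EllGeneric Q (P' j) := fun j hj =>
      ⟨fun h => hK ⟨_, ⟨j, hj, rfl⟩, (eq_inv_of_mul_eq_one_left (sub_eq_zero.1 h).symm).symm⟩,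
        hn _ ⟨j, hj, rfl⟩⟩
    have hs : ∀ j ∈ s, Function.update P' a Q j = P' j := fun j hj =>
      Function.update_of_ne (by rintro rfl; exact ha hj) _ _
    refine ⟨Function.update P' a Q, fun i => ?_, fun i => ?_, fun i hi j hj hij => ?_⟩
    · rcases eq_or_ne i a with rfl | hi
      · simpa using hQU
      · simpa [Function.update_of_ne hi] using h1 i
    · rcases eq_or_ne i a with rfl | hi
      · simpa using hQ
      · simpa [Function.update_of_ne hi] using h2 i
    · rcases Finset.mem_insert.1 hi with hia | his <;> rcases Finset.mem_insert.1 hj with hja | hjs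
      · exact absurd (hia.trans hja.symm) hij
      · rw [hia, Function.update_self, hs j hjs]
        exact hg j hjs
      · rw [hja, Function.update_self, hs i his]
        exact (hg i his).symm
      · rw [hs i his, hs j hjs]
        exact h3 i his j hjs hij

/-- The triple `(x, y, z)` of the soliton with end points `P` and `Q`. -/
noncomputable def ellTriple (A B C : ℂ) (P Q : ℂ × ℂ) : ℂ × ℂ × ℂ :=
  (P.2 * Q.2 * (ellZ A B C P * ellZ A B C Q), P.1 * Q.1 * (ellZ A B C P * ellZ A B C Q),
    P.1 * Q.1 * (P.2 * Q.2))

lemma isSolitonDatum_of_ellGeneric (hA : A ≠ 0) (hB : B ≠ 0) (hC : C ≠ 0) (hC4 : C ^ 4 ≠ 1)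
    {p q : Fin N → ℂ × ℂ} (hp : ∀ i, OnCurve A B C (p i)) (hq : ∀ i, OnCurve A B C (q i))
    (rp : ∀ i, EllRegular A B (p i)) (rq : ∀ i, EllRegular A B (q i))
    (gpp : ∀ i j, i ≠ j → EllGeneric (p i) (p j)) (gqq : ∀ i j, i ≠ j → EllGeneric (q i) (q j))
    (gpq : ∀ i j, EllGeneric (p i) (q j)) :
    IsSolitonDatum (![A ^ 2, B ^ 2, C ^ 2, -(A * B * C) ^ 2],
      fun i => ellTriple A B C (p i) (q i)) := by
  intro hQ d k l m
  rw [nSoliton_congr (R' := interaction (ellKernel C) p q) (fun i j hij => ?_)]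
  · exact dakpNum_ellSoliton hA hB hC hC4 hp hq rp rq gpp gqq gpq (fun _ => rfl) (fun _ => rfl)
      (fun _ => rfl) (fun _ => rfl) (fun _ => rfl) (fun _ => rfl) d k l m
  · have hsol := dakpNum_ellSoliton (N := 2) (p := ![p i, p j]) (q := ![q i, q j]) hA hB hC hC4
      (Fin.forall_fin_two.2 ⟨hp i, hp j⟩) (Fin.forall_fin_two.2 ⟨hq i, hq j⟩)
      (Fin.forall_fin_two.2 ⟨rp i, rp j⟩) (Fin.forall_fin_two.2 ⟨rq i, rq j⟩)
      (by simp [Fin.forall_fin_two, gpp i j hij.ne, gpp j i hij.ne'])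
      (by simp [Fin.forall_fin_two, gqq i j hij.ne, gqq j i hij.ne'])
      (by simp [Fin.forall_fin_two, gpq]) (fun _ => rfl) (fun _ => rfl)
      (fun _ => rfl) (fun _ => rfl) (fun _ => rfl) (fun _ => rfl)
    have := dakpR_eq_of_nSoliton fun d => hsol d 1 1 1
    exact this (hQ i j hij)

lemma ellZ_continuousAt (hC : C ≠ 0) {P : ℂ × ℂ} (h : EllRegular A B P) :
    ContinuousAt (ellZ A B C) P := by
  unfold ellZ
  exact ContinuousAt.div (by fun_prop) (by fun_prop) (mul_ne_zero hC h.denom)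

lemma EllRegular.eventually {P : ℂ × ℂ} (h : EllRegular A B P) :
    ∀ᶠ Q in 𝓝 P, EllRegular A B Q := by
  have h1 : ContinuousAt (fun Q : ℂ × ℂ => Q.1) P := by fun_prop
  have h2 : ContinuousAt (fun Q : ℂ × ℂ => Q.2) P := by fun_prop
  have h3 : ContinuousAt (fun Q : ℂ × ℂ => A * Q.1 + B * Q.2) P := by fun_prop
  have h4 : ContinuousAt (fun Q : ℂ × ℂ => 1 + A * B * (Q.1 * Q.2)) P := by fun_prop
  filter_upwards [h1.eventually_ne h.1, h2.eventually_ne h.2, h3.eventually_ne h.3,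
    h4.eventually_ne h.4] with Q h1 h2 h3 h4
  exact ⟨h1, h2, h3, h4⟩

lemma ellTriple_ne_zero (hC : C ≠ 0) {P Q : ℂ × ℂ} (hP : EllRegular A B P)
    (hQ : EllRegular A B Q) : (ellTriple A B C P Q).1 ≠ 0 ∧ (ellTriple A B C P Q).2.1 ≠ 0 ∧
      (ellTriple A B C P Q).2.2 ≠ 0 := by
  have hZ : ∀ P, EllRegular A B P → ellZ A B C P ≠ 0 := fun P h =>
    div_ne_zero h.numer (mul_ne_zero hC h.denom)
  simp [ellTriple, hZ P hP, hZ Q hQ, hP.1, hP.2, hQ.1, hQ.2]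

/-- End points in special position are limits of end points in general position. -/
theorem isSolitonDatum_ellTriple (hA : A ≠ 0) (hB : B ≠ 0) (hC : C ≠ 0) (hC4 : C ^ 4 ≠ 1)
    {p q : Fin N → ℂ × ℂ} (hp : ∀ i, OnCurve A B C (p i)) (hq : ∀ i, OnCurve A B C (q i))
    (rp : ∀ i, EllRegular A B (p i)) (rq : ∀ i, EllRegular A B (q i)) :
    IsSolitonDatum (![A ^ 2, B ^ 2, C ^ 2, -(A * B * C) ^ 2],
      fun i => ellTriple A B C (p i) (q i)) := by
  refine isSolitonDatum_of_mem_closure ?_ fun i => ellTriple_ne_zero hC (rp i) (rq i)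
  let Φ : (Fin N ⊕ Fin N → ℂ × ℂ) → (Fin 4 → ℂ) × (Fin N → ℂ × ℂ × ℂ) := fun P =>
    (![A ^ 2, B ^ 2, C ^ 2, -(A * B * C) ^ 2],
      fun i => ellTriple A B C (P (.inl i)) (P (.inr i)))
  let G : Set (Fin N ⊕ Fin N → ℂ × ℂ) := {P | (∀ v, OnCurve A B C (P v)) ∧
    (∀ v, EllRegular A B (P v)) ∧ ∀ v w, v ≠ w → EllGeneric (P v) (P w)}
  have hG : Φ '' G ⊆ {t | IsSolitonDatum t} := by
    rintro _ ⟨P, ⟨h1, h2, h3⟩, rfl⟩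
    exact isSolitonDatum_of_ellGeneric hA hB hC hC4 (fun i => h1 _) (fun i => h1 _)
      (fun i => h2 _) (fun i => h2 _) (fun i j hij => h3 _ _ (by simpa using hij))
      (fun i j hij => h3 _ _ (by simpa using hij)) (fun i j => h3 _ _ (by simp))
  have hr : ∀ v, EllRegular A B (Sum.elim p q v) := Sum.forall.2 ⟨rp, rq⟩
  have hmem : Sum.elim p q ∈ closure G := by
    rw [mem_closure_iff_nhds]
    intro W hW
    rw [nhds_pi, Filter.mem_pi] at hW
    obtain ⟨I, -, t, ht, htW⟩ := hW
    obtain ⟨P', h1, h2, h3⟩ := exists_ellGeneric_near hA hB hC hC4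
      (P := Sum.elim p q) (Sum.forall.2 ⟨hp, hq⟩)
      (U := fun v => t v ∩ {Q | EllRegular A B Q}) (fun v => inter_mem (ht v) (hr v).eventually)
      (fun v Q hQ => hQ.2.fst)
    exact ⟨P', htW fun v _ => (h1 v).1, h2, fun v => (h1 v).2, h3⟩
  have hΦ : ContinuousAt Φ (Sum.elim p q) := by
    refine ContinuousAt.prodMk continuousAt_const (continuousAt_pi.2 fun i => ?_)
    have hz : ∀ v, ContinuousAt (fun P : Fin N ⊕ Fin N → ℂ × ℂ => ellZ A B C (P v))
        (Sum.elim p q) := fun v =>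
      ContinuousAt.comp (f := fun P : Fin N ⊕ Fin N → ℂ × ℂ => P v)
        (ellZ_continuousAt hC (hr v)) (continuous_apply v).continuousAt
    have := hz (.inl i)
    have := hz (.inr i)
    unfold ellTriple
    fun_prop
  exact closure_mono hG (hΦ.continuousWithinAt.mem_closure_image hmem)

end EllipticSolitons

/-! ### Elliptic coordinates of the points of the dispersion surface -/

section Weights

lemma one_add_mul_ne_zero_of_sum_eq_zero {w₁ w₂ w₃ w₄ x₁ x₂ x₃ x₄ γ : ℂ} (hw : w₁ ≠ 0)
    (h12 : x₁ ≠ x₂) (h13 : x₁ ≠ x₃) (h14 : x₁ ≠ x₄)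
    (h : w₁ * ((1 + γ * x₂) * (1 + γ * x₃) * (1 + γ * x₄))
      + w₂ * ((1 + γ * x₁) * (1 + γ * x₃) * (1 + γ * x₄))
      + w₃ * ((1 + γ * x₁) * (1 + γ * x₂) * (1 + γ * x₄))
      + w₄ * ((1 + γ * x₁) * (1 + γ * x₂) * (1 + γ * x₃)) = 0) : 1 + γ * x₁ ≠ 0 := by
  intro h1
  have key : ∀ x, x₁ ≠ x → 1 + γ * x ≠ 0 := fun x hx h2 => by
    have : γ * (x₁ - x) = 0 := by linear_combination h1 - h2
    rw [(mul_eq_zero.1 this).resolve_right (sub_ne_zero.2 hx)] at h1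
    simp at h1
  rw [h1] at h
  have : w₁ * ((1 + γ * x₂) * (1 + γ * x₃) * (1 + γ * x₄)) = 0 := by linear_combination h
  simp [hw, key x₂ h12, key x₃ h13, key x₄ h14] at this

/-- The dispersion relation, written symmetrically in `x₁, …, x₄` with
`πᵢ = ∏_{j ≠ i} (xᵢ - xⱼ)`, is the solvability condition for four equations in the weights `vᵢ`.
The first two say that `vᵢ = (β + γ xᵢ) / πᵢ`. Of the resulting cubic equation for `γ / β` one root
is at infinity because of the dispersion relation, which leaves a quadratic equation. -/
lemma exists_weights {a₁ a₂ a₃ a₄ x₁ x₂ x₃ x₄ : ℂ} (ha₁ : a₁ ≠ 0) (ha₂ : a₂ ≠ 0) (ha₃ : a₃ ≠ 0)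
    (ha₄ : a₄ ≠ 0) (hx₁ : x₁ ≠ 0) (hx₂ : x₂ ≠ 0) (hx₃ : x₃ ≠ 0) (hx₄ : x₄ ≠ 0)
    (h12 : x₁ ≠ x₂) (h13 : x₁ ≠ x₃) (h14 : x₁ ≠ x₄) (h23 : x₂ ≠ x₃) (h24 : x₂ ≠ x₄)
    (h34 : x₃ ≠ x₄)
    (h : a₁ * ((x₁ - x₂) * (x₁ - x₃) * (x₁ - x₄)) * (x₂ * x₃ * x₄)
      + a₂ * ((x₂ - x₁) * (x₂ - x₃) * (x₂ - x₄)) * (x₁ * x₃ * x₄)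
      + a₃ * ((x₃ - x₁) * (x₃ - x₂) * (x₃ - x₄)) * (x₁ * x₂ * x₄)
      + a₄ * ((x₄ - x₁) * (x₄ - x₂) * (x₄ - x₃)) * (x₁ * x₂ * x₃) = 0) :
    ∃ v₁ v₂ v₃ v₄ : ℂ, v₁ ≠ 0 ∧ v₂ ≠ 0 ∧ v₃ ≠ 0 ∧ v₄ ≠ 0 ∧ v₁ + v₂ + v₃ + v₄ = 0 ∧
      x₁ * v₁ + x₂ * v₂ + x₃ * v₃ + x₄ * v₄ = 0 ∧ a₁ / v₁ + a₂ / v₂ + a₃ / v₃ + a₄ / v₄ = 0 ∧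
      a₁ / (x₁ * v₁) + a₂ / (x₂ * v₂) + a₃ / (x₃ * v₃) + a₄ / (x₄ * v₄) = 0 := by
  have d12 := sub_ne_zero.2 h12
  have d13 := sub_ne_zero.2 h13
  have d14 := sub_ne_zero.2 h14
  have d23 := sub_ne_zero.2 h23
  have d24 := sub_ne_zero.2 h24
  have d34 := sub_ne_zero.2 h34
  have d21 := sub_ne_zero.2 h12.symm
  have d31 := sub_ne_zero.2 h13.symm
  have d41 := sub_ne_zero.2 h14.symm
  have d32 := sub_ne_zero.2 h23.symm
  have d42 := sub_ne_zero.2 h24.symm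
  have d43 := sub_ne_zero.2 h34.symm
  obtain ⟨π₁, hπ₁⟩ : ∃ t, t = (x₁ - x₂) * (x₁ - x₃) * (x₁ - x₄) := ⟨_, rfl⟩
  obtain ⟨π₂, hπ₂⟩ : ∃ t, t = (x₂ - x₁) * (x₂ - x₃) * (x₂ - x₄) := ⟨_, rfl⟩
  obtain ⟨π₃, hπ₃⟩ : ∃ t, t = (x₃ - x₁) * (x₃ - x₂) * (x₃ - x₄) := ⟨_, rfl⟩
  obtain ⟨π₄, hπ₄⟩ : ∃ t, t = (x₄ - x₁) * (x₄ - x₂) * (x₄ - x₃) := ⟨_, rfl⟩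
  have n₁ : π₁ ≠ 0 := by simp [*]
  have n₂ : π₂ ≠ 0 := by simp [*]
  have n₃ : π₃ ≠ 0 := by simp [*]
  have n₄ : π₄ ≠ 0 := by simp [*]
  have s0 : 1 / π₁ + 1 / π₂ + 1 / π₃ + 1 / π₄ = 0 := by
    rw [hπ₁, hπ₂, hπ₃, hπ₄]
    rw [← neg_sub x₁ x₂, ← neg_sub x₁ x₃, ← neg_sub x₁ x₄, ← neg_sub x₂ x₃, ← neg_sub x₂ x₄,
      ← neg_sub x₃ x₄]
    field_simp
    ring
  have s1 : x₁ / π₁ + x₂ / π₂ + x₃ / π₃ + x₄ / π₄ = 0 := by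
    rw [hπ₁, hπ₂, hπ₃, hπ₄]
    rw [← neg_sub x₁ x₂, ← neg_sub x₁ x₃, ← neg_sub x₁ x₄, ← neg_sub x₂ x₃, ← neg_sub x₂ x₄,
      ← neg_sub x₃ x₄]
    field_simp
    ring
  have s2 : x₁ ^ 2 / π₁ + x₂ ^ 2 / π₂ + x₃ ^ 2 / π₃ + x₄ ^ 2 / π₄ = 0 := by
    rw [hπ₁, hπ₂, hπ₃, hπ₄]
    rw [← neg_sub x₁ x₂, ← neg_sub x₁ x₃, ← neg_sub x₁ x₄, ← neg_sub x₂ x₃, ← neg_sub x₂ x₄,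
      ← neg_sub x₃ x₄]
    field_simp
    ring
  rw [← hπ₁, ← hπ₂, ← hπ₃, ← hπ₄] at h
  suffices hβγ : ∃ β γ : ℂ, β + γ * x₁ ≠ 0 ∧ β + γ * x₂ ≠ 0 ∧ β + γ * x₃ ≠ 0 ∧ β + γ * x₄ ≠ 0 ∧
      a₁ * π₁ / (β + γ * x₁) + a₂ * π₂ / (β + γ * x₂) + a₃ * π₃ / (β + γ * x₃)
        + a₄ * π₄ / (β + γ * x₄) = 0 ∧
      a₁ * π₁ / (x₁ * (β + γ * x₁)) + a₂ * π₂ / (x₂ * (β + γ * x₂))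
        + a₃ * π₃ / (x₃ * (β + γ * x₃)) + a₄ * π₄ / (x₄ * (β + γ * x₄)) = 0 by
    obtain ⟨β, γ, b₁, b₂, b₃, b₄, e1, e2⟩ := hβγ
    refine ⟨(β + γ * x₁) / π₁, (β + γ * x₂) / π₂, (β + γ * x₃) / π₃, (β + γ * x₄) / π₄,
      div_ne_zero b₁ n₁, div_ne_zero b₂ n₂, div_ne_zero b₃ n₃, div_ne_zero b₄ n₄,
      by linear_combination β * s0 + γ * s1, by linear_combination β * s1 + γ * s2, ?_, ?_⟩
    · simpa only [div_div_eq_mul_div] using e1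
    · simpa only [← mul_div_assoc, div_div_eq_mul_div] using e2
  have hdiv : a₁ * π₁ / x₁ + a₂ * π₂ / x₂ + a₃ * π₃ / x₃ + a₄ * π₄ / x₄ = 0 := by
    field_simp
    linear_combination h
  by_cases hc2 : a₁ * π₁ * (x₂ * x₃ + x₂ * x₄ + x₃ * x₄) + a₂ * π₂ * (x₁ * x₃ + x₁ * x₄ + x₃ * x₄)
      + a₃ * π₃ * (x₁ * x₂ + x₁ * x₄ + x₂ * x₄) + a₄ * π₄ * (x₁ * x₂ + x₁ * x₃ + x₂ * x₃) = 0
  · refine ⟨0, 1, by simpa, by simpa, by simpa, by simpa, by simpa using hdiv, ?_⟩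
    have e : a₁ * π₁ / (x₁ * x₁) + a₂ * π₂ / (x₂ * x₂) + a₃ * π₃ / (x₃ * x₃)
        + a₄ * π₄ / (x₄ * x₄) = (1 / x₁ + 1 / x₂ + 1 / x₃ + 1 / x₄)
          * (a₁ * π₁ / x₁ + a₂ * π₂ / x₂ + a₃ * π₃ / x₃ + a₄ * π₄ / x₄)
        - (a₁ * π₁ * (x₂ * x₃ + x₂ * x₄ + x₃ * x₄) + a₂ * π₂ * (x₁ * x₃ + x₁ * x₄ + x₃ * x₄)
          + a₃ * π₃ * (x₁ * x₂ + x₁ * x₄ + x₂ * x₄) + a₄ * π₄ * (x₁ * x₂ + x₁ * x₃ + x₂ * x₃))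
          / (x₁ * x₂ * x₃ * x₄) := by
      field_simp
      ring
    simp only [zero_add, one_mul]
    rw [e, hdiv, hc2]
    simp
  · obtain ⟨c2, hc2'⟩ : ∃ t, t = a₁ * π₁ * (x₂ * x₃ + x₂ * x₄ + x₃ * x₄)
      + a₂ * π₂ * (x₁ * x₃ + x₁ * x₄ + x₃ * x₄) + a₃ * π₃ * (x₁ * x₂ + x₁ * x₄ + x₂ * x₄)
      + a₄ * π₄ * (x₁ * x₂ + x₁ * x₃ + x₂ * x₃) := ⟨_, rfl⟩
    obtain ⟨c1, hc1⟩ : ∃ t, t = a₁ * π₁ * (x₂ + x₃ + x₄) + a₂ * π₂ * (x₁ + x₃ + x₄)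
      + a₃ * π₃ * (x₁ + x₂ + x₄) + a₄ * π₄ * (x₁ + x₂ + x₃) := ⟨_, rfl⟩
    obtain ⟨c0, hc0⟩ : ∃ t, t = a₁ * π₁ + a₂ * π₂ + a₃ * π₃ + a₄ * π₄ := ⟨_, rfl⟩
    rw [← hc2'] at hc2
    obtain ⟨s, hs⟩ := IsAlgClosed.exists_eq_mul_self (c1 ^ 2 - 4 * c2 * c0)
    obtain ⟨γ, hγ⟩ : ∃ γ, c2 * γ ^ 2 + c1 * γ + c0 = 0 :=
      ⟨(-c1 + s) / (2 * c2), by field_simp; linear_combination -hs⟩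
    have hF : a₁ * π₁ * ((1 + γ * x₂) * (1 + γ * x₃) * (1 + γ * x₄))
        + a₂ * π₂ * ((1 + γ * x₁) * (1 + γ * x₃) * (1 + γ * x₄))
        + a₃ * π₃ * ((1 + γ * x₁) * (1 + γ * x₂) * (1 + γ * x₄))
        + a₄ * π₄ * ((1 + γ * x₁) * (1 + γ * x₂) * (1 + γ * x₃)) = 0 := by
      rw [hc2', hc1, hc0] at hγ
      linear_combination hγ + γ ^ 3 * h
    have b₁ : 1 + γ * x₁ ≠ 0 := one_add_mul_ne_zero_of_sum_eq_zero (w₁ := a₁ * π₁) (w₂ := a₂ * π₂)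
      (w₃ := a₃ * π₃) (w₄ := a₄ * π₄) (mul_ne_zero ha₁ n₁) h12 h13 h14 hF
    have b₂ : 1 + γ * x₂ ≠ 0 := one_add_mul_ne_zero_of_sum_eq_zero (w₁ := a₂ * π₂) (w₂ := a₁ * π₁)
      (w₃ := a₃ * π₃) (w₄ := a₄ * π₄) (mul_ne_zero ha₂ n₂) h12.symm h23 h24
      (by linear_combination hF)
    have b₃ : 1 + γ * x₃ ≠ 0 := one_add_mul_ne_zero_of_sum_eq_zero (w₁ := a₃ * π₃) (w₂ := a₁ * π₁)
      (w₃ := a₂ * π₂) (w₄ := a₄ * π₄) (mul_ne_zero ha₃ n₃) h13.symm h23.symm h34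
      (by linear_combination hF)
    have b₄ : 1 + γ * x₄ ≠ 0 := one_add_mul_ne_zero_of_sum_eq_zero (w₁ := a₄ * π₄) (w₂ := a₁ * π₁)
      (w₃ := a₂ * π₂) (w₄ := a₃ * π₃) (mul_ne_zero ha₄ n₄) h14.symm h24.symm h34.symm
      (by linear_combination hF)
    have e1 : a₁ * π₁ / (1 + γ * x₁) + a₂ * π₂ / (1 + γ * x₂) + a₃ * π₃ / (1 + γ * x₃)
        + a₄ * π₄ / (1 + γ * x₄) = 0 := by
      field_simp
      linear_combination hF
    have part : ∀ w x : ℂ, x ≠ 0 → 1 + γ * x ≠ 0 →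
        w / (x * (1 + γ * x)) = w / x - γ * (w / (1 + γ * x)) := fun w x hx hb => by
      rw [← mul_div_assoc, div_sub_div _ _ hx hb]
      congr 1
      ring
    refine ⟨1, γ, b₁, b₂, b₃, b₄, e1, ?_⟩
    rw [part _ _ hx₁ b₁, part _ _ hx₂ b₂, part _ _ hx₃ b₃, part _ _ hx₄ b₄]
    linear_combination hdiv - γ * e1

variable {A B C : ℂ}

/-- Four weights give a point of the curve. -/
lemma exists_onCurve_of_weights (hA : A ≠ 0) (hB : B ≠ 0) (hC : C ≠ 0) {x y z v₁ v₂ v₃ v₄ t : ℂ}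
    (h₁ : v₁ ≠ 0) (h₂ : v₂ ≠ 0) (h₃ : v₃ ≠ 0) (h₄ : v₄ ≠ 0) (hv : v₁ + v₂ + v₃ + v₄ = 0)
    (hxv : x * v₁ + y * v₂ + z * v₃ + 1 * v₄ = 0)
    (hav : A ^ 2 / v₁ + B ^ 2 / v₂ + C ^ 2 / v₃ + (A * B * C) ^ 2 / v₄ = 0)
    (hL : (A ^ 2 - B ^ 2) * (x - y) ≠ (C ^ 2 - (A * B * C) ^ 2) * (z - 1))
    (ht : t ^ 2 * (v₁ * v₂ * v₃) = v₄) :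
    OnCurve A B C (t * v₁ / A, t * v₂ / B) ∧ EllRegular A B (t * v₁ / A, t * v₂ / B) ∧
      ellZ A B C (t * v₁ / A, t * v₂ / B) = -(t * v₃ / C) := by
  have hs : v₃ + v₄ ≠ 0 := by
    intro hs
    have e4 : v₄ = -v₃ := by linear_combination hs
    have e2 : v₂ = -v₁ := by linear_combination hv - hs
    subst e4 e2
    refine hL (mul_right_cancel₀ h₃ ?_)
    field_simp at hav
    have e1 : (A ^ 2 - B ^ 2) * v₃ = -(C ^ 2 - (A * B * C) ^ 2) * v₁ := by
      linear_combination hav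
    linear_combination (x - y) * e1 - (C ^ 2 - (A * B * C) ^ 2) * hxv
  have ht0 : t ≠ 0 := by
    rintro rfl
    exact h₄ (by rw [← ht]; ring)
  have hden : 1 + A * B * (t * v₁ / A * (t * v₂ / B)) = (v₃ + v₄) / v₃ := by
    field_simp
    linear_combination ht
  have hnum : A * (t * v₁ / A) + B * (t * v₂ / B) = -t * (v₃ + v₄) := by
    field_simp
    linear_combination hv
  refine ⟨?_, ⟨by simp [*], by simp [*], ?_, ?_⟩, ?_⟩
  · simp only [OnCurve]
    rw [hden, hnum]
    have e : B * (t * v₁ / A) + A * (t * v₂ / B)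
        = -(C ^ 2 / v₃ + (A * B * C) ^ 2 / v₄) * (t * v₁ * v₂ / (A * B)) := by
      have : -(C ^ 2 / v₃ + (A * B * C) ^ 2 / v₄) = A ^ 2 / v₁ + B ^ 2 / v₂ := by
        linear_combination -hav
      rw [this]
      field_simp
      ring
    rw [e, ← ht]
    have : v₁ * v₂ ≠ 0 := mul_ne_zero h₁ h₂
    field_simp
    ring
  · simp only [hnum]
    simp [*]
  · simp only [hden]
    simp [*]
  · simp only [ellZ, hnum, hden]
    field_simp

/-- A generic point of the dispersion surface is the triple of a soliton with two end points on the
curve. The second end point belongs to the weights `aᵢ / (xᵢ vᵢ)`, which obey the same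
equations. -/
theorem exists_ellTriple (hA : A ≠ 0) (hB : B ≠ 0) (hC : C ≠ 0) {x y z : ℂ} (hx : x ≠ 0)
    (hy : y ≠ 0) (hz : z ≠ 0) (hxy : x ≠ y) (hxz : x ≠ z) (hyz : y ≠ z) (hx1 : x ≠ 1) (hy1 : y ≠ 1)
    (hz1 : z ≠ 1) (hL : (A ^ 2 - B ^ 2) * (x - y) ≠ (C ^ 2 - (A * B * C) ^ 2) * (z - 1))
    (hQ : dispQ ![A ^ 2, B ^ 2, C ^ 2, -(A * B * C) ^ 2] x y z = 0) :
    ∃ P Q, OnCurve A B C P ∧ OnCurve A B C Q ∧ EllRegular A B P ∧ EllRegular A B Q ∧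
      ellTriple A B C P Q = (x, y, z) := by
  have hD : A * B * C ≠ 0 := by simp [*]
  obtain ⟨v₁, v₂, v₃, v₄, h₁, h₂, h₃, h₄, e1, e2, e3, e4⟩ := exists_weights (pow_ne_zero 2 hA)
    (pow_ne_zero 2 hB) (pow_ne_zero 2 hC) (pow_ne_zero 2 hD) hx hy hz one_ne_zero hxy hxz hx1 hyz
    hy1 hz1 (by
      simp only [dispQ, Matrix.cons_val] at hQ
      linear_combination hQ)
  obtain ⟨t, ht⟩ := IsAlgClosed.exists_eq_mul_self (v₄ / (v₁ * v₂ * v₃))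
  obtain ⟨r, hr⟩ := IsAlgClosed.exists_eq_mul_self (x * y * z)
  have ht0 : t ≠ 0 := by
    rintro rfl
    exact div_ne_zero h₄ (mul_ne_zero (mul_ne_zero h₁ h₂) h₃) (ht.trans (mul_zero 0))
  have ht' : v₄ = t ^ 2 * (v₁ * v₂ * v₃) := by
    field_simp at ht
    linear_combination ht
  obtain ⟨c1, r1, z1⟩ := exists_onCurve_of_weights hA hB hC (t := t) h₁ h₂ h₃ h₄ e1 e2 e3 hL ht'.symm
  obtain ⟨c2, r2, z2⟩ := exists_onCurve_of_weights hA hB hC (t := r / t)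
    (v₁ := A ^ 2 / (x * v₁)) (v₂ := B ^ 2 / (y * v₂)) (v₃ := C ^ 2 / (z * v₃))
    (v₄ := (A * B * C) ^ 2 / (1 * v₄)) (x := x) (y := y) (z := z)
    (by simp [*]) (by simp [*]) (by simp [*]) (by simp [*]) e4
    (by rw [← e3]; field_simp) (by
      rw [← e2]
      field_simp) hL (by
      rw [ht']
      field_simp
      linear_combination -hr)
  refine ⟨_, _, c1, c2, r1, r2, ?_⟩
  simp only [ellTriple, z1, z2]
  refine Prod.ext ?_ (Prod.ext ?_ ?_)
  · simp only
    field_simp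
    linear_combination -hr
  · simp only
    field_simp
    linear_combination -hr
  · simp only
    field_simp
    linear_combination -hr

end Weights

/-! ### Reduction to generic parameters and generic points -/

section Generic

lemma eventually_eventually_ne_of_differentiable {f : ℂ → ℂ → ℂ}
    (h1 : ∀ v, Differentiable ℂ fun u => f u v) (h2 : ∀ u, Differentiable ℂ (f u)) {u₁ v₁ : ℂ}
    (h : f u₁ v₁ ≠ 0) (u₀ v₀ : ℂ) : ∀ᶠ u in 𝓝[≠] u₀, ∀ᶠ v in 𝓝[≠] v₀, f u v ≠ 0 :=
  (eventually_ne_of_differentiable (h1 v₁) h u₀).mono fun u hu =>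
    eventually_ne_of_differentiable (h2 u) hu v₀

/-- Conditions on the parameters under which the elliptic curve exists, contains no line `X = const`
(`mul_add_ne`), and its points cover a dense part of the dispersion surface. -/
structure IsGenericParam (α : Fin 4 → ℂ) : Prop where
  ne_zero : ∀ i, α i ≠ 0
  sub_ne : α 0 - α 1 ≠ 0
  sub_sub_ne : α 0 - α 1 - (α 2 + α 3) ≠ 0
  mul_add_ne : α 0 * α 1 + α 2 * α 3 ≠ 0

/-- The points of the dispersion surface covered by `exists_ellTriple`. -/
def genericTriples (α : Fin 4 → ℂ) : Set (ℂ × ℂ × ℂ) :=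
  {v | dispQ α v.1 v.2.1 v.2.2 = 0 ∧ v.1 ≠ 0 ∧ v.2.1 ≠ 0 ∧ v.2.2 ≠ 0 ∧ v.1 ≠ v.2.1 ∧ v.1 ≠ v.2.2 ∧
    v.2.1 ≠ v.2.2 ∧ v.1 ≠ 1 ∧ v.2.1 ≠ 1 ∧ v.2.2 ≠ 1 ∧
    (α 0 - α 1) * (v.1 - v.2.1) ≠ (α 2 + α 3) * (v.2.2 - 1)}

/-- For generic parameters, no component of the dispersion surface outside the coordinate planes is
contained in one of the excluded surfaces: each of these is a graph over the `(y, z)` plane, and `Q`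
does not vanish identically on it. -/
lemma mem_closure_genericTriples {α : Fin 4 → ℂ} (hα : IsGenericParam α) {x y z : ℂ} (hx : x ≠ 0)
    (hy : y ≠ 0) (hz : z ≠ 0) (hQ : dispQ α x y z = 0) :
    (x, y, z) ∈ closure (genericTriples α) := by
  rw [mem_closure_iff_nhds]
  intro W hW
  obtain ⟨U₁, hU₁, U₂₃, hU₂₃, hW⟩ := mem_nhds_prod_iff.1 hW
  have hd : Continuous (Function.uncurry fun (p : ℂ × ℂ) t => dispQ α t p.1 p.2) := by
    unfold Function.uncurry dispQ
    fun_prop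
  have hroot := eventually_exists_zero_near (f := fun (p : ℂ × ℂ) t => dispQ α t p.1 p.2)
    (p₀ := (y, z)) (t₀ := x) (w := 0) hd (fun p => by unfold dispQ; fun_prop) hQ
    (by simp [dispQ, hy, hz, hα.1]) (inter_mem hU₁ (isOpen_ne.mem_nhds hx))
  have h1 := (hroot.and hU₂₃).curry_nhds
  obtain ⟨κ, hκ⟩ : ∃ κ, κ = (α 2 + α 3) / (α 0 - α 1) := ⟨_, rfl⟩
  have hκ1 : κ ≠ 1 := by
    rw [hκ, Ne, div_eq_one_iff_eq hα.sub_ne]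
    exact fun h => hα.sub_sub_ne (by rw [h, sub_self])
  have g1 := eventually_eventually_ne_of_differentiable (f := fun u v => dispQ α 1 u v) (u₁ := 2)
    (v₁ := 1) (fun v => by unfold dispQ; fun_prop) (fun u => by unfold dispQ; fun_prop)
    (by simp [dispQ]; norm_num; exact hα.1 1) y z
  have g2 := eventually_eventually_ne_of_differentiable (f := fun u v => dispQ α u u v) (u₁ := 1)
    (v₁ := 2) (fun v => by unfold dispQ; fun_prop) (fun u => by unfold dispQ; fun_prop)
    (by simp [dispQ]; norm_num; exact hα.1 2) y z
  have g3 := eventually_eventually_ne_of_differentiable (f := fun u v => dispQ α v u v) (u₁ := 2)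
    (v₁ := 1) (fun v => by unfold dispQ; fun_prop) (fun u => by unfold dispQ; fun_prop)
    (by simp [dispQ]; norm_num; exact hα.1 1) y z
  have g4 := fun v₁ h => eventually_eventually_ne_of_differentiable
    (f := fun u v => dispQ α (u + κ * (v - 1)) u v) (u₁ := 1) (v₁ := v₁)
    (fun v => by unfold dispQ; fun_prop) (fun u => by unfold dispQ; fun_prop) h y z
  have g4 : ∀ᶠ u in 𝓝[≠] y, ∀ᶠ v in 𝓝[≠] z, dispQ α (u + κ * (v - 1)) u v ≠ 0 := by
    have e : ∀ v, dispQ α (1 + κ * (v - 1)) 1 v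
        = (v - 1) ^ 3 * (κ - 1) * (v * κ ^ 2 * α 0 - (1 + κ * (v - 1)) * α 2) := fun v => by
      simp only [dispQ]; ring
    by_cases h2 : dispQ α (1 + κ * (2 - 1)) 1 2 = 0
    · refine g4 3 fun h3 => ?_
      rw [e] at h2 h3
      have hκ1 := sub_ne_zero.2 hκ1
      have e2 : 2 * κ ^ 2 * α 0 - (1 + κ * (2 - 1)) * α 2 = 0 := mul_left_cancel₀ hκ1 (by
        linear_combination h2)
      have e3 : 3 * κ ^ 2 * α 0 - (1 + κ * (3 - 1)) * α 2 = 0 := mul_left_cancel₀ hκ1 (by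
        linear_combination h3 / 8)
      exact mul_ne_zero hκ1 (hα.1 2) (by linear_combination 3 * e2 - 2 * e3)
    · exact g4 2 h2
  have hne : ∀ w c : ℂ, ∀ᶠ u in 𝓝[≠] w, u ≠ c := fun w c =>
    eventually_ne_of_differentiable (f := fun u => u - c) (by fun_prop) (w := c + 1) (by simp) w
      |>.mono fun u => sub_ne_zero.1
  obtain ⟨u, ⟨h1, g1, g2, g3, g4⟩, hu0, hu1⟩ := (((h1.filter_mono nhdsWithin_le_nhds).and
    (g1.and (g2.and (g3.and g4)))).and ((hne y 0).and (hne y 1))).exists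
  obtain ⟨v, ⟨⟨⟨t, ⟨htU, ht0⟩, htQ⟩, huv⟩, g1, g2, g3, g4⟩, hv0, hv1, hvu⟩ :=
    (((h1.filter_mono nhdsWithin_le_nhds).and (g1.and (g2.and (g3.and g4)))).and
      ((hne z 0).and ((hne z 1).and (hne z u)))).exists
  refine ⟨(t, u, v), hW ⟨htU, huv⟩, htQ, ht0, hu0, hv0, ?_, ?_, hvu.symm, ?_, hu1, hv1, ?_⟩
  · intro (h : t = u)
    subst h
    exact g2 htQ
  · intro (h : t = v)
    subst h
    exact g3 htQ
  · intro (h : t = 1)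
    subst h
    exact g1 htQ
  · intro hL
    simp only at hL
    have : t = u + κ * (v - 1) := by
      have h0 := hα.sub_ne
      rw [hκ]
      field_simp
      linear_combination hL
    exact g4 (this ▸ htQ)

/-- Up to a common factor, generic parameters are those of an elliptic curve. -/
lemma IsGenericParam.exists_sq {α : Fin 4 → ℂ} (hα : IsGenericParam α) :
    ∃ A B C μ : ℂ, A ≠ 0 ∧ B ≠ 0 ∧ C ≠ 0 ∧ μ ≠ 0 ∧ C ^ 4 ≠ 1 ∧
      α = fun i => μ * ![A ^ 2, B ^ 2, C ^ 2, -(A * B * C) ^ 2] i := by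
  obtain ⟨A, hA⟩ := IsAlgClosed.exists_eq_mul_self (α 0)
  obtain ⟨B, hB⟩ := IsAlgClosed.exists_eq_mul_self (α 1)
  obtain ⟨C, hC⟩ := IsAlgClosed.exists_eq_mul_self (α 2)
  obtain ⟨D, hD⟩ := IsAlgClosed.exists_eq_mul_self (-α 3)
  have hA0 : A ≠ 0 := fun h => hα.1 0 (by rw [hA, h, mul_zero])
  have hB0 : B ≠ 0 := fun h => hα.1 1 (by rw [hB, h, mul_zero])
  have hC0 : C ≠ 0 := fun h => hα.1 2 (by rw [hC, h, mul_zero])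
  have hD0 : D ≠ 0 := fun h => hα.1 3 (by rw [← neg_eq_zero, hD, h, mul_zero])
  obtain ⟨r, hr⟩ := IsAlgClosed.exists_eq_mul_self (A * B * C / D)
  have hr0 : r ≠ 0 := fun h => div_ne_zero (mul_ne_zero (mul_ne_zero hA0 hB0) hC0) hD0
    (by rw [hr, h, mul_zero])
  have hr' : A * B * C = r ^ 2 * D := by
    field_simp at hr
    linear_combination hr
  have hα' : α = fun i => r ^ 2 * ![(A / r) ^ 2, (B / r) ^ 2, (C / r) ^ 2,
      -(A / r * (B / r) * (C / r)) ^ 2] i := by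
    have e : A / r * (B / r) * (C / r) = D / r := by
      field_simp
      linear_combination hr'
    rw [e]
    ext i
    fin_cases i
    · simp; field_simp; linear_combination hA
    · simp; field_simp; linear_combination hB
    · simp; field_simp; linear_combination hC
    · simp; field_simp; linear_combination -hD
  refine ⟨A / r, B / r, C / r, r ^ 2, div_ne_zero hA0 hr0, div_ne_zero hB0 hr0, div_ne_zero hC0 hr0,
    pow_ne_zero 2 hr0, fun h => hα.mul_add_ne ?_, hα'⟩
  rw [hα']
  simp only [Matrix.cons_val]
  linear_combination (-(r ^ 4 * (A / r) ^ 2 * (B / r) ^ 2)) * h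

variable {N : ℕ}

/-- For generic parameters, the triples that have end points on the elliptic curve are dense. -/
lemma isSolitonDatum_of_isGenericParam {α : Fin 4 → ℂ} (hα : IsGenericParam α)
    {v : Fin N → ℂ × ℂ × ℂ} (hv : ∀ i, (v i).1 ≠ 0 ∧ (v i).2.1 ≠ 0 ∧ (v i).2.2 ≠ 0)
    (hQ : ∀ i, dispQ α (v i).1 (v i).2.1 (v i).2.2 = 0) : IsSolitonDatum (α, v) := by
  have hmem : v ∈ closure (Set.pi Set.univ fun _ : Fin N => genericTriples α) := by
    rw [closure_pi_set]
    exact fun i _ => mem_closure_genericTriples hα (hv i).1 (hv i).2.1 (hv i).2.2 (hQ i)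
  have hcont : Continuous fun v : Fin N → ℂ × ℂ × ℂ => (α, v) := by fun_prop
  refine isSolitonDatum_of_mem_closure (closure_mono ?_
    (hcont.continuousWithinAt.mem_closure_image hmem)) hv
  rintro _ ⟨u, hu, rfl⟩
  obtain ⟨A, B, C, μ, hA, hB, hC, hμ, hC4, rfl⟩ := hα.exists_sq
  have hpq : ∀ i, ∃ P Q, OnCurve A B C P ∧ OnCurve A B C Q ∧ EllRegular A B P ∧ EllRegular A B Q ∧
      ellTriple A B C P Q = u i := fun i => by
    obtain ⟨h, hx, hy, hz, hxy, hxz, hyz, hx1, hy1, hz1, hL⟩ := hu i (Set.mem_univ i)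
    refine exists_ellTriple hA hB hC hx hy hz hxy hxz hyz hx1 hy1 hz1 (fun h => hL ?_)
      (mul_left_cancel₀ hμ ?_)
    · simp only [Matrix.cons_val]
      linear_combination μ * h
    · rw [mul_zero, ← h]
      simp only [dispQ]
      ring
  choose p q hp hq rp rq hu using hpq
  obtain rfl : (fun i => ellTriple A B C (p i) (q i)) = u := funext hu
  exact (isSolitonDatum_ellTriple hA hB hC hC4 hp hq rp rq).const_mul hμ

lemma exists_dispQ_ne_zero {α : Fin 4 → ℂ} (hα : α ≠ 0) : ∃ x y z, dispQ α x y z ≠ 0 := by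
  by_contra! h
  have h1 := h 0 1 1
  have h2 := h 1 0 1
  have h3 := h 1 1 0
  have h4 := h 2 2 2
  simp only [dispQ] at h1 h2 h3 h4
  have e0 : α 0 = 0 := by linear_combination -h1
  have e1 : α 1 = 0 := by linear_combination -h2
  have e2 : α 2 = 0 := by linear_combination -h3
  have e3 : α 3 = 0 := by linear_combination h4 / 8
  exact hα (funext fun i => by fin_cases i <;> assumption)

/-- Almost all points of a line of parameters with a suitable direction are generic. -/
lemma eventually_isGenericParam (α : Fin 4 → ℂ) :
    ∀ᶠ s in 𝓝[≠] (0 : ℂ), IsGenericParam fun i => α i + s * ![1, 2, 3, 5] i := by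
  have h2 : ∀ᶠ s in 𝓝[≠] (0 : ℂ), (α 0 + s * 1) * (α 1 + s * 2) + (α 2 + s * 3) * (α 3 + s * 5)
      ≠ 0 := by
    have hw : ∃ w : ℂ, (α 0 + w * 1) * (α 1 + w * 2) + (α 2 + w * 3) * (α 3 + w * 5) ≠ 0 := by
      by_contra! h
      have : (17 : ℂ) = 0 := by linear_combination (h 1 + h (-1)) / 2 - h 0
      norm_num at this
    obtain ⟨w, hw⟩ := hw
    exact eventually_ne_of_differentiable (f := fun s => (α 0 + s * 1) * (α 1 + s * 2)
      + (α 2 + s * 3) * (α 3 + s * 5)) (by fun_prop) hw 0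
  have hlin := fun u v hv => eventually_add_mul_ne_zero (s := v) u hv
  filter_upwards [hlin (α 0) 1 one_ne_zero, hlin (α 1) 2 two_ne_zero, hlin (α 2) 3 three_ne_zero,
    hlin (α 3) 5 (by norm_num), hlin (α 0 - α 1) (-1) (by norm_num),
    hlin (α 0 - α 1 - (α 2 + α 3)) (-9) (by norm_num), h2] with s h0 h1 h2 h3 h4 h5 h6
  refine ⟨fun i => ?_, ?_, ?_, by simpa using h6⟩
  · fin_cases i
    · exact h0
    · exact h1
    · exact h2
    · exact h3
  · simp only [Matrix.cons_val]
    convert h4 using 1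
    ring
  · simp only [Matrix.cons_val]
    convert h5 using 1
    ring

/-- Arbitrary parameters are limits of generic ones, and a point of the dispersion surface is a limit
of points of the nearby surfaces because zeros persist under perturbation. -/
theorem isSolitonDatum_of_dispQ {α : Fin 4 → ℂ} {v : Fin N → ℂ × ℂ × ℂ}
    (hv : ∀ i, (v i).1 ≠ 0 ∧ (v i).2.1 ≠ 0 ∧ (v i).2.2 ≠ 0)
    (hQ : ∀ i, dispQ α (v i).1 (v i).2.1 (v i).2.2 = 0) : IsSolitonDatum (α, v) := by
  rcases eq_or_ne α 0 with rfl | hα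
  · intro _ d k l m
    simp [dakpNum_eq]
  obtain ⟨e₁, e₂, e₃, he⟩ := exists_dispQ_ne_zero hα
  refine isSolitonDatum_of_mem_closure (mem_closure_iff_nhds.2 fun W hW => ?_) hv
  obtain ⟨U, hU, V, hV, hW⟩ := mem_nhds_prod_iff.1 hW
  rw [nhds_pi, Filter.mem_pi] at hV
  obtain ⟨I, -, T, hT, hV⟩ := hV
  let path : Fin N → ℂ → ℂ × ℂ × ℂ := fun i t => ((v i).1 + t * (e₁ - (v i).1),
    (v i).2.1 + t * (e₂ - (v i).2.1), (v i).2.2 + t * (e₃ - (v i).2.2))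
  have hpath : ∀ i, Continuous (path i) := fun i => by unfold path; fun_prop
  have hpath0 : ∀ i, path i 0 = v i := fun i => by simp [path]
  have hroot : ∀ i, ∀ᶠ s in 𝓝 (0 : ℂ), ∃ u ∈ T i ∩ {u | u.1 ≠ 0 ∧ u.2.1 ≠ 0 ∧ u.2.2 ≠ 0},
      dispQ (fun i => α i + s * ![1, 2, 3, 5] i) u.1 u.2.1 u.2.2 = 0 := by
    intro i
    have hopen : {u : ℂ × ℂ × ℂ | u.1 ≠ 0 ∧ u.2.1 ≠ 0 ∧ u.2.2 ≠ 0} ∈ 𝓝 (v i) := by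
      have c1 : ContinuousAt (fun u : ℂ × ℂ × ℂ => u.1) (v i) := by fun_prop
      have c2 : ContinuousAt (fun u : ℂ × ℂ × ℂ => u.2.1) (v i) := by fun_prop
      have c3 : ContinuousAt (fun u : ℂ × ℂ × ℂ => u.2.2) (v i) := by fun_prop
      exact (c1.eventually_ne (hv i).1).and ((c2.eventually_ne (hv i).2.1).and
        (c3.eventually_ne (hv i).2.2))
    have := eventually_exists_zero_near (f := fun s t =>
        dispQ (fun i => α i + s * ![1, 2, 3, 5] i) (path i t).1 (path i t).2.1 (path i t).2.2)
      (p₀ := 0) (t₀ := 0) (w := 1) (by unfold Function.uncurry dispQ path; fun_prop)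
      (fun s => by unfold dispQ path; fun_prop) (by simpa [hpath0] using hQ i)
      (by simpa [path] using he) ((hpath i).continuousAt.preimage_mem_nhds
        (by rw [hpath0]; exact inter_mem (hT i) hopen))
    exact this.mono fun s ⟨t, ht, hs⟩ => ⟨path i t, ht, hs⟩
  have hα0 : ∀ᶠ s in 𝓝 (0 : ℂ), (fun i => α i + s * ![1, 2, 3, 5] i) ∈ U := by
    have : Continuous fun s : ℂ => fun i => α i + s * ![1, 2, 3, 5] i := by fun_prop
    exact this.continuousAt.preimage_mem_nhds (by simpa using hU)
  obtain ⟨s, hs, hsU, hroot⟩ := ((eventually_isGenericParam α).and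
    ((hα0.and (eventually_all.2 hroot)).filter_mono nhdsWithin_le_nhds)).exists
  choose u hu huQ using hroot
  exact ⟨(_, u), hW ⟨hsU, hV fun i _ => (hu i).1⟩,
    isSolitonDatum_of_isGenericParam hs (fun i => (hu i).2) huQ⟩

theorem isDAKPSolution_nSoliton (α : Fin 4 → ℂ) (N : ℕ) (c x y z : Fin N → ℂ)
    (h0 : ∀ i, x i ≠ 0 ∧ y i ≠ 0 ∧ z i ≠ 0) (hQ : ∀ i, dispQ α (x i) (y i) (z i) = 0)
    (hQ' : ∀ i j, i < j → dispQ α (x i * x j) (y i * y j) (z i * z j) ≠ 0) :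
    IsDAKPSolution α
      (nSoliton (fun i j => dakpR α (x i) (y i) (z i) (x j) (y j) (z j)) c x y z) :=
  isDAKPSolution_of_dakpNum
    (isSolitonDatum_of_dispQ (v := fun i => (x i, y i, z i)) h0 hQ hQ' c)

end Generic

end DualAKP

open DualAKP
theorem theorem3 :
    -- the N-soliton solution exists for all values of the parameters
    (∀ (α : Fin 4 → ℂ) (N : ℕ) (c x y z : Fin N → ℂ),
      (∀ i, x i ≠ 0 ∧ y i ≠ 0 ∧ z i ≠ 0) →
      (∀ i, dispQ α (x i) (y i) (z i) = 0) →
      (∀ i j, i < j → dispQ α (x i * x j) (y i * y j) (z i * z j) ≠ 0) →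
      IsDAKPSolution α
        (nSoliton (fun i j => dakpR α (x i) (y i) (z i) (x j) (y j) (z j)) c x y z))
    ∧
    -- nonzero parameters: gauge transformation to the parametrised equation
    (∀ (α : Fin 4 → ℂ) (a b c : ℂ), (∀ i, α i ≠ 0) →
      bkpA a b c ≠ 0 → bkpB a b c ≠ 0 → bkpC a b c ≠ 0 → bkpD a b c ≠ 0 →
      ∃ g₁ g₂ g₃ : ℂ, g₁ ≠ 0 ∧ g₂ ≠ 0 ∧ g₃ ≠ 0 ∧
        ∀ τ : LatticeFun,
          IsDAKPSolution (bkpParams a b c) τ ↔ IsDAKPSolution α (gaugeMul g₁ g₂ g₃ τ))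
    ∧
    -- the parametrised N-soliton solution, obtained from the one of BKP
    (∀ (a b c : ℂ) (N : ℕ) (p q : Fin N → ℂ),
      (∀ i, BKPRegular a (p i) (q i) ∧ BKPRegular b (p i) (q i) ∧ BKPRegular c (p i) (q i)) →
      ∀ X Y Z x y z : Fin N → ℂ,
      (∀ i, X i = bkpX a (p i) (q i)) → (∀ i, Y i = bkpX b (p i) (q i)) →
      (∀ i, Z i = bkpX c (p i) (q i)) →
      (∀ i, x i = Y i * Z i) → (∀ i, y i = X i * Z i) → (∀ i, z i = X i * Y i) →
      (∀ i, dispQ (bkpParams a b c) (x i) (y i) (z i) = 0) ∧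
      (∀ i j, i ≠ j → dispQ (bkpParams a b c) (x i * x j) (y i * y j) (z i * z j) ≠ 0 →
        dakpR (bkpParams a b c) (x i) (y i) (z i) (x j) (y j) (z j)
          = bkpR (p i) (q i) (p j) (q j)) ∧
      ((∀ i j, i < j → q i + q j ≠ 0 ∧ q i + p j ≠ 0 ∧ p i + q j ≠ 0 ∧ p i + p j ≠ 0) →
        ∀ (d : Fin N → ℂ) (R : Fin N → Fin N → ℂ),
        (∀ i j, R i j = bkpR (p i) (q i) (p j) (q j)) →
        IsBKPSolution (bkpA a b c) (bkpB a b c) (bkpC a b c) (bkpD a b c)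
          (nSoliton R d X Y Z) ∧
        nSoliton R d x y z = changeVars (fun _ => 1) (nSoliton R d X Y Z) ∧
        IsDAKPSolution (bkpParams a b c) (nSoliton R d x y z)))
    ∧
    -- every solution of the dispersion relation outside three lines has BKP Miwa coordinates
    (∀ a b c : ℂ, a ≠ 0 → b ≠ 0 → c ≠ 0 →
      bkpA a b c ≠ 0 → bkpB a b c ≠ 0 → bkpC a b c ≠ 0 → bkpD a b c ≠ 0 →
      ∀ x y z : ℂ, x ≠ 0 → y ≠ 0 → z ≠ 0 → dispQ (bkpParams a b c) x y z = 0 →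
      ¬ (x = 1 ∧ y = z) → ¬ (y = 1 ∧ x = z) → ¬ (z = 1 ∧ x = y) →
      ∃ p q : ℂ, BKPRegular a p q ∧ BKPRegular b p q ∧ BKPRegular c p q ∧
        x = bkpX b p q * bkpX c p q ∧ y = bkpX a p q * bkpX c p q ∧
        z = bkpX a p q * bkpX b p q)
    ∧
    -- one vanishing parameter: gauge transformation to the parametrised equation
    (∀ (ν : Fin 4) (α : Fin 4 → ℂ) (a b c : ℂ), (∀ i, α i = 0 ↔ i = ν) →
      akpA a b c ≠ 0 → akpB a b c ≠ 0 → akpC a b c ≠ 0 →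
      ∃ g₁ g₂ g₃ : ℂ, g₁ ≠ 0 ∧ g₂ ≠ 0 ∧ g₃ ≠ 0 ∧
        ∀ τ : LatticeFun,
          IsDAKPSolution (akpParams ν a b c) τ ↔ IsDAKPSolution α (gaugeMul g₁ g₂ g₃ τ))
    ∧
    -- the parametrised N-soliton solution, obtained from the one of AKP
    (∀ (ν : Fin 4) (a b c : ℂ) (N : ℕ) (p q : Fin N → ℂ),
      (∀ i, AKPRegular a (p i) (q i) ∧ AKPRegular b (p i) (q i) ∧ AKPRegular c (p i) (q i)) →
      ∀ X Y Z x y z : Fin N → ℂ,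
      (∀ i, X i = akpX a (p i) (q i)) → (∀ i, Y i = akpX b (p i) (q i)) →
      (∀ i, Z i = akpX c (p i) (q i)) →
      (∀ i, x i = Y i ^ reversal ν 1 * Z i ^ reversal ν 2) →
      (∀ i, y i = X i ^ reversal ν 0 * Z i ^ reversal ν 2) →
      (∀ i, z i = X i ^ reversal ν 0 * Y i ^ reversal ν 1) →
      (∀ i, dispQ (akpParams ν a b c) (x i) (y i) (z i) = 0) ∧
      (∀ i j, i ≠ j → dispQ (akpParams ν a b c) (x i * x j) (y i * y j) (z i * z j) ≠ 0 →
        dakpR (akpParams ν a b c) (x i) (y i) (z i) (x j) (y j) (z j)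
          = akpR (p i) (q i) (p j) (q j)) ∧
      ((∀ i j, i < j → p j ≠ q i ∧ p i ≠ q j) →
        ∀ (d : Fin N → ℂ) (R : Fin N → Fin N → ℂ),
        (∀ i j, R i j = akpR (p i) (q i) (p j) (q j)) →
        IsAKPSolution (akpA a b c) (akpB a b c) (akpC a b c) (nSoliton R d X Y Z) ∧
        nSoliton R d x y z = changeVars (reversal ν) (nSoliton R d X Y Z) ∧
        IsDAKPSolution (akpParams ν a b c) (nSoliton R d x y z)))
    ∧
    -- every solution of the dispersion relation outside three lines has AKP Miwa coordinates,
    -- or is a limit of such points for p, q → ∞ with q / p → t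
    (∀ (ν : Fin 4) (a b c : ℂ), akpA a b c ≠ 0 → akpB a b c ≠ 0 → akpC a b c ≠ 0 →
      ∀ x y z : ℂ, x ≠ 0 → y ≠ 0 → z ≠ 0 → dispQ (akpParams ν a b c) x y z = 0 →
      ¬ (x = 1 ∧ y = z) → ¬ (y = 1 ∧ x = z) → ¬ (z = 1 ∧ x = y) →
      (∃ p q : ℂ, AKPRegular a p q ∧ AKPRegular b p q ∧ AKPRegular c p q ∧
        x = akpX b p q ^ reversal ν 1 * akpX c p q ^ reversal ν 2 ∧
        y = akpX a p q ^ reversal ν 0 * akpX c p q ^ reversal ν 2 ∧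
        z = akpX a p q ^ reversal ν 0 * akpX b p q ^ reversal ν 1) ∨
      (∃ t : ℂ, t ≠ 0 ∧ x = t ^ reversal ν 1 * t ^ reversal ν 2 ∧
        y = t ^ reversal ν 0 * t ^ reversal ν 2 ∧
        z = t ^ reversal ν 0 * t ^ reversal ν 1)) :=
  ⟨isDAKPSolution_nSoliton, bkp_gauge, bkp_miwa,
    fun a b c ha hb hc hA hB hC _ => bkp_converse a b c ha hb hc hA hB hC, akp_gauge, akp_miwa,
    akp_converse⟩
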